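/- A directed graph is called twinless strongly connected if it has a strongly connected spanning subgraph that contains no pair of antiparallel edges $(u,v),(v,u)$; its twinless strongly connected components (TSCCs) are the maximal vertex sets inducing twinless strongly connected subgraphs. A graph $G=(V,E)$ is $2$-vertex-twinless-connected (resp. $2$-vertex-connected) if $|V|\ge 3$ and $G$, as well as $G\setminus\{x\}$ for every $x\in V$, is twinless strongly connected (resp. strongly connected). A twinless articulation point of a $2$-vertex-connected graph $H$ is a vertex $x$ such that $H\setminus\{x\}$ is not twinless strongly connected. Consider the following algorithm, whose input is a $2$-vertex-twinless-connected graph $G=(V,E)$ with $n=|V|$ and $m=|E|$. (1) Calculate a minimal $2$-vertex-connected spanning subgraph $G_{2v}=(V,E_{2v})$ of $G$. (2) Set $E_{2t}\leftarrow E_{2v}$. (3) Compute the twinless articulation points of $G_{2v}$. (4) For each twinless articulation point $x$ of $G_{2v}$: while $G_{2t}\setminus\{x\}$, where $G_{2t}=(V,E_{2t})$, is not twinless strongly connected, identify the TSCCs of $G_{2t}\setminus\{x\}$, find an edge $(v,w)\in E\setminus E_{2t}$ such that $v$ and $w$ lie in distinct TSCCs of $G_{2t}\setminus\{x\}$, and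 add $(v,w)$ to $E_{2t}$. Output $G_{2t}$. Theorem. This algorithm runs in $O(n^2m)$ time. That is, the steps of the algorithm can be implemented by subroutines for a random access machine (unit cost for each elementary operation, with addition, truncated subtraction and comparison as arithmetic) in such a way that, for an absolute constant $K$ and every $2$-vertex-twinless-connected input graph, given by $n$, $m$ and a list of its edges in any order, the algorithm halts after at most $K n^2 m$ steps; its output $G_{2t}$ is a $2$-vertex-twinless-connected spanning subgraph of $G$. -/

import Mathlib

/-! ## Directed graphs and twinless connectivity

A directed graph is a vertex type `V` with a set `E` of ordered pairs.  For `S : Set V`, the predicates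
below speak about the subgraph with vertex set `S` and all edges of `E` with both ends in `S`. -/

/-- The subgraph of `(V, E)` induced on `S` is strongly connected. -/
def StronglyConnectedOn {V : Type*} (E : Set (V × V)) (S : Set V) : Prop :=
  S.Nonempty ∧ ∀ u ∈ S, ∀ v ∈ S,
    Relation.ReflTransGen (fun a b => a ∈ S ∧ b ∈ S ∧ (a, b) ∈ E) u v

/-- No two edges of `T` are antiparallel. -/
def Twinless {V : Type*} (T : Set (V × V)) : Prop :=
  ∀ u v : V, u ≠ v → (u, v) ∈ T → (v, u) ∉ T

/-- The subgraph of `(V, E)` induced on `S` is twinless strongly connected: it has a strongly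
connected spanning subgraph without antiparallel edges. -/
def TwinlessSCOn {V : Type*} (E : Set (V × V)) (S : Set V) : Prop :=
  ∃ T ⊆ E, Twinless T ∧ StronglyConnectedOn T S

/-- `C` is (the vertex set of) a twinless strongly connected component of the subgraph of `(V, E)`
induced on `S`. -/
def IsTSCC {V : Type*} (E : Set (V × V)) (S C : Set V) : Prop :=
  Maximal (fun D : Set V => D ⊆ S ∧ TwinlessSCOn E D) C

/-- `(V, E)` is `k`-vertex-connected. -/
def IsKVertexConnected {V : Type*} [Fintype V] (k : ℕ) (E : Set (V × V)) : Prop :=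
  StronglyConnectedOn E Set.univ ∧ k + 1 ≤ Fintype.card V ∧
    ∀ U : Finset V, U.card < k → StronglyConnectedOn E ((U : Set V)ᶜ)

/-- `(V, E)` is `k`-vertex-twinless-connected. -/
def IsKVertexTwinlessConnected {V : Type*} [Fintype V] (k : ℕ) (E : Set (V × V)) : Prop :=
  TwinlessSCOn E Set.univ ∧ k + 1 ≤ Fintype.card V ∧
    ∀ U : Finset V, U.card < k → TwinlessSCOn E ((U : Set V)ᶜ)

/-- `(V, F)` is a minimal `2`-vertex-connected spanning subgraph of `(V, E)`. -/
def IsMinimalTwoVertexConnected {V : Type*} [Fintype V] (E F : Set (V × V)) : Prop :=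
  Minimal (fun D : Set (V × V) => D ⊆ E ∧ IsKVertexConnected 2 D) F

/-- `x` is a twinless articulation point of `(V, F)`: deleting `x` leaves a graph that is not
twinless strongly connected. -/
def IsTwinlessArticulationPoint {V : Type*} (F : Set (V × V)) (x : V) : Prop :=
  ¬ TwinlessSCOn F ({x}ᶜ)

/-! ## Random access machine programs with a step count

A program uses finitely many registers and finitely many arrays of natural numbers, random access
into the arrays, addition, truncated subtraction and comparison.  Every operation costs one step. -/

/-- Contents of the registers and of the arrays. -/
structure RamState where
  /-- the registers -/
  reg : ℕ → ℕ
  /-- the arrays: `arr a i` is cell `i` of array `a` -/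
  arr : ℕ → ℕ → ℕ

/-- Expressions of the programming language. -/
inductive RamExpr where
  | lit (k : ℕ)
  | reg (r : ℕ)
  | read (a : ℕ) (i : RamExpr)
  | add (e f : RamExpr)
  | sub (e f : RamExpr)
  | lt (e f : RamExpr)
  | eq (e f : RamExpr)

/-- Value of an expression; comparisons give `1` for true and `0` for false. -/
def RamExpr.eval (σ : RamState) : RamExpr → ℕ
  | .lit k => k
  | .reg r => σ.reg r
  | .read a i => σ.arr a (i.eval σ)
  | .add e f => e.eval σ + f.eval σ
  | .sub e f => e.eval σ - f.eval σ
  | .lt e f => if e.eval σ < f.eval σ then 1 else 0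
  | .eq e f => if e.eval σ = f.eval σ then 1 else 0

/-- Number of steps needed to evaluate an expression: one for each node. -/
def RamExpr.cost : RamExpr → ℕ
  | .lit _ => 1
  | .reg _ => 1
  | .read _ i => i.cost + 1
  | .add e f => e.cost + f.cost + 1
  | .sub e f => e.cost + f.cost + 1
  | .lt e f => e.cost + f.cost + 1
  | .eq e f => e.cost + f.cost + 1

/-- Programs.  A test succeeds if its value is nonzero. -/
inductive RamProg where
  | skip
  | assign (r : ℕ) (e : RamExpr)
  | write (a : ℕ) (i e : RamExpr)
  | seq (p q : RamProg)
  | ite (c : RamExpr) (p q : RamProg)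
  | loop (c : RamExpr) (p : RamProg)

/-- Register assignment. -/
def RamState.setReg (σ : RamState) (r k : ℕ) : RamState :=
  { σ with reg := Function.update σ.reg r k }

/-- Array assignment. -/
def RamState.setArr (σ : RamState) (a i k : ℕ) : RamState :=
  { σ with arr := Function.update σ.arr a (Function.update (σ.arr a) i k) }

/-- `RamExec p σ t τ`: program `p`, started in state `σ`, halts after `t` steps in state `τ`. -/
inductive RamExec : RamProg → RamState → ℕ → RamState → Prop
  | skip (σ : RamState) : RamExec .skip σ 1 σ
  | assign (r : ℕ) (e : RamExpr) (σ : RamState) :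
      RamExec (.assign r e) σ (e.cost + 1) (σ.setReg r (e.eval σ))
  | write (a : ℕ) (i e : RamExpr) (σ : RamState) :
      RamExec (.write a i e) σ (i.cost + e.cost + 1) (σ.setArr a (i.eval σ) (e.eval σ))
  | seq {p q : RamProg} {σ τ ρ : RamState} {s t : ℕ} :
      RamExec p σ s τ → RamExec q τ t ρ → RamExec (.seq p q) σ (s + t) ρ
  | iteTrue {c : RamExpr} {p q : RamProg} {σ τ : RamState} {t : ℕ} :
      c.eval σ ≠ 0 → RamExec p σ t τ → RamExec (.ite c p q) σ (c.cost + 1 + t) τ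
  | iteFalse {c : RamExpr} {p q : RamProg} {σ τ : RamState} {t : ℕ} :
      c.eval σ = 0 → RamExec q σ t τ → RamExec (.ite c p q) σ (c.cost + 1 + t) τ
  | loopTrue {c : RamExpr} {p : RamProg} {σ τ ρ : RamState} {s t : ℕ} :
      c.eval σ ≠ 0 → RamExec p σ s τ → RamExec (.loop c p) τ t ρ →
        RamExec (.loop c p) σ (c.cost + 1 + s + t) ρ
  | loopFalse {c : RamExpr} {p : RamProg} {σ : RamState} :
      c.eval σ = 0 → RamExec (.loop c p) σ (c.cost + 1) σ

/-! ## The approximation algorithm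

The vertices are `0, …, n - 1` and the input graph is given by the list of its `m` edges.  All
registers and arrays not named below are scratch space for the subroutines. -/

namespace Alg

/-- register: the number `n` of vertices -/
abbrev rN : ℕ := 0
/-- register: the number `m` of edges -/
abbrev rM : ℕ := 1
/-- register: the vertex `x` of the for-loop -/
abbrev rX : ℕ := 2
/-- register: nonzero if `G_{2t} ∖ {x}` is not twinless strongly connected -/
abbrev rFlag : ℕ := 3
/-- register: position in the list of the edge that was found -/
abbrev rPick : ℕ := 4
/-- register: counter of the copying loop -/
abbrev rI : ℕ := 5
/-- array: tails of the edges -/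
abbrev aSrc : ℕ := 0
/-- array: heads of the edges -/
abbrev aDst : ℕ := 1
/-- array: characteristic vector of `E_{2v}` -/
abbrev aE2v : ℕ := 2
/-- array: characteristic vector of `E_{2t}` -/
abbrev aE2t : ℕ := 3
/-- array: characteristic vector of the set of twinless articulation points -/
abbrev aTap : ℕ := 4
/-- array: for every vertex a label of its twinless strongly connected component -/
abbrev aComp : ℕ := 5

/-- Programs for those lines of the algorithm that are not elementary. -/
structure Subroutines where
  /-- calculate a minimal `2`-vertex-connected subgraph `(V, E_{2v})` -/
  minimalTwoVC : RamProg
  /-- compute the twinless articulation points of `(V, E_{2v})` -/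
  articulationPoints : RamProg
  /-- decide whether `G_{2t} ∖ {x}` is not twinless strongly connected -/
  testNotTSC : RamProg
  /-- identify the twinless strongly connected components of `G_{2t} ∖ {x}` -/
  components : RamProg
  /-- find an edge of `E ∖ E_{2t}` between distinct components -/
  findEdge : RamProg

/-- `E_{2t} ← E_{2v}` -/
def copyEdges : RamProg :=
  .seq (.assign rI (.lit 0))
    (.loop (.lt (.reg rI) (.reg rM))
      (.seq (.write aE2t (.reg rI) (.read aE2v (.reg rI)))
        (.assign rI (.add (.reg rI) (.lit 1)))))

/-- The while-loop for the vertex `x`: as long as `G_{2t} ∖ {x}` is not twinless strongly connected,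
identify its components, find an edge between two of them, and add this edge to `E_{2t}`. -/
def whileLoop (P : Subroutines) : RamProg :=
  .seq P.testNotTSC
    (.loop (.reg rFlag)
      (.seq P.components
        (.seq P.findEdge
          (.seq (.write aE2t (.reg rPick) (.lit 1))
            P.testNotTSC))))

/-- The for-loop over all twinless articulation points `x` of `(V, E_{2v})`. -/
def forLoop (P : Subroutines) : RamProg :=
  .seq (.assign rX (.lit 0))
    (.loop (.lt (.reg rX) (.reg rN))
      (.seq (.ite (.read aTap (.reg rX)) (whileLoop P) .skip)
        (.assign rX (.add (.reg rX) (.lit 1)))))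

/-- The approximation algorithm. -/
def approx (P : Subroutines) : RamProg :=
  .seq P.minimalTwoVC (.seq copyEdges (.seq P.articulationPoints (forLoop P)))

/-- Initial state: `n`, `m` and the edge list; everything else is zero. -/
def initState (n : ℕ) (L : List (Fin n × Fin n)) : RamState where
  reg r := if r = rN then n else if r = rM then L.length else 0
  arr a i := if h : i < L.length then
      (if a = aSrc then (L[i].1 : ℕ) else if a = aDst then (L[i].2 : ℕ) else 0)
    else 0

/-- The state contains the graph with edge list `L`. -/
def StoresGraph {n : ℕ} (L : List (Fin n × Fin n)) (σ : RamState) : Prop :=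
  σ.reg rN = n ∧ σ.reg rM = L.length ∧
    ∀ (i : ℕ) (h : i < L.length), σ.arr aSrc i = (L[i].1 : ℕ) ∧ σ.arr aDst i = (L[i].2 : ℕ)

/-- Array `a` is the characteristic vector (nonzero meaning "yes") of the edge set `F`. -/
def StoresEdges {n : ℕ} (L : List (Fin n × Fin n)) (a : ℕ) (F : Set (Fin n × Fin n))
    (σ : RamState) : Prop :=
  ∀ (i : ℕ) (h : i < L.length), σ.arr a i ≠ 0 ↔ L[i] ∈ F

/-- `σ` and `τ` agree on the given registers and arrays. -/
def Keeps (regs arrs : List ℕ) (σ τ : RamState) : Prop :=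
  (∀ r ∈ regs, τ.reg r = σ.reg r) ∧ ∀ a ∈ arrs, τ.arr a = σ.arr a

/-- Started in any state satisfying `Pre`, the program halts, and the initial and the final state are
related by `Post`. -/
def Correct (p : RamProg) (Pre : RamState → Prop) (Post : RamState → RamState → Prop) : Prop :=
  ∀ σ, Pre σ → ∃ t τ, RamExec p σ t τ ∧ Post σ τ

/-- The edge set of an edge list. -/
def edgeSet {n : ℕ} (L : List (Fin n × Fin n)) : Set (Fin n × Fin n) := {e | e ∈ L}

/-- The situation inside the for-loop: `E2v` is the minimal `2`-vertex-connected subgraph, `F` the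
current value of `E_{2t}`, and `x` the current twinless articulation point of `(V, E2v)`. -/
def InLoop {n : ℕ} (L : List (Fin n × Fin n)) (E2v F : Set (Fin n × Fin n)) (x : Fin n)
    (σ : RamState) : Prop :=
  StoresGraph L σ ∧
  IsMinimalTwoVertexConnected (edgeSet L) E2v ∧ StoresEdges L aE2v E2v σ ∧
  E2v ⊆ F ∧ F ⊆ edgeSet L ∧ StoresEdges L aE2t F σ ∧
  IsTwinlessArticulationPoint E2v x ∧ σ.reg rX = x

/-- The labels in `aComp` identify the twinless strongly connected components of `(V, F) ∖ {x}`. -/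
def StoresComponents {n : ℕ} (F : Set (Fin n × Fin n)) (x : Fin n) (σ : RamState) : Prop :=
  ∀ v w : Fin n, v ≠ x → w ≠ x →
    (σ.arr aComp v = σ.arr aComp w ↔ ∃ C, IsTSCC F ({x}ᶜ) C ∧ v ∈ C ∧ w ∈ C)

/-- Every subroutine does what the corresponding line of the algorithm asks for, on every input graph
of the algorithm and whenever control can reach that line, and does not touch the variables of the
algorithm that are still needed. -/
structure Subroutines.Correct (P : Subroutines) : Prop where
  minimalTwoVC : ∀ (n : ℕ) (L : List (Fin n × Fin n)), L.Nodup →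
    IsKVertexTwinlessConnected 2 (edgeSet L) →
    Alg.Correct P.minimalTwoVC (StoresGraph L) (fun σ τ =>
      Keeps [rN, rM] [aSrc, aDst] σ τ ∧
      ∃ E2v, IsMinimalTwoVertexConnected (edgeSet L) E2v ∧ StoresEdges L aE2v E2v τ)
  articulationPoints : ∀ (n : ℕ) (L : List (Fin n × Fin n)), L.Nodup →
    IsKVertexTwinlessConnected 2 (edgeSet L) →
    ∀ E2v, IsMinimalTwoVertexConnected (edgeSet L) E2v →
    Alg.Correct P.articulationPoints
      (fun σ => StoresGraph L σ ∧ StoresEdges L aE2v E2v σ)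
      (fun σ τ =>
        Keeps [rN, rM] [aSrc, aDst, aE2v, aE2t] σ τ ∧
        ∀ x : Fin n, τ.arr aTap x ≠ 0 ↔ IsTwinlessArticulationPoint E2v x)
  testNotTSC : ∀ (n : ℕ) (L : List (Fin n × Fin n)), L.Nodup →
    IsKVertexTwinlessConnected 2 (edgeSet L) → ∀ E2v F x,
    Alg.Correct P.testNotTSC (InLoop L E2v F x) (fun σ τ =>
      Keeps [rN, rM, rX] [aSrc, aDst, aE2v, aE2t, aTap] σ τ ∧
      (τ.reg rFlag ≠ 0 ↔ ¬ TwinlessSCOn F ({x}ᶜ)))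
  components : ∀ (n : ℕ) (L : List (Fin n × Fin n)), L.Nodup →
    IsKVertexTwinlessConnected 2 (edgeSet L) → ∀ E2v F x,
    ¬ TwinlessSCOn F ({x}ᶜ) →
    Alg.Correct P.components (InLoop L E2v F x) (fun σ τ =>
      Keeps [rN, rM, rX] [aSrc, aDst, aE2v, aE2t, aTap] σ τ ∧ StoresComponents F x τ)
  findEdge : ∀ (n : ℕ) (L : List (Fin n × Fin n)), L.Nodup →
    IsKVertexTwinlessConnected 2 (edgeSet L) → ∀ E2v F x,
    ¬ TwinlessSCOn F ({x}ᶜ) →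
    Alg.Correct P.findEdge (fun σ => InLoop L E2v F x σ ∧ StoresComponents F x σ) (fun σ τ =>
      Keeps [rN, rM, rX] [aSrc, aDst, aE2v, aE2t, aTap] σ τ ∧
      ∃ h : τ.reg rPick < L.length, L[τ.reg rPick] ∉ F ∧
        ∃ C D, IsTSCC F ({x}ᶜ) C ∧ IsTSCC F ({x}ᶜ) D ∧ C ≠ D ∧
          L[τ.reg rPick].1 ∈ C ∧ L[τ.reg rPick].2 ∈ D)

end Alg

/-! ## Programs with bounded loops

A sublanguage of the machine language in which every loop is a counting loop with a bound that depends
only on `n` and `m`.  Its programs have a total denotation and a syntactic bound on the running time. -/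

/-! A strongly connected digraph is twinless strongly connected exactly if no bridge of its
underlying undirected graph separates two vertices, and its TSCCs are the classes of vertices not
separated by bridges. `BridgeCut` and `SameSide` express this by vertex sets whose boundary is
crossed by at most one pair. A twinless strongly connected subgraph crosses every cut in both
directions, which takes two pairs (`TwinlessSCOn.sameSide`). Conversely, in a strongly connected
subgraph that is minimal among those keeping an orientation of every adjacent pair, antiparallel
edges occur at bridges only (`StronglyConnectedOn.exists_subgraph`); and a walk that leaves a class
over a bridge returns at the same vertex, so it can be shortcut
(`StronglyConnectedOn.twinlessSCOn_sameSide`).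

In the loop, the current graph minus `x` contains the strongly connected graph `E_{2v}` minus `x`.
Its classes are read off a breadth-first tree: bridges are tree edges, and a tree edge is a bridge
if and only if no other adjacency leaves the subtree below it (`label_eq_iff`). With matrices this
takes `O(n²)` steps. As long as a bridge remains, some input edge not yet chosen crosses it
(`exists_edge_not_sameSide`), so the while-loop never gets stuck. If all vertex-deleted subgraphs
are twinless strongly connected, so is the graph (`twinlessSCOn_univ_of_compl`).

The minimal subgraph results from one pass that tries to drop every edge. An edge `(u, v)` can be
dropped if and only if no third vertex separates `v` from `u` in the rest
(`IsKVertexConnected.diff_singleton_iff`). If `v` is still reachable, such a vertex lies on the tree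
path from `u` to `v`, and a single scan along this path detects it in `O(n²)` steps
(`ScanState.reachAvoid_iff`).

All subroutines use counting loops only, which yields termination and a syntactic time bound
(`ForProg.exec_compile`, `ForProg.cost_le`). There are `m` trial deletions, `n` articulation tests
and `n` first tests of the while-loop. Each pass of the while-loop adds an edge that is never
removed, so all vertices together cause at most `m` passes (`exec_while`, `exec_for`). Each item
costs `O(n²)`, and `n ≤ m`. -/

@[simp] theorem RamState.reg_setReg (σ : RamState) (r k r' : ℕ) :
    (σ.setReg r k).reg r' = if r' = r then k else σ.reg r' := by
  simp [RamState.setReg, Function.update_apply]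

@[simp] theorem RamState.arr_setReg (σ : RamState) (r k : ℕ) : (σ.setReg r k).arr = σ.arr := rfl

@[simp] theorem RamState.reg_setArr (σ : RamState) (a i k : ℕ) : (σ.setArr a i k).reg = σ.reg := rfl

@[simp] theorem RamState.arr_setArr (σ : RamState) (a i k a' : ℕ) :
    (σ.setArr a i k).arr a' = if a' = a then Function.update (σ.arr a) i k else σ.arr a' := by
  simp [RamState.setArr, Function.update_apply]

/-- Bounds of counting loops. -/
inductive LoopBound where
  | verts
  | edges
  | twiceVerts

namespace LoopBound

/-- The bound as an expression. -/
def expr : LoopBound → RamExpr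
  | verts => .reg Alg.rN
  | edges => .reg Alg.rM
  | twiceVerts => .add (.reg Alg.rN) (.reg Alg.rN)

/-- The value of the bound. -/
def val (n m : ℕ) : LoopBound → ℕ
  | verts => n
  | edges => m
  | twiceVerts => n + n

theorem eval_expr (b : LoopBound) (σ : RamState) :
    b.expr.eval σ = b.val (σ.reg Alg.rN) (σ.reg Alg.rM) := by cases b <;> rfl

theorem cost_expr_le (b : LoopBound) : b.expr.cost ≤ 3 := by cases b <;> decide

end LoopBound

/-- Programs with counting loops only. -/
inductive ForProg where
  | skip
  | assign (r : ℕ) (e : RamExpr)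
  | write (a : ℕ) (i e : RamExpr)
  | seq (p q : ForProg)
  | ite (c : RamExpr) (p q : ForProg)
  | count (r : ℕ) (b : LoopBound) (p : ForProg)

/-- Apply `f 0`, `f 1`, …, `f (N - 1)` one after the other. -/
def iterUpTo {α : Type*} (f : ℕ → α → α) : ℕ → α → α
  | 0, x => x
  | N + 1, x => f N (iterUpTo f N x)

namespace ForProg

/-- Translation into the machine language. -/
def compile : ForProg → RamProg
  | skip => .skip
  | assign r e => .assign r e
  | write a i e => .write a i e
  | seq p q => .seq p.compile q.compile
  | ite c p q => .ite c p.compile q.compile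
  | count r b p => .seq (.assign r (.lit 0))
      (.loop (.lt (.reg r) b.expr) (.seq p.compile (.assign r (.add (.reg r) (.lit 1)))))

/-- The state transformation performed by a program. -/
def den : ForProg → RamState → RamState
  | skip, σ => σ
  | assign r e, σ => σ.setReg r (e.eval σ)
  | write a i e, σ => σ.setArr a (i.eval σ) (e.eval σ)
  | seq p q, σ => q.den (p.den σ)
  | ite c p q, σ => if c.eval σ ≠ 0 then p.den σ else q.den σ
  | count r b p, σ => iterUpTo (fun k τ => (p.den τ).setReg r (k + 1))
      (b.val (σ.reg Alg.rN) (σ.reg Alg.rM)) (σ.setReg r 0)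

/-- The registers that a program may change. -/
def regs : ForProg → List ℕ
  | skip => []
  | assign r _ => [r]
  | write _ _ _ => []
  | seq p q => p.regs ++ q.regs
  | ite _ p q => p.regs ++ q.regs
  | count r _ p => r :: p.regs

/-- The arrays that a program may change. -/
def arrs : ForProg → List ℕ
  | skip => []
  | assign _ _ => []
  | write a _ _ => [a]
  | seq p q => p.arrs ++ q.arrs
  | ite _ p q => p.arrs ++ q.arrs
  | count _ _ p => p.arrs

/-- No loop changes its own counter, and `n` and `m` are never changed. -/
def ok : ForProg → Bool
  | skip => true
  | assign r _ => r ≠ Alg.rN && r ≠ Alg.rM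
  | write _ _ _ => true
  | seq p q => p.ok && q.ok
  | ite _ p q => p.ok && q.ok
  | count r _ p => r ≠ Alg.rN && r ≠ Alg.rM && r ∉ p.regs && p.ok

/-- Upper bound on the running time. -/
def cost (n m : ℕ) : ForProg → ℕ
  | skip => 1
  | assign _ e => e.cost + 1
  | write _ i e => i.cost + e.cost + 1
  | seq p q => p.cost n m + q.cost n m
  | ite c p q => c.cost + 1 + p.cost n m + q.cost n m
  | count _ b p => 8 + b.val n m * (p.cost n m + 10)

/-- Exponent of the polynomial bound on the running time in terms of `n`, where `m ≤ n ^ 2`. -/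
def deg : ForProg → ℕ
  | skip => 0
  | assign _ _ => 0
  | write _ _ _ => 0
  | seq p q => max p.deg q.deg
  | ite _ p q => max p.deg q.deg
  | count _ .edges p => p.deg + 2
  | count _ _ p => p.deg + 1

/-- Coefficient of the polynomial bound on the running time. -/
def coeff : ForProg → ℕ
  | skip => 1
  | assign _ e => e.cost + 1
  | write _ i e => i.cost + e.cost + 1
  | seq p q => p.coeff + q.coeff
  | ite c p q => c.cost + 1 + p.coeff + q.coeff
  | count _ _ p => 8 + 2 * (p.coeff + 10)

/-- `τ` differs from `σ` only in registers and arrays that `p` may change. -/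
structure Frame (p : ForProg) (σ τ : RamState) : Prop where
  reg : ∀ r, r ∉ p.regs → τ.reg r = σ.reg r
  arr : ∀ a, a ∉ p.arrs → τ.arr a = σ.arr a

/-- The write sets are read off the syntax, so for a concrete program it is a mere computation that
some register or array is untouched. -/
theorem frame_den (p : ForProg) : ∀ σ, p.Frame σ (p.den σ) := by
  induction p with
  | skip => exact fun σ => ⟨fun _ _ => rfl, fun _ _ => rfl⟩
  | assign r e =>
    refine fun σ => ⟨fun r' h => ?_, fun _ _ => rfl⟩
    simp only [regs, List.mem_singleton] at h
    simp [den, h]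
  | write a i e =>
    refine fun σ => ⟨fun _ _ => rfl, fun a' h => ?_⟩
    simp only [arrs, List.mem_singleton] at h
    simp [den, h]
  | seq p q hp hq =>
    refine fun σ => ⟨fun r h => ?_, fun a h => ?_⟩
    · simp only [regs, List.mem_append, not_or] at h
      exact ((hq _).reg r h.2).trans ((hp σ).reg r h.1)
    · simp only [arrs, List.mem_append, not_or] at h
      exact ((hq _).arr a h.2).trans ((hp σ).arr a h.1)
  | ite c p q hp hq =>
    refine fun σ => ⟨fun r h => ?_, fun a h => ?_⟩
    · simp only [regs, List.mem_append, not_or] at h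
      simp only [den]
      split_ifs
      exacts [(hp σ).reg r h.1, (hq σ).reg r h.2]
    · simp only [arrs, List.mem_append, not_or] at h
      simp only [den]
      split_ifs
      exacts [(hp σ).arr a h.1, (hq σ).arr a h.2]
  | count r b p hp =>
    intro σ
    simp only [den]
    generalize b.val (σ.reg Alg.rN) (σ.reg Alg.rM) = N
    induction N with
    | zero =>
      refine ⟨fun r' h => ?_, fun _ _ => rfl⟩
      simp only [regs, List.mem_cons, not_or] at h
      simp [iterUpTo, h.1]
    | succ N ih =>
      refine ⟨fun r' h => ?_, fun a h => ?_⟩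
      · have h' := h
        simp only [regs, List.mem_cons, not_or] at h'
        simp only [iterUpTo, RamState.reg_setReg, h'.1, if_false]
        exact ((hp _).reg r' h'.2).trans (ih.reg r' h)
      · simp only [iterUpTo, RamState.arr_setReg]
        exact ((hp _).arr a h).trans (ih.arr a h)

/-- Because `n` and `m` keep their values, the bound that `den` evaluates once agrees with the bound
that the compiled loop evaluates at every test. -/
theorem ok_regs (p : ForProg) (h : p.ok = true) : Alg.rN ∉ p.regs ∧ Alg.rM ∉ p.regs := by
  induction p with
  | skip => simp [regs]
  | assign r e =>
    simp only [ok, Bool.and_eq_true, decide_eq_true_eq] at h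
    simp only [regs, List.mem_singleton]
    exact ⟨Ne.symm h.1, Ne.symm h.2⟩
  | write a i e => simp [regs]
  | seq p q hp hq =>
    simp only [ok, Bool.and_eq_true] at h
    simp only [regs, List.mem_append, not_or]
    exact ⟨⟨(hp h.1).1, (hq h.2).1⟩, (hp h.1).2, (hq h.2).2⟩
  | ite c p q hp hq =>
    simp only [ok, Bool.and_eq_true] at h
    simp only [regs, List.mem_append, not_or]
    exact ⟨⟨(hp h.1).1, (hq h.2).1⟩, (hp h.1).2, (hq h.2).2⟩
  | count r b p hp =>
    simp only [ok, Bool.and_eq_true, decide_eq_true_eq] at h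
    simp only [regs, List.mem_cons, not_or]
    exact ⟨⟨Ne.symm h.1.1.1, (hp h.2).1⟩, Ne.symm h.1.1.2, (hp h.2).2⟩

theorem den_rN {p : ForProg} (h : p.ok = true) (σ : RamState) :
    (p.den σ).reg Alg.rN = σ.reg Alg.rN := (p.frame_den σ).reg _ (p.ok_regs h).1

theorem den_rM {p : ForProg} (h : p.ok = true) (σ : RamState) :
    (p.den σ).reg Alg.rM = σ.reg Alg.rM := (p.frame_den σ).reg _ (p.ok_regs h).2

/-- Invariant rule for counting loops; the counter and the unchanged part of the state are tracked
automatically. -/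
theorem count_rule {r : ℕ} {b : LoopBound} {p : ForProg} {σ : RamState}
    (I : ℕ → RamState → Prop) (h0 : I 0 (σ.setReg r 0))
    (hs : ∀ k < b.val (σ.reg Alg.rN) (σ.reg Alg.rM), ∀ τ, (count r b p).Frame σ τ → τ.reg r = k →
      I k τ → I (k + 1) ((p.den τ).setReg r (k + 1))) :
    I (b.val (σ.reg Alg.rN) (σ.reg Alg.rM)) ((count r b p).den σ) := by
  simp only [den]
  generalize b.val (σ.reg Alg.rN) (σ.reg Alg.rM) = M at hs ⊢
  suffices H : ∀ N ≤ M,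
      let τ := iterUpTo (fun k τ => (p.den τ).setReg r (k + 1)) N (σ.setReg r 0)
      (count r b p).Frame σ τ ∧ τ.reg r = N ∧ I N τ from (H M le_rfl).2.2
  intro N
  induction N with
  | zero =>
    intro _
    refine ⟨⟨fun r' h => ?_, fun _ _ => rfl⟩, by simp [iterUpTo], h0⟩
    simp only [regs, List.mem_cons, not_or] at h
    simp [iterUpTo, h.1]
  | succ N ih =>
    intro hN
    obtain ⟨hF, hr, hI⟩ := ih (by omega)
    refine ⟨⟨fun r' h => ?_, fun a h => ?_⟩, by simp [iterUpTo], hs N (by omega) _ hF hr hI⟩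
    · have h' := h
      simp only [regs, List.mem_cons, not_or] at h'
      simp only [iterUpTo, RamState.reg_setReg, h'.1, if_false]
      exact ((p.frame_den _).reg r' h'.2).trans (hF.reg r' h)
    · simp only [iterUpTo, RamState.arr_setReg]
      exact ((p.frame_den _).arr a h).trans (hF.arr a h)

/-- Induction on the number `d` of remaining rounds; `f` lists the states at the beginnings of the
rounds. A test costs at most 6 and an increment 4, hence `p.cost n m + 10` per round and 6 for the
failing test. -/
theorem loop_exec {r : ℕ} {b : LoopBound} {p : ForProg} {n m : ℕ} (hr : r ∉ p.regs)
    (hok : p.ok = true) (hrN : r ≠ Alg.rN) (hrM : r ≠ Alg.rM)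
    (hp : ∀ σ : RamState, σ.reg Alg.rN = n → σ.reg Alg.rM = m →
      ∃ t, RamExec p.compile σ t (p.den σ) ∧ t ≤ p.cost n m) :
    ∀ (d k : ℕ) (f : ℕ → RamState) (σ : RamState), k + d = b.val n m → σ = f k →
      (∀ i, f (i + 1) = (p.den (f i)).setReg r (i + 1)) →
      σ.reg Alg.rN = n → σ.reg Alg.rM = m → σ.reg r = k →
      ∃ t, RamExec (.loop (.lt (.reg r) b.expr)
        (.seq p.compile (.assign r (.add (.reg r) (.lit 1))))) σ t (f (b.val n m)) ∧
        t ≤ 6 + d * (p.cost n m + 10) := by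
  intro d
  induction d with
  | zero =>
    intro k f σ hk hσ _ hN hM hrk
    refine ⟨(RamExpr.lt (.reg r) b.expr).cost + 1, ?_, ?_⟩
    · rw [← hk, show f (k + 0) = σ from hσ.symm]
      apply RamExec.loopFalse
      simp only [RamExpr.eval, b.eval_expr, hN, hM, hrk, ← hk]
      simp
    · have := b.cost_expr_le
      simp only [RamExpr.cost]
      omega
  | succ d ih =>
    intro k f σ hk hσ hf hN hM hrk
    obtain ⟨s, hs, hsc⟩ := hp σ hN hM
    have hrp : (p.den σ).reg r = k := by rw [(p.frame_den σ).reg r hr, hrk]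
    obtain ⟨t, ht, htc⟩ := ih (k + 1) f ((p.den σ).setReg r (k + 1)) (by omega)
      (by rw [hf, hσ]) hf
      (by simp only [RamState.reg_setReg, Ne.symm hrN, if_false]; rw [den_rN hok, hN])
      (by simp only [RamState.reg_setReg, Ne.symm hrM, if_false]; rw [den_rM hok, hM])
      (by simp)
    refine ⟨_, RamExec.loopTrue (t := t) ?_ (RamExec.seq hs (RamExec.assign _ _ _)) ?_, ?_⟩
    · simp only [RamExpr.eval, b.eval_expr, hN, hM, hrk, ← hk]
      simp
    · simpa only [RamExpr.eval, hrp] using ht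
    · have := b.cost_expr_le
      simp only [RamExpr.cost]
      have : (d + 1) * (p.cost n m + 10) = d * (p.cost n m + 10) + (p.cost n m + 10) := by ring
      omega

/-- The compiled program computes the denotation within the stated time. -/
theorem exec_compile (n m : ℕ) : ∀ p : ForProg, p.ok = true → ∀ σ : RamState, σ.reg Alg.rN = n →
    σ.reg Alg.rM = m → ∃ t, RamExec p.compile σ t (p.den σ) ∧ t ≤ p.cost n m := by
  intro p
  induction p with
  | skip => exact fun _ σ _ _ => ⟨1, RamExec.skip σ, le_rfl⟩
  | assign r e => exact fun _ σ _ _ => ⟨_, RamExec.assign r e σ, le_rfl⟩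
  | write a i e => exact fun _ σ _ _ => ⟨_, RamExec.write a i e σ, le_rfl⟩
  | seq p q hp hq =>
    intro h σ hN hM
    simp only [ok, Bool.and_eq_true] at h
    obtain ⟨s, hs, hsc⟩ := hp h.1 σ hN hM
    obtain ⟨t, ht, htc⟩ := hq h.2 (p.den σ) (by rw [den_rN h.1, hN]) (by rw [den_rM h.1, hM])
    exact ⟨_, RamExec.seq hs ht, by simp only [cost]; omega⟩
  | ite c p q hp hq =>
    intro h σ hN hM
    simp only [ok, Bool.and_eq_true] at h
    simp only [den, cost, compile]
    by_cases hc : c.eval σ ≠ 0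
    · obtain ⟨s, hs, hsc⟩ := hp h.1 σ hN hM
      rw [if_pos hc]
      exact ⟨_, RamExec.iteTrue hc hs, by omega⟩
    · obtain ⟨s, hs, hsc⟩ := hq h.2 σ hN hM
      rw [if_neg hc]
      exact ⟨_, RamExec.iteFalse (not_not.mp hc) hs, by omega⟩
  | count r b p hp =>
    intro h σ hN hM
    simp only [ok, Bool.and_eq_true, decide_eq_true_eq] at h
    obtain ⟨t, ht, htc⟩ := loop_exec (b := b) h.1.2 h.2 h.1.1.1 h.1.1.2 (hp h.2) (b.val n m) 0
      (fun N => iterUpTo (fun k τ => (p.den τ).setReg r (k + 1)) N (σ.setReg r 0)) (σ.setReg r 0)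
      (by omega) rfl (fun _ => rfl)
      (by simp only [RamState.reg_setReg, Ne.symm h.1.1.1, if_false, hN])
      (by simp only [RamState.reg_setReg, Ne.symm h.1.1.2, if_false, hM]) (by simp)
    refine ⟨(RamExpr.lit 0).cost + 1 + t, RamExec.seq (RamExec.assign _ _ _) ?_, ?_⟩
    · simp only [den, hN, hM]
      exact ht
    · simp only [cost, RamExpr.cost]
      omega

/-- An edge loop counts as two powers of `n` because `m ≤ n ^ 2`, the factor 2 in `coeff` covers the
bound `n + n`, and additive constants are absorbed since `1 ≤ n`. -/
theorem cost_le {n m : ℕ} (hn : 1 ≤ n) (hm : m ≤ n ^ 2) (p : ForProg) :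
    p.cost n m ≤ p.coeff * n ^ p.deg := by
  have one : ∀ d, 1 ≤ n ^ d := fun d => Nat.one_le_pow _ _ hn
  have key : ∀ k c d e v : ℕ, c ≤ k * n ^ d → v ≤ 2 * n ^ e →
      8 + v * (c + 10) ≤ (8 + 2 * (k + 10)) * n ^ (d + e) := by
    intro k c d e v h1 h2
    have h3 : c + 10 ≤ (k + 10) * n ^ d := by nlinarith [one d]
    have h4 := Nat.mul_le_mul h2 h3
    have h5 : 2 * n ^ e * ((k + 10) * n ^ d) = 2 * (k + 10) * n ^ (d + e) := by rw [pow_add]; ring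
    nlinarith [one (d + e)]
  have two : ∀ a b d e : ℕ, a * n ^ d + b * n ^ e ≤ (a + b) * n ^ max d e := by
    intro a b d e
    rw [add_mul]
    gcongr <;> simp
  induction p with
  | skip => simp [cost, coeff, deg]
  | assign r e => simp [cost, coeff, deg]
  | write a i e => simp [cost, coeff, deg]
  | seq p q hp hq =>
    simp only [cost, coeff, deg]
    exact (Nat.add_le_add hp hq).trans (two _ _ _ _)
  | ite c p q hp hq =>
    simp only [cost, coeff, deg]
    have := two p.coeff q.coeff p.deg q.deg
    nlinarith [one (max p.deg q.deg)]
  | count r b p hp =>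
    cases b with
    | verts => exact key _ _ _ 1 _ hp (by simp [LoopBound.val]; omega)
    | edges => exact key _ _ _ 2 _ hp (by simp [LoopBound.val]; omega)
    | twiceVerts => exact key _ _ _ 1 _ hp (by simp [LoopBound.val]; omega)

end ForProg

/-! ## Bridge cuts and twinless strongly connected components -/

section Twinless

variable {V : Type*} {E F T : Set (V × V)} {S X D : Set V}

/-- Reachability inside `S` along edges of `E`. -/
abbrev ReachIn (E : Set (V × V)) (S : Set V) : V → V → Prop :=
  Relation.ReflTransGen (fun a b => a ∈ S ∧ b ∈ S ∧ (a, b) ∈ E)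

/-- At most one pair of adjacent vertices of `S` is separated by `X`. -/
def BridgeCut (E : Set (V × V)) (S X : Set V) : Prop :=
  ∃ a b, ∀ p ∈ S, ∀ q ∈ S, (p, q) ∈ E → ¬ (p ∈ X ↔ q ∈ X) → (p, q) = (a, b) ∨ (p, q) = (b, a)

/-- `v` and `w` lie on the same side of every bridge. -/
def SameSide (E : Set (V × V)) (S : Set V) (v w : V) : Prop :=
  ∀ X, BridgeCut E S X → (v ∈ X ↔ w ∈ X)

theorem SameSide.rfl' {v : V} : SameSide E S v v := fun _ _ => Iff.rfl

theorem SameSide.symm {v w : V} (h : SameSide E S v w) : SameSide E S w v :=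
  fun X hX => (h X hX).symm

theorem SameSide.trans {u v w : V} (h : SameSide E S u v) (h' : SameSide E S v w) :
    SameSide E S u w := fun X hX => (h X hX).trans (h' X hX)

theorem BridgeCut.compl (h : BridgeCut E S X) : BridgeCut E S Xᶜ := by
  obtain ⟨a, b, h⟩ := h
  refine ⟨a, b, fun p hp q hq hpq hX => h p hp q hq hpq ?_⟩
  simp only [Set.mem_compl_iff] at hX
  tauto

/-- A walk that leaves `X` uses an edge that leaves `X`. -/
theorem exists_edge_of_reach {R : V → V → Prop} {u v : V} (h : Relation.ReflTransGen R u v)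
    (hu : u ∈ X) (hv : v ∉ X) : ∃ p q, R p q ∧ p ∈ X ∧ q ∉ X := by
  induction h with
  | refl => exact absurd hu hv
  | @tail b c _ hbc ih =>
    by_cases hb : b ∈ X
    · exact ⟨b, c, hbc, hb, hv⟩
    · exact ih hb

theorem StronglyConnectedOn.mono (h : StronglyConnectedOn E S) (hEF : E ⊆ F) :
    StronglyConnectedOn F S :=
  ⟨h.1, fun u hu v hv =>
    Relation.ReflTransGen.mono (fun _ _ hab => ⟨hab.1, hab.2.1, hEF hab.2.2⟩) _ _ (h.2 u hu v hv)⟩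

theorem TwinlessSCOn.mono (h : TwinlessSCOn E S) (hEF : E ⊆ F) : TwinlessSCOn F S := by
  obtain ⟨T, hT, h⟩ := h
  exact ⟨T, hT.trans hEF, h⟩

theorem TwinlessSCOn.stronglyConnectedOn (h : TwinlessSCOn E S) : StronglyConnectedOn E S := by
  obtain ⟨T, hT, _, h⟩ := h
  exact h.mono hT

/-- A twinless strongly connected set lies on one side of every bridge. -/
theorem TwinlessSCOn.sameSide (h : TwinlessSCOn E D) (hDS : D ⊆ S) {v w : V} (hv : v ∈ D)
    (hw : w ∈ D) : SameSide E S v w := by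
  suffices H : ∀ X, BridgeCut E S X → ∀ v ∈ D, ∀ w ∈ D, v ∈ X → w ∈ X from
    fun X hX => ⟨H X hX v hv w hw, H X hX w hw v hv⟩
  clear hv hw v w
  intro X ⟨a, b, hX⟩ v hv w hw hvX
  by_contra hwX
  obtain ⟨T, hTE, hT, hTD⟩ := h
  -- `T` crosses the cut in both directions, but only one pair is available, so the two crossing
  -- edges are antiparallel.
  obtain ⟨p, q, ⟨hp, hq, hpq⟩, hpX, hqX⟩ := exists_edge_of_reach (hTD.2 v hv w hw) hvX hwX
  obtain ⟨r, s, ⟨hr, hs, hrs⟩, hrX, hsX⟩ :=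
    exists_edge_of_reach (X := Xᶜ) (hTD.2 w hw v hv) hwX (not_not.mpr hvX)
  have hsX' : s ∈ X := not_not.mp hsX
  have h1 := hX p (hDS hp) q (hDS hq) (hTE hpq) (by tauto)
  have h2 := hX r (hDS hr) s (hDS hs) (hTE hrs) (by rw [Set.mem_compl_iff] at hrX; tauto)
  have hne : p ≠ q := fun h => hqX (h ▸ hpX)
  have : (r, s) = (q, p) := by
    simp only [Prod.mk.injEq] at h1 h2 ⊢
    rcases h1 with ⟨rfl, rfl⟩ | ⟨rfl, rfl⟩ <;> rcases h2 with ⟨rfl, rfl⟩ | ⟨rfl, rfl⟩ <;>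
      first | exact ⟨rfl, rfl⟩ | exact absurd hpX hrX
  rw [this] at hrs
  exact hT p q hne hpq hrs

/-- If an edge cannot be dropped from a strongly connected graph, then it is the only edge that
leaves some set of vertices. -/
theorem exists_cut_of_not_stronglyConnectedOn {u v : V} (h : StronglyConnectedOn T S)
    (hd : ¬ StronglyConnectedOn (T \ {(u, v)}) S) (hu : u ∈ S) (hv : v ∈ S) :
    ∃ X ⊆ S, u ∈ X ∧ v ∉ X ∧ ∀ p ∈ X, ∀ q ∈ S, q ∉ X → (p, q) ∈ T → (p, q) = (u, v) := by
  -- A detour from `u` to `v` could replace the edge in every walk. Hence the vertices still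
  -- reachable from `u` form a set without `v`, and only the dropped edge leaves it.
  have huv : ¬ ReachIn (T \ {(u, v)}) S u v := by
    intro huv
    refine hd ⟨h.1, fun a ha b hb => ?_⟩
    have hab := h.2 a ha b hb
    clear hb
    induction hab with
    | refl => exact .refl
    | @tail c d _ hcd ih =>
      by_cases he : (c, d) = (u, v)
      · obtain ⟨rfl, rfl⟩ := Prod.mk.inj he
        exact ih.trans huv
      · exact ih.tail ⟨hcd.1, hcd.2.1, hcd.2.2, he⟩
  refine ⟨{z | z ∈ S ∧ ReachIn (T \ {(u, v)}) S u z}, fun z hz => hz.1, ⟨hu, .refl⟩,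
    fun hz => huv hz.2, fun p hp q hq hqX hpq => ?_⟩
  by_contra hne
  exact hqX ⟨hq, hp.2.tail ⟨hp.1, hq, hpq, hne⟩⟩

/-- In a strongly connected graph some strongly connected spanning subgraph has antiparallel edges
at bridges only. -/
theorem StronglyConnectedOn.exists_subgraph [Finite V] (h : StronglyConnectedOn E S) :
    ∃ T ⊆ E, StronglyConnectedOn T S ∧ (∀ p q, (p, q) ∈ T → p ∈ S ∧ q ∈ S) ∧
      ∀ u v, u ≠ v → (u, v) ∈ T → (v, u) ∈ T → ¬ SameSide E S u v := by
  -- Keeping some orientation of every adjacent pair ensures that a cut crossed by one pair in `T`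
  -- is crossed by one pair in `E`.
  let P : Set (V × V) → Prop := fun T => T ⊆ E ∧ StronglyConnectedOn T S ∧
    (∀ p q, (p, q) ∈ T → p ∈ S ∧ q ∈ S) ∧
    ∀ p ∈ S, ∀ q ∈ S, (p, q) ∈ E → (p, q) ∈ T ∨ (q, p) ∈ T
  have hne : {T | P T}.Nonempty := by
    refine ⟨{e | e ∈ E ∧ e.1 ∈ S ∧ e.2 ∈ S}, fun e he => he.1, ⟨h.1, fun u hu v hv => ?_⟩,
      fun p q hpq => hpq.2, fun p hp q hq hpq => .inl ⟨hpq, hp, hq⟩⟩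
    exact Relation.ReflTransGen.mono
      (fun a b hab => ⟨hab.1, hab.2.1, hab.2.2, hab.1, hab.2.1⟩) _ _ (h.2 u hu v hv)
  obtain ⟨T, hT⟩ := (Set.toFinite {T | P T}).exists_minimal hne
  obtain ⟨⟨hTE, hTS, hTin, hTE'⟩, hmin⟩ := hT
  refine ⟨T, hTE, hTS, hTin, fun u v huv he he' hside => ?_⟩
  -- The opposite edge still orients the pair, so only the loss of strong connectivity can forbid
  -- the removal.
  have drop : ∀ a b : V, a ≠ b → (a, b) ∈ T → (b, a) ∈ T →
      ¬ StronglyConnectedOn (T \ {(a, b)}) S := by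
    intro a b hab h1 h2 hsc
    have : P (T \ {(a, b)}) := by
      refine ⟨Set.sdiff_subset.trans hTE, hsc, fun p q hpq => hTin p q hpq.1,
        fun p hp q hq hpq => ?_⟩
      simp only [Set.mem_sdiff, Set.mem_singleton_iff, Prod.mk.injEq]
      by_cases hp1 : p = a ∧ q = b
      · obtain ⟨rfl, rfl⟩ := hp1
        exact .inr ⟨h2, fun h => hab h.2⟩
      by_cases hp2 : p = b ∧ q = a
      · obtain ⟨rfl, rfl⟩ := hp2
        exact .inl ⟨h2, hp1⟩
      rcases hTE' p hp q hq hpq with h | h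
      · exact .inl ⟨h, hp1⟩
      · exact .inr ⟨h, fun h => hp2 ⟨h.2, h.1⟩⟩
    exact (hmin this Set.sdiff_subset h1).2 rfl
  obtain ⟨hu, hv⟩ := hTin u v he
  -- Only `(u, v)` leaves `X` in `T`, and only `(v, u)` leaves `Y`. The sets partition `S`: an edge
  -- out of `X ∩ Y` or out of `X ∪ Y` would be one of these two edges with an end on the wrong side.
  -- Thus only the pair of `u` and `v` crosses.
  obtain ⟨X, hXS, huX, hvX, hX⟩ :=
    exists_cut_of_not_stronglyConnectedOn hTS (drop u v huv he he') hu hv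
  obtain ⟨Y, hYS, hvY, huY, hY⟩ :=
    exists_cut_of_not_stronglyConnectedOn hTS (drop v u huv.symm he' he) hv hu
  have hinter : ∀ z, z ∈ X → z ∉ Y := by
    intro z hzX hzY
    obtain ⟨p, q, ⟨hp, hq, hpq⟩, hpXY, hqXY⟩ :=
      exists_edge_of_reach (X := X ∩ Y) (hTS.2 z (hXS hzX) u hu) ⟨hzX, hzY⟩ (fun h => huY h.2)
    by_cases hqX : q ∈ X
    · have := hY p hpXY.2 q hq (fun h => hqXY ⟨hqX, h⟩) hpq
      exact hvX ((Prod.mk.inj this).1 ▸ hpXY.1)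
    · have := hX p hpXY.1 q hq hqX hpq
      exact huY ((Prod.mk.inj this).1 ▸ hpXY.2)
  have hunion : ∀ z ∈ S, z ∈ X ∨ z ∈ Y := by
    intro z hz
    by_contra hzXY
    obtain ⟨p, q, ⟨hp, hq, hpq⟩, hpXY, hqXY⟩ :=
      exists_edge_of_reach (X := X ∪ Y) (hTS.2 u hu z hz) (.inl huX) hzXY
    rw [Set.mem_union, not_or] at hqXY
    rcases hpXY with h | h
    · have := hX p h q hq hqXY.1 hpq
      exact hqXY.2 ((Prod.mk.inj this).2 ▸ hvY)
    · have := hY p h q hq hqXY.2 hpq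
      exact hqXY.1 ((Prod.mk.inj this).2 ▸ huX)
  have hcross : ∀ p ∈ S, ∀ q ∈ S, (p, q) ∈ T → ¬ (p ∈ X ↔ q ∈ X) →
      (p, q) = (u, v) ∨ (p, q) = (v, u) := by
    intro p hp q hq hpq hpqX
    by_cases hpX : p ∈ X
    · exact .inl (hX p hpX q hq (by tauto) hpq)
    · have hqX : q ∈ X := by tauto
      exact .inr (hY p ((hunion p hp).resolve_left hpX) q hq (hinter q hqX) hpq)
  refine hvX ((hside X ⟨u, v, fun p hp q hq hpq hpqX => ?_⟩).1 huX)
  rcases hTE' p hp q hq hpq with h | h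
  · exact hcross p hp q hq h hpqX
  · rcases hcross q hq p hp h (by tauto) with h | h
    · exact .inr (by simp only [Prod.mk.injEq] at h ⊢; tauto)
    · exact .inl (by simp only [Prod.mk.injEq] at h ⊢; tauto)

/-- The vertices that no bridge separates from `c` induce a twinless strongly connected subgraph. -/
theorem StronglyConnectedOn.twinlessSCOn_sameSide [Finite V] (h : StronglyConnectedOn E S) {c : V}
    (hc : c ∈ S) : TwinlessSCOn E {w | w ∈ S ∧ SameSide E S c w} := by
  obtain ⟨T, hTE, hTS, hTin, hT⟩ := h.exists_subgraph
  set C := {w | w ∈ S ∧ SameSide E S c w} with hC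
  have hCC : ∀ u ∈ C, ∀ w ∈ C, SameSide E S u w := fun u hu w hw => hu.2.symm.trans hw.2
  refine ⟨{e | e ∈ T ∧ e.1 ∈ C ∧ e.2 ∈ C}, fun e he => hTE he.1, ?_, ⟨c, hc, .rfl'⟩, ?_⟩
  · intro u v huv he he'
    exact hT u v huv he.1 he'.1 (hCC u he.2.1 v he.2.2)
  intro u hu w hw
  let T' : Set (V × V) := {e | e ∈ T ∧ e.1 ∈ C ∧ e.2 ∈ C}
  change ReachIn T' C u w
  -- A walk in `T` is either in the class, reached without leaving it, or beyond a bridge that it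
  -- crossed at the vertex `p` of the class. Every edge back into `X` ends at `p`, so the excursion
  -- can be cut out.
  have key : ∀ z, ReachIn T S u z → (z ∈ C ∧ ReachIn T' C u z) ∨
      ∃ p ∈ C, ReachIn T' C u p ∧ ∃ X, BridgeCut E S X ∧ p ∈ X ∧ z ∉ X ∧
        ∀ r ∈ S, ∀ s ∈ S, (r, s) ∈ E → r ∉ X → s ∈ X → s = p := by
    intro z hz
    induction hz with
    | refl => exact .inl ⟨hu, .refl⟩
    | @tail y z _ hyz ih =>
      obtain ⟨hy, hz, hyz⟩ := hyz
      rcases ih with ⟨hyC, hry⟩ | ⟨p, hp, hrp, X, hXb, hpX, hyX, hX⟩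
      · by_cases hzC : z ∈ C
        · exact .inl ⟨hzC, hry.tail ⟨hyC, hzC, hyz, hyC, hzC⟩⟩
        · right
          have hns : ¬ SameSide E S y z := fun hs => hzC ⟨hz, hyC.2.trans hs⟩
          obtain ⟨X, hXb, hyX, hzX⟩ : ∃ X, BridgeCut E S X ∧ y ∈ X ∧ z ∉ X := by
            simp only [SameSide, not_forall] at hns
            obtain ⟨X, hXb, hns⟩ := hns
            by_cases hyX : y ∈ X
            · exact ⟨X, hXb, hyX, by tauto⟩
            · exact ⟨Xᶜ, hXb.compl, hyX, by simp only [Set.mem_compl_iff]; tauto⟩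
          refine ⟨y, hyC, hry, X, hXb, hyX, hzX, fun r hr s hs hrs hrX hsX => ?_⟩
          obtain ⟨a, b, hab⟩ := hXb
          have h1 := hab y hy z hz (hTE hyz) (by tauto)
          have h2 := hab r hr s hs hrs (by tauto)
          simp only [Prod.mk.injEq] at h1 h2
          rcases h1 with ⟨rfl, rfl⟩ | ⟨rfl, rfl⟩ <;> rcases h2 with ⟨rfl, rfl⟩ | ⟨rfl, rfl⟩ <;>
            first | rfl | exact absurd hyX hrX
      · by_cases hzX : z ∈ X
        · left
          obtain rfl := hX y hy z hz (hTE hyz) hyX hzX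
          exact ⟨hp, hrp⟩
        · exact .inr ⟨p, hp, hrp, X, hXb, hpX, hzX, hX⟩
  rcases key w (hTS.2 u hu.1 w hw.1) with h | ⟨p, hp, _, X, hXb, hpX, hwX, _⟩
  · exact h.2
  · exact absurd ((hCC p hp w hw X hXb).1 hpX) hwX

/-- If no two vertices are separated, the class of any vertex is all of `S`, and classes are
twinless strongly connected. -/
theorem StronglyConnectedOn.twinlessSCOn_iff [Finite V] (h : StronglyConnectedOn E S) :
    TwinlessSCOn E S ↔ ∀ v ∈ S, ∀ w ∈ S, SameSide E S v w := by
  refine ⟨fun ht v hv w hw => ht.sameSide subset_rfl hv hw, fun hs => ?_⟩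
  obtain ⟨c, hc⟩ := h.1
  have : {w | w ∈ S ∧ SameSide E S c w} = S := by
    ext w
    exact ⟨fun hw => hw.1, fun hw => ⟨hw, hs c hc w hw⟩⟩
  exact this ▸ h.twinlessSCOn_sameSide hc

theorem TwinlessSCOn.exists_isTSCC [Finite V] (h : TwinlessSCOn E D) (hDS : D ⊆ S) :
    ∃ C, D ⊆ C ∧ IsTSCC E S C :=
  (Set.toFinite {D : Set V | D ⊆ S ∧ TwinlessSCOn E D}).exists_le_maximal ⟨hDS, h⟩

/-- A class is twinless strongly connected, hence contained in a component, and no bridge splits a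
component. So the components can be computed as classes. -/
theorem StronglyConnectedOn.exists_isTSCC_iff [Finite V] (h : StronglyConnectedOn E S) {v w : V}
    (hv : v ∈ S) (hw : w ∈ S) :
    (∃ C, IsTSCC E S C ∧ v ∈ C ∧ w ∈ C) ↔ SameSide E S v w := by
  constructor
  · rintro ⟨C, hC, hvC, hwC⟩
    exact hC.1.2.sameSide hC.1.1 hvC hwC
  · intro hs
    obtain ⟨C, hDC, hC⟩ := (h.twinlessSCOn_sameSide hv).exists_isTSCC fun w hw => hw.1
    exact ⟨C, hC, hDC ⟨hv, .rfl'⟩, hDC ⟨hw, hs⟩⟩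

/-- If `(V, E)` is twinless strongly connected on `S` and the strongly connected subgraph `(V, F)` is
not, then some edge of `E` outside `F` joins vertices separated by a bridge of `F`. -/
theorem exists_edge_not_sameSide [Finite V] (hF : StronglyConnectedOn F S)
    (hE : TwinlessSCOn E S) (hnF : ¬ TwinlessSCOn F S) :
    ∃ p ∈ S, ∃ q ∈ S, (p, q) ∈ E ∧ (p, q) ∉ F ∧ ¬ SameSide F S p q := by
  rw [hF.twinlessSCOn_iff] at hnF
  push Not at hnF
  obtain ⟨v, hv, w, hw, hvw⟩ := hnF
  simp only [SameSide, not_forall] at hvw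
  obtain ⟨X, ⟨a, b, hX⟩, hvwX⟩ := hvw
  -- Otherwise no edge of `E` outside `F` would cross `X`, and `X` would be a bridge cut of `E` as
  -- well.
  by_contra! hcon
  refine hvwX (hE.sameSide subset_rfl hv hw X ⟨a, b, fun p hp q hq hpq hpqX => ?_⟩)
  by_cases hpF : (p, q) ∈ F
  · exact hX p hp q hq hpF hpqX
  · exact absurd (hcon p hp q hq hpq hpF X ⟨a, b, hX⟩) hpqX

/-! ### Deleting single vertices and single edges -/

/-- If every vertex-deleted subgraph is twinless strongly connected, then so is the graph. -/
theorem twinlessSCOn_univ_of_compl [Fintype V] (hcard : 3 ≤ Fintype.card V)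
    (h : ∀ x, TwinlessSCOn F ({x}ᶜ)) (hF : StronglyConnectedOn F Set.univ) :
    TwinlessSCOn F Set.univ := by
  classical
  rw [hF.twinlessSCOn_iff]
  intro v _ w _ X ⟨a, b, hX⟩
  -- A bridge cut remains one after a deletion, so deleting a third vertex gives a contradiction to
  -- any cut that separates `v` from `w`.
  obtain ⟨x, hx⟩ : ∃ x, x ∉ ({v, w} : Finset V) := by
    by_contra! hall
    have := (Finset.card_le_card (s := Finset.univ) fun x _ => hall x).trans Finset.card_le_two
    rw [Finset.card_univ] at this
    omega
  simp only [Finset.mem_insert, Finset.mem_singleton, not_or] at hx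
  exact (h x).sameSide subset_rfl (Ne.symm hx.1) (Ne.symm hx.2) X
    ⟨a, b, fun p _ q _ => hX p trivial q trivial⟩

/-- A set of fewer than two vertices is empty or a singleton, so only single deletions have to be
considered. -/
theorem isKVertexTwinlessConnected_two_iff [Fintype V] :
    IsKVertexTwinlessConnected 2 E ↔
      TwinlessSCOn E Set.univ ∧ 3 ≤ Fintype.card V ∧ ∀ x, TwinlessSCOn E ({x}ᶜ) := by
  refine ⟨fun h => ⟨h.1, h.2.1, fun x => ?_⟩, fun h => ⟨h.1, h.2.1, fun U hU => ?_⟩⟩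
  · simpa using h.2.2 {x} (by simp)
  · rcases Nat.lt_succ_iff_lt_or_eq.1 hU with hU | hU
    · have : U = ∅ := Finset.card_eq_zero.1 (by omega)
      subst this
      simpa using h.1
    · obtain ⟨x, rfl⟩ := Finset.card_eq_one.1 hU
      simpa using h.2.2 x

theorem isKVertexConnected_two_iff [Fintype V] :
    IsKVertexConnected 2 E ↔
      StronglyConnectedOn E Set.univ ∧ 3 ≤ Fintype.card V ∧ ∀ x, StronglyConnectedOn E ({x}ᶜ) := by
  refine ⟨fun h => ⟨h.1, h.2.1, fun x => ?_⟩, fun h => ⟨h.1, h.2.1, fun U hU => ?_⟩⟩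
  · simpa using h.2.2 {x} (by simp)
  · rcases Nat.lt_succ_iff_lt_or_eq.1 hU with hU | hU
    · have : U = ∅ := Finset.card_eq_zero.1 (by omega)
      subst this
      simpa using h.1
    · obtain ⟨x, rfl⟩ := Finset.card_eq_one.1 hU
      simpa using h.2.2 x

theorem IsKVertexTwinlessConnected.isKVertexConnected [Fintype V] {k : ℕ}
    (h : IsKVertexTwinlessConnected k E) : IsKVertexConnected k E :=
  ⟨h.1.stronglyConnectedOn, h.2.1, fun U hU => (h.2.2 U hU).stronglyConnectedOn⟩

theorem IsKVertexConnected.mono [Fintype V] {k : ℕ} (h : IsKVertexConnected k E) (hEF : E ⊆ F) :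
    IsKVertexConnected k F :=
  ⟨h.1.mono hEF, h.2.1, fun U hU => (h.2.2 U hU).mono hEF⟩

/-- An edge `(u, v)` of a `2`-vertex-connected graph can be dropped if and only if the rest contains,
for every other vertex `z`, a path from `u` to `v` that avoids `z`. -/
theorem IsKVertexConnected.diff_singleton_iff [Fintype V] (h : IsKVertexConnected 2 E) {u v : V} :
    IsKVertexConnected 2 (E \ {(u, v)}) ↔
      ∀ z, z ≠ u → z ≠ v → ReachIn (E \ {(u, v)}) ({z}ᶜ) u v := by
  classical
  -- Every use of `(u, v)` is replaced by a detour inside the same vertex set, which is needed only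
  -- if both ends belong to the set.
  have lift : ∀ S, (u ∈ S → v ∈ S → ReachIn (E \ {(u, v)}) S u v) → ∀ a b, ReachIn E S a b →
      ReachIn (E \ {(u, v)}) S a b := by
    intro S hS a b hab
    induction hab with
    | refl => exact .refl
    | @tail c d _ hcd ih =>
      by_cases he : (c, d) = (u, v)
      · obtain ⟨rfl, rfl⟩ := Prod.mk.inj he
        exact ih.trans (hS hcd.1 hcd.2.1)
      · exact ih.tail ⟨hcd.1, hcd.2.1, hcd.2.2, he⟩
  constructor
  · intro h' z hu hv
    exact ((isKVertexConnected_two_iff.1 h').2.2 z).2 u (Ne.symm hu) v (Ne.symm hv)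
  · intro hz
    rw [isKVertexConnected_two_iff] at h ⊢
    refine ⟨⟨h.1.1, fun a ha b hb => lift _ (fun _ _ => ?_) a b (h.1.2 a ha b hb)⟩, h.2.1,
      fun x => ⟨(h.2.2 x).1, fun a ha b hb => lift _ (fun hu hv => ?_) a b ((h.2.2 x).2 a ha b hb)⟩⟩
    -- For the graph without deletions, a detour that avoids some third vertex serves.
    · obtain ⟨x, hx⟩ : ∃ x, x ∉ ({u, v} : Finset V) := by
        by_contra! hall
        have := (Finset.card_le_card (s := Finset.univ) fun x _ => hall x).trans
          Finset.card_le_two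
        rw [Finset.card_univ] at this
        omega
      simp only [Finset.mem_insert, Finset.mem_singleton, not_or] at hx
      exact Relation.ReflTransGen.mono (fun a b hab => ⟨trivial, trivial, hab.2.2⟩) _ _
        (hz x hx.1 hx.2)
    · exact hz x (fun h => hu h.symm) fun h => hv h.symm

/-- By monotonicity, if a proper subgraph were `2`-vertex-connected, then removing just one of the
edges that it lacks would also be harmless. -/
theorem isMinimalTwoVertexConnected_of_forall [Fintype V] (hFE : F ⊆ E)
    (h : IsKVertexConnected 2 F) (hmin : ∀ e ∈ F, ¬ IsKVertexConnected 2 (F \ {e})) :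
    IsMinimalTwoVertexConnected E F := by
  refine ⟨⟨hFE, h⟩, fun D hD hDF e he => ?_⟩
  by_contra heD
  exact hmin e he (hD.2.mono fun d hd => ⟨hDF hd, fun h => heD (h ▸ hd)⟩)

/-- A `2`-vertex-connected graph has at least as many edges as vertices. -/
theorem IsKVertexConnected.card_le [Fintype V] {E : Finset (V × V)}
    (h : IsKVertexConnected 2 (E : Set (V × V))) : Fintype.card V ≤ E.card := by
  classical
  -- Every vertex is the tail of an edge, because a walk to another vertex has to leave it.
  have : (Finset.univ : Finset V) ⊆ E.image Prod.fst := by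
    intro v _
    have hc := h.2.1
    obtain ⟨w, hw⟩ := Fintype.exists_ne_of_one_lt_card (by omega) v
    obtain ⟨p, q, ⟨_, _, hpq⟩, hp, _⟩ :=
      exists_edge_of_reach (X := {v}) (h.1.2 v trivial w trivial) rfl hw
    exact Finset.mem_image.2 ⟨(p, q), hpq, hp⟩
  exact (Finset.card_le_card this).trans Finset.card_image_le

end Twinless

/-! ## Search trees -/

/-- `u` is a descendant of `a` in the tree with parent function `par`. -/
inductive Subtree (par : ℕ → ℕ) (root a : ℕ) : ℕ → Prop
  | self : Subtree par root a a
  | child {u : ℕ} : u ≠ root → Subtree par root a (par u) → Subtree par root a u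

/-- `par` describes a tree on the set `R` whose edges are in `A`, and `num` increases from parents to
children. -/
structure SpanTree (A : ℕ → ℕ → Prop) (R : ℕ → Prop) (root : ℕ) (par num : ℕ → ℕ) : Prop where
  root_mem : R root
  par_mem : ∀ v, R v → v ≠ root → R (par v)
  adj : ∀ v, R v → v ≠ root → A (par v) v
  num_lt : ∀ v, R v → v ≠ root → num (par v) < num v

/-- Reachability that avoids the vertex `z`. -/
abbrev ReachAvoid (A : ℕ → ℕ → Prop) (z : ℕ) : ℕ → ℕ → Prop :=
  Relation.ReflTransGen (fun a b => a ≠ z ∧ b ≠ z ∧ A a b)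

namespace SpanTree

variable {A : ℕ → ℕ → Prop} {R : ℕ → Prop} {root : ℕ} {par num : ℕ → ℕ}

/-- Numbers decrease from a vertex to its parent, so every ascent ends at the root. -/
theorem induction (hT : SpanTree A R root par num) {P : ℕ → Prop} (h0 : P root)
    (h1 : ∀ v, R v → v ≠ root → P (par v) → P v) : ∀ v, R v → P v := by
  suffices H : ∀ k v, num v = k → R v → P v from fun v hv => H _ v rfl hv
  intro k
  induction k using Nat.strong_induction_on with
  | _ k ih =>
    intro v hk hv
    by_cases hr : v = root
    · exact hr ▸ h0
    · exact h1 v hv hr (ih _ (hk ▸ hT.num_lt v hv hr) _ rfl (hT.par_mem v hv hr))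

theorem subtree_root (hT : SpanTree A R root par num) {v : ℕ} (hv : R v) :
    Subtree par root root v :=
  hT.induction (P := fun v => Subtree par root root v) .self (fun _ _ hr ih => .child hr ih) v hv

theorem num_le (hT : SpanTree A R root par num) {a u : ℕ} (h : Subtree par root a u) (hu : R u) :
    u = a ∨ num a < num u := by
  induction h with
  | self => exact .inl rfl
  | @child u hr _ ih =>
    right
    have h2 := hT.num_lt u hu hr
    rcases ih (hT.par_mem u hu hr) with h | h
    · exact h ▸ h2
    · exact h.trans h2

theorem mem_of_subtree (hT : SpanTree A R root par num) {a u : ℕ} (h : Subtree par root a u)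
    (hu : R u) : R a := by
  induction h with
  | self => exact hu
  | @child u hr _ ih => exact ih (hT.par_mem u hu hr)

theorem not_subtree_par (hT : SpanTree A R root par num) {a : ℕ} (ha : R a) (hr : a ≠ root) :
    ¬ Subtree par root a (par a) := by
  intro h
  have h1 := hT.num_lt a ha hr
  rcases hT.num_le h (hT.par_mem a ha hr) with h | h
  · exact absurd (h ▸ h1) (lt_irrefl _)
  · omega

theorem subtree_trans {a b u : ℕ} (hab : Subtree par root a b)
    (hbu : Subtree par root b u) : Subtree par root a u := by
  induction hbu with
  | self => exact hab
  | child hr _ ih => exact .child hr ih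

/-- Subtrees decompose into their top and the subtrees of its children; `gatherProg` evaluates this
recursion bottom up. -/
theorem subtree_iff (hT : SpanTree A R root par num) {y u : ℕ} (hu : R u) :
    Subtree par root y u ↔ u = y ∨ ∃ z, R z ∧ z ≠ root ∧ par z = y ∧ Subtree par root z u := by
  constructor
  · intro h
    induction h with
    | self => exact .inl rfl
    | @child u hr _ ih =>
      right
      rcases ih (hT.par_mem u hu hr) with h | ⟨z, hz, hzr, hzy, hzu⟩
      · exact ⟨u, hu, hr, h, .self⟩
      · exact ⟨z, hz, hzr, hzy, .child hr hzu⟩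
  · rintro (rfl | ⟨z, hz, hzr, rfl, hzu⟩)
    · exact .self
    · exact subtree_trans (.child hzr .self) hzu

/-- The tree path from `y` down to `v` avoids all vertices off the path and all vertices with
smaller number than `y`. -/
theorem reach_down (hT : SpanTree A R root par num) {y v z : ℕ} (h : Subtree par root y v)
    (hv : R v) (hz : ∀ w, Subtree par root y w → Subtree par root w v → w ≠ z) :
    ReachAvoid A z y v := by
  induction h with
  | self => exact .refl
  | @child v hr hyv ih =>
    have hpv : Subtree par root (par v) v := .child hr .self
    refine (ih (hT.par_mem v hv hr) fun w hw hwv => hz w hw (.child hr hwv)).tail ⟨?_, ?_, ?_⟩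
    · exact hz _ hyv hpv
    · exact hz _ (.child hr hyv) .self
    · exact hT.adj v hv hr

/-- All vertices on the tree path to `v` have numbers at most `num v`, so none of them is `z`. -/
theorem reach_root (hT : SpanTree A R root par num) {v z : ℕ} (hv : R v) (hz : num v < num z) :
    ReachAvoid A z root v := by
  refine hT.reach_down (hT.subtree_root hv) hv fun w _ hw hwz => ?_
  subst hwz
  rcases hT.num_le hw hv with h | h
  · exact absurd (h ▸ hz) (lt_irrefl _)
  · omega

end SpanTree

/-! ## Labelling the components by means of a spanning tree -/

section Label

variable {n : ℕ} {F : Set (Fin n × Fin n)} {S : Set (Fin n)}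

/-- The subgraph of `(V, F)` induced on `S`, as a relation on numbers. -/
def NatAdj (F : Set (Fin n × Fin n)) (S : Set (Fin n)) (p q : ℕ) : Prop :=
  ∃ (hp : p < n) (hq : q < n), (⟨p, hp⟩ : Fin n) ∈ S ∧ (⟨q, hq⟩ : Fin n) ∈ S ∧
    ((⟨p, hp⟩, ⟨q, hq⟩) : Fin n × Fin n) ∈ F

/-- A set of vertices, as a predicate on numbers. -/
def NatMem (S : Set (Fin n)) (v : ℕ) : Prop := ∃ h : v < n, (⟨v, h⟩ : Fin n) ∈ S

/-- Adjacency in either direction, except for the pairs joined by a tree edge. -/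
def NonTreeAdj (A : ℕ → ℕ → Prop) (par : ℕ → ℕ) (u w : ℕ) : Prop :=
  (A u w ∨ A w u) ∧ par u ≠ w ∧ par w ≠ u

/-- Some edge outside the tree leaves the subtree of `a`. -/
def Covered (A : ℕ → ℕ → Prop) (par : ℕ → ℕ) (root a : ℕ) : Prop :=
  ∃ u w, Subtree par root a u ∧ ¬ Subtree par root a w ∧ NonTreeAdj A par u w

variable {root : ℕ} {par num : ℕ → ℕ}

/-- If a bridge cut `X` separated `a` from its parent `b`, this pair would be the only one to cross.
All other tree edges stay on one side, so `X` splits the subtree of `a` from the remaining vertices,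
and the covering edge would be a second crossing pair. -/
theorem Covered.sameSide (hT : SpanTree (NatAdj F S) (NatMem S) root par num)
    {a b : Fin n} (hb : par a = b) (ha : a ∈ S) (har : (a : ℕ) ≠ root)
    (hcov : Covered (NatAdj F S) par root a) : SameSide F S a b := by
  rintro X ⟨p₀, q₀, hX⟩
  by_contra hab
  have hRa : NatMem S a := ⟨a.2, ha⟩
  -- The tree edge from `b` to `a` crosses, so it determines the single pair of the cut.
  have hAdj : ∀ p q : Fin n, NatAdj F S p q → ¬ (p ∈ X ↔ q ∈ X) →
      (p = a ∧ q = b) ∨ (p = b ∧ q = a) := by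
    have h0 : NatAdj F S b a := hb ▸ hT.adj a hRa har
    obtain ⟨_, _, h1, h2, h3⟩ := h0
    have h4 := hX _ h1 _ h2 h3 (by simp only [Fin.eta]; tauto)
    rintro p q ⟨_, _, h5, h6, h7⟩ hpq
    have h8 := hX _ h5 _ h6 h7 hpq
    simp only [Prod.mk.injEq, Fin.eta] at h4 h8
    rcases h4 with ⟨rfl, rfl⟩ | ⟨rfl, rfl⟩ <;> tauto
  have hin : ∀ u, Subtree par root a u → ∀ u' : Fin n, (u' : ℕ) = u → u' ∈ S →
      (u' ∈ X ↔ a ∈ X) := by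
    intro u hu
    induction hu with
    | self => intro u' h _; rw [Fin.ext h]
    | @child u hr hs ih =>
      rintro u' rfl hu'
      have hRu : NatMem S u' := ⟨u'.2, hu'⟩
      obtain ⟨hp, hpS⟩ := hT.par_mem _ hRu hr
      have ih' := ih ⟨par u', hp⟩ rfl hpS
      rw [← ih']
      by_contra hcon
      rcases hAdj ⟨par u', hp⟩ u' (hT.adj _ hRu hr) (by tauto) with ⟨h1, h2⟩ | ⟨h1, h2⟩
      · have h1' : par u' = a := congrArg Fin.val h1
        have := hT.not_subtree_par hRa har
        rw [hb, ← h2] at this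
        exact this (.child hr hs)
      · subst h2
        exact hcon ih'.symm
  have hout : ∀ w, NatMem S w → ¬ Subtree par root a w → ∀ w' : Fin n, (w' : ℕ) = w →
      ∀ r' : Fin n, (r' : ℕ) = root → (w' ∈ X ↔ r' ∈ X) := by
    refine hT.induction ?_ ?_
    · intro _ w' h1 r' h2
      rw [Fin.ext (h1.trans h2.symm)]
    · rintro w hRw hr ih hw w' rfl r' h2
      obtain ⟨hp, hpS⟩ := hT.par_mem _ hRw hr
      have hnp : ¬ Subtree par root a (par w') := fun h => hw (.child hr h)
      rw [← ih hnp ⟨par w', hp⟩ rfl r' h2]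
      by_contra hcon
      rcases hAdj ⟨par w', hp⟩ w' (hT.adj _ hRw hr) (by tauto) with ⟨h1, _⟩ | ⟨_, h2⟩
      · have h1' : par w' = a := congrArg Fin.val h1
        exact hnp (h1' ▸ .self)
      · subst h2
        exact hw .self
  obtain ⟨u, w, hu, hw, hA, hn1, hn2⟩ := hcov
  have huw : NatMem S u ∧ NatMem S w := by
    rcases hA with ⟨h1, h2, h3, h4, _⟩ | ⟨h1, h2, h3, h4, _⟩
    exacts [⟨⟨h1, h3⟩, h2, h4⟩, ⟨⟨h2, h4⟩, h1, h3⟩]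
  obtain ⟨⟨hun, huS⟩, hwn, hwS⟩ := huw
  obtain ⟨hrn, _⟩ := hT.root_mem
  have hbR : NatMem S b := hb ▸ hT.par_mem _ hRa har
  have h1 := hin u hu ⟨u, hun⟩ rfl huS
  have h2 := hout w ⟨hwn, hwS⟩ hw ⟨w, hwn⟩ rfl ⟨root, hrn⟩ rfl
  have h3 := hout b hbR (hb ▸ hT.not_subtree_par hRa har) b rfl ⟨root, hrn⟩ rfl
  have h4 : ((⟨u, hun⟩ : Fin n) = a ∧ (⟨w, hwn⟩ : Fin n) = b) ∨
      ((⟨u, hun⟩ : Fin n) = b ∧ (⟨w, hwn⟩ : Fin n) = a) := by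
    rcases hA with h | h
    · exact hAdj ⟨u, hun⟩ ⟨w, hwn⟩ h (by tauto)
    · have := hAdj ⟨w, hwn⟩ ⟨u, hun⟩ h (by tauto)
      tauto
  rcases h4 with ⟨h5, h6⟩ | ⟨h5, h6⟩
  · have h5' : u = a := congrArg Fin.val h5
    have h6' : w = b := congrArg Fin.val h6
    exact hn1 (by rw [h5', h6', hb])
  · have h6' : w = a := congrArg Fin.val h6
    exact hw (h6' ▸ .self)

/-- As `a` is not covered, a pair crossing the boundary of its subtree is a tree pair, and only `a`
with its parent is such a pair. The value `par root = n` is no vertex, so `par q = p` for vertices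
`p` and `q` implies `q ≠ root`. -/
theorem bridgeCut_subtree (hT : SpanTree (NatAdj F S) (NatMem S) root par num)
    (hpr : par root = n) {a : ℕ} (ha : NatMem S a) (har : a ≠ root)
    (hcov : ¬ Covered (NatAdj F S) par root a) :
    BridgeCut F S {v : Fin n | Subtree par root a v} := by
  obtain ⟨hb, hbS⟩ := hT.par_mem a ha har
  obtain ⟨han, haS⟩ := ha
  refine ⟨⟨par a, hb⟩, ⟨a, han⟩, fun p hp q hq hpq hX => ?_⟩
  simp only [Set.mem_ofPred_eq] at hX
  have hA : NatAdj F S p q := ⟨p.2, q.2, hp, hq, hpq⟩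
  have tree : ∀ p q : Fin n, par q = p → ¬ (Subtree par root a p ↔ Subtree par root a q) →
      q = ⟨a, han⟩ ∧ p = ⟨par a, hb⟩ := by
    intro p q h hX
    have hq : (q : ℕ) ≠ root := by
      intro hq
      rw [hq, hpr] at h
      exact absurd p.2 (by omega)
    have h1 : ¬ Subtree par root a p := fun h2 => hX ⟨fun _ => .child hq (h ▸ h2), fun _ => h2⟩
    have h2 : Subtree par root a q := by tauto
    generalize hq' : (q : ℕ) = q' at h2 h hq
    cases h2 with
    | self => exact ⟨Fin.ext hq', Fin.ext h.symm⟩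
    | child _ h3 => exact absurd (h ▸ h3) h1
  by_cases h1 : par p = q
  · obtain ⟨h2, h3⟩ := tree q p h1 (by tauto)
    exact .inr (by rw [h2, h3])
  by_cases h2 : par q = p
  · obtain ⟨h2, h3⟩ := tree p q h2 hX
    exact .inl (by rw [h2, h3])
  refine absurd ?_ hcov
  by_cases h3 : Subtree par root a p
  · exact ⟨p, q, h3, by tauto, .inl hA, h1, h2⟩
  · exact ⟨q, p, by tauto, h3, .inr hA, h2, h1⟩

variable {comp : ℕ → ℕ}

/-- Labels that are inherited from the parent exactly if the tree edge to the parent is covered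
identify the classes of vertices not separated by a bridge. -/
theorem label_eq_iff (hT : SpanTree (NatAdj F S) (NatMem S) root par num) (hpr : par root = n)
    (h0 : comp root = root)
    (h1 : ∀ v, NatMem S v → v ≠ root → Covered (NatAdj F S) par root v → comp v = comp (par v))
    (h2 : ∀ v, NatMem S v → v ≠ root → ¬ Covered (NatAdj F S) par root v → comp v = v)
    {v w : Fin n} (hv : v ∈ S) (hw : w ∈ S) : comp v = comp w ↔ SameSide F S v w := by
  -- Going up from `v` along covered tree edges, the label is the vertex where this stops: the root,
  -- or a vertex whose tree edge is a bridge.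
  have hself : ∀ v, NatMem S v → NatMem S (comp v) ∧ (∀ v' c' : Fin n, (v' : ℕ) = v →
      (c' : ℕ) = comp v → SameSide F S v' c') ∧ Subtree par root (comp v) v ∧
      (comp v = root ∨ ¬ Covered (NatAdj F S) par root (comp v)) := by
    refine hT.induction ?_ ?_
    · rw [h0]
      exact ⟨hT.root_mem, fun v' c' h h' => Fin.ext (h.trans h'.symm) ▸ .rfl', .self, .inl rfl⟩
    · intro v hv hvr ih
      by_cases hc : Covered (NatAdj F S) par root v
      · rw [h1 v hv hvr hc]
        refine ⟨ih.1, ?_, .child hvr ih.2.2.1, ih.2.2.2⟩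
        rintro v' c' rfl h
        obtain ⟨hp, _⟩ := hT.par_mem _ hv hvr
        exact (hc.sameSide hT (b := ⟨par v', hp⟩) rfl hv.2 hvr).trans (ih.2.1 ⟨_, hp⟩ c' rfl h)
      · rw [h2 v hv hvr hc]
        exact ⟨hv, fun v' c' h h' => Fin.ext (h.trans h'.symm) ▸ .rfl', .self, .inr hc⟩
  have hRv : NatMem S v := ⟨v.2, hv⟩
  have hRw : NatMem S w := ⟨w.2, hw⟩
  constructor
  · intro h
    obtain ⟨hc, _⟩ := (hself v hRv).1
    exact ((hself v hRv).2.1 v ⟨_, hc⟩ rfl rfl).trans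
      ((hself w hRw).2.1 w ⟨_, hc⟩ rfl h).symm
  -- A label never climbs above an uncovered ancestor.
  have hsub : ∀ a u, Subtree par root a u → NatMem S u →
      (a = root ∨ ¬ Covered (NatAdj F S) par root a) → Subtree par root a (comp u) := by
    intro a u hau hu hac
    by_cases har : a = root
    · exact har ▸ hT.subtree_root (hself u hu).1
    induction hau with
    | self => rw [h2 a hu har (hac.resolve_left har)]; exact .self
    | @child u hr hs ih =>
      by_cases hc : Covered (NatAdj F S) par root u
      · rw [h1 u hu hr hc]
        exact ih (hT.par_mem u hu hr)
      · rw [h2 u hu hr hc]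
        exact .child hr hs
  -- The subtree of `comp v` is everything or a bridge cut. It contains `v`, hence `w`, and then
  -- also the label of `w`.
  have key : ∀ v w : Fin n, v ∈ S → w ∈ S → SameSide F S v w →
      Subtree par root (comp v) (comp w) := by
    intro v w hv hw hs
    obtain ⟨g1, _, g3, g4⟩ := hself v ⟨v.2, hv⟩
    refine hsub _ _ ?_ ⟨w.2, hw⟩ g4
    by_cases hr : comp v = root
    · exact hr ▸ hT.subtree_root ⟨w.2, hw⟩
    · exact (hs _ (bridgeCut_subtree hT hpr g1 hr (g4.resolve_left hr))).1 g3
  intro hs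
  have k1 := key v w hv hw hs
  have k2 := key w v hw hv hs.symm
  -- Each label lies in the subtree of the other, and the numbers exclude that they differ.
  rcases hT.num_le k1 (hself w hRw).1 with h | h
  · exact h.symm
  · rcases hT.num_le k2 (hself v hRv).1 with h' | h'
    · exact h'
    · omega

/-- The graph is twinless strongly connected if and only if every tree edge is covered. -/
theorem twinlessSCOn_iff_covered (hF : StronglyConnectedOn F S)
    (hT : SpanTree (NatAdj F S) (NatMem S) root par num) (hpr : par root = n) :
    TwinlessSCOn F S ↔
      ∀ v, NatMem S v → v ≠ root → Covered (NatAdj F S) par root v := by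
  rw [hF.twinlessSCOn_iff]
  constructor
  · intro h v hv hvr
    by_contra hc
    obtain ⟨hp, hpS⟩ := hT.par_mem v hv hvr
    have := (h ⟨v, hv.1⟩ hv.2 ⟨par v, hp⟩ hpS _ (bridgeCut_subtree hT hpr hv hvr hc)).1 .self
    exact hT.not_subtree_par hv hvr this
  · intro h v hv w hw
    -- If every tree edge is covered, the constant labelling obeys the rules.
    exact (label_eq_iff (comp := fun _ => root) hT hpr rfl (fun _ _ _ _ => rfl)
      (fun v hv hvr hc => absurd (h v hv hvr) hc) hv hw).1 rfl

end Label

/-! ## Matrices stored by rows -/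

attribute [simp] ForProg.den RamExpr.eval Alg.rN Alg.rM Alg.rX Alg.rFlag Alg.rPick Alg.rI
  Alg.aSrc Alg.aDst Alg.aE2v Alg.aE2t Alg.aTap Alg.aComp

infixr:60 " ;; " => ForProg.seq

namespace Alg

/-- register: outer loop counter -/
@[simp] abbrev rOuter : ℕ := 6
/-- register: inner loop counter -/
@[simp] abbrev rInner : ℕ := 7
/-- register: accumulator -/
@[simp] abbrev rAcc : ℕ := 8
/-- register: deleted vertex -/
@[simp] abbrev rBan : ℕ := 9
/-- register: root of the search tree -/
@[simp] abbrev rRoot : ℕ := 10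
/-- register: number of vertices found by the search -/
@[simp] abbrev rCnt : ℕ := 11
/-- register: current vertex -/
@[simp] abbrev rCur : ℕ := 12
/-- register: parent of the current vertex -/
@[simp] abbrev rPar : ℕ := 13
/-- register: head of the queue -/
@[simp] abbrev rHead : ℕ := 14
/-- register: tail of the queue -/
@[simp] abbrev rTail : ℕ := 15
/-- register: largest number of a vertex of the path that was hit -/
@[simp] abbrev rHigh : ℕ := 16
/-- register: nonzero if the tested edge has to be kept -/
@[simp] abbrev rBad : ℕ := 17
/-- register: tested edge -/
@[simp] abbrev rEdge : ℕ := 18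
/-- register: position in the search order -/
@[simp] abbrev rPos : ℕ := 19
/-- register: end of the path -/
@[simp] abbrev rEnd : ℕ := 20

/-- array: beginnings of the rows of matrices -/
@[simp] abbrev aRow : ℕ := 6
/-- array: adjacency matrix -/
@[simp] abbrev aAdj : ℕ := 7
/-- array: search order -/
@[simp] abbrev aOrd : ℕ := 8
/-- array: visited vertices -/
@[simp] abbrev aVis : ℕ := 9
/-- array: parents in the search tree -/
@[simp] abbrev aPar : ℕ := 10
/-- array: positions in the search order -/
@[simp] abbrev aNum : ℕ := 11
/-- array: matrix of the adjacencies outside the tree -/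
@[simp] abbrev aOut : ℕ := 12
/-- array: matrix of the descendants -/
@[simp] abbrev aDesc : ℕ := 13
/-- array: covered vertices -/
@[simp] abbrev aCov : ℕ := 14
/-- array: queue -/
@[simp] abbrev aQueue : ℕ := 15
/-- array: vertices that were put into the queue -/
@[simp] abbrev aSeen : ℕ := 16

end Alg

open Alg

theorem cell_inj {n i j i' j' : ℕ} (hj : j < n) (hj' : j' < n) :
    i * n + j = i' * n + j' ↔ i = i' ∧ j = j' := by
  refine ⟨fun h => ?_, fun h => by rw [h.1, h.2]⟩
  have h1 : (j + n * i) / n = i := by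
    rw [Nat.add_mul_div_left _ _ (by omega), Nat.div_eq_of_lt hj, zero_add]
  have h2 : (j' + n * i') / n = i' := by
    rw [Nat.add_mul_div_left _ _ (by omega), Nat.div_eq_of_lt hj', zero_add]
  have h3 : j + n * i = j' + n * i' := by rw [mul_comm n i, mul_comm n i']; omega
  have h4 : i = i' := by rw [← h1, h3, h2]
  subst h4
  exact ⟨rfl, by omega⟩

/-- With row `i` starting at `i * n`, entries in columns below `n` occupy distinct cells, so a write
affects one entry only. -/
theorem update_cell {n : ℕ} (X : ℕ → ℕ) (k : ℕ) {i j i' j' : ℕ} (hj : j < n) (hj' : j' < n) :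
    Function.update X (i * n + j) k (i' * n + j') =
      if i' = i ∧ j' = j then k else X (i' * n + j') := by
  simp only [Function.update_apply, cell_inj hj' hj]

namespace ForProg

theorem Frame.inner {r : ℕ} {b : LoopBound} {p : ForProg} {σ τ τ' : RamState}
    (h : (count r b p).Frame σ τ) (h' : p.Frame τ τ') : (count r b p).Frame σ τ' := by
  refine ⟨fun r' hr => ?_, fun a ha => (h'.arr a ha).trans (h.arr a ha)⟩
  have hr' := hr
  simp only [regs, List.mem_cons, not_or] at hr'
  exact (h'.reg r' hr'.2).trans (h.reg r' hr)

end ForProg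

/-- The array `aRow` contains the beginnings of the rows of an `n × n` matrix. -/
def RowsOk (n : ℕ) (σ : RamState) : Prop := ∀ i < n, σ.arr aRow i = i * n

/-- Compute the beginnings of the rows. -/
def rowsProg : ForProg :=
  .assign rAcc (.lit 0) ;;
  .count rOuter .verts
    (.write aRow (.reg rOuter) (.reg rAcc) ;; .assign rAcc (.add (.reg rAcc) (.reg rN)))

theorem rowsProg_spec {n : ℕ} {σ : RamState} (hn : σ.reg rN = n) : RowsOk n (rowsProg.den σ) := by
  have := ForProg.count_rule (r := rOuter) (b := .verts)
    (p := .write aRow (.reg rOuter) (.reg rAcc) ;; .assign rAcc (.add (.reg rAcc) (.reg rN)))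
    (σ := σ.setReg rAcc 0)
    -- The machine has no multiplication; the accumulator runs through the multiples of `n` instead.
    (fun k τ => τ.reg rAcc = k * n ∧ ∀ i < k, τ.arr aRow i = i * n)
    (by simp) (by
      intro k hk τ hF hr hI
      have hN : τ.reg rN = n := (hF.reg rN (by decide)).trans (by simpa using hn)
      simp only [rOuter, rAcc, rN] at hr hI hN ⊢
      refine ⟨?_, fun i hi => ?_⟩
      · simp [hI.1, hN, Nat.succ_mul]
      · simp only [ForProg.den, RamExpr.eval, RamState.arr_setReg, RamState.arr_setArr, hr, hI.1]
        simp only [if_true, Function.update_apply]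
        split_ifs with h
        · rw [h]
        · exact hI.2 i (by omega))
  simp only [LoopBound.val] at this
  have h2 := this.2
  intro i hi
  exact h2 i (by simpa [hn] using hi)

/-- Fill the matrix `a`; the entry may depend on the two loop counters. -/
def fill (a : ℕ) (e : RamExpr) : ForProg :=
  .count rOuter .verts (.count rInner .verts
    (.write a (.add (.read aRow (.reg rOuter)) (.reg rInner)) e))

/-- The entry is evaluated in states that agree with `σ` except for the matrix and the two counters,
so `e` may depend on any other data of `σ`. -/
theorem fill_spec {n a : ℕ} {e : RamExpr} {σ : RamState} (ha : a ≠ aRow) (hn : σ.reg rN = n)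
    (hrow : RowsOk n σ) (g : ℕ → ℕ → ℕ)
    (he : ∀ i < n, ∀ j < n, ∀ τ, (fill a e).Frame σ τ → τ.reg rOuter = i → τ.reg rInner = j →
      e.eval τ = g i j) :
    ∀ i < n, ∀ j < n, ((fill a e).den σ).arr a (i * n + j) = g i j := by
  have := ForProg.count_rule (r := rOuter) (b := .verts)
    (p := .count rInner .verts (.write a (.add (.read aRow (.reg rOuter)) (.reg rInner)) e))
    (σ := σ) (fun k τ => ∀ i < k, ∀ j < n, τ.arr a (i * n + j) = g i j) (by simp) (by
      intro k hk τ hF hr hI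
      have hNτ : τ.reg rN = n := (hF.reg rN (by simp [ForProg.regs])).trans hn
      have := ForProg.count_rule (r := rInner) (b := .verts)
        (p := .write a (.add (.read aRow (.reg rOuter)) (.reg rInner)) e) (σ := τ)
        (fun l τ' => (∀ i < k, ∀ j < n, τ'.arr a (i * n + j) = g i j) ∧
          ∀ j < l, τ'.arr a (k * n + j) = g k j) (by simpa using hI) (by
          intro l hl τ' hF' hr' hI'
          have hF2 := hF.inner hF'
          have hO : τ'.reg rOuter = k := (hF'.reg rOuter (by simp [ForProg.regs])).trans hr
          have hkn : k < n := by simpa [LoopBound.val, ← hn] using hk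
          have hln : l < n := by simpa [LoopBound.val, ← hNτ] using hl
          have hrw : τ'.arr aRow k = k * n := by
            rw [hF2.arr aRow (by simpa [ForProg.arrs] using ha.symm)]
            exact hrow k hkn
          have hev := he k hkn l hln τ' hF2 hO hr'
          simp only [ForProg.den, RamExpr.eval, RamState.arr_setReg, RamState.arr_setArr, if_true,
            hO, hr', hrw, hev]
          refine ⟨fun i hi j hj => ?_, fun j hj => ?_⟩
          · rw [update_cell _ _ hln hj, if_neg (by omega)]
            exact hI'.1 i hi j hj
          · rw [update_cell _ _ hln (by omega)]
            split_ifs with h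
            · rw [h.2]
            · exact hI'.2 j (by omega))
      simp only [LoopBound.val, hNτ] at this
      intro i hi j hj
      simp only [RamState.arr_setReg]
      rcases Nat.lt_succ_iff_lt_or_eq.1 hi with h | rfl
      · exact this.1 i h j hj
      · exact this.2 j hj)
  simp only [LoopBound.val, hn] at this
  exact this

/-! ### The adjacency matrix of a vertex-deleted graph -/

/-- Write the adjacency matrix of the graph whose edges are marked in `a`, without the vertex in the
register `rBan`. -/
def adjProg (a : ℕ) : ForProg :=
  fill aAdj (.lit 0) ;;
  .count rOuter .edges
    (.ite (.read a (.reg rOuter))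
      (.ite (.eq (.read aSrc (.reg rOuter)) (.reg rBan)) .skip
        (.ite (.eq (.read aDst (.reg rOuter)) (.reg rBan)) .skip
          (.write aAdj (.add (.read aRow (.read aSrc (.reg rOuter))) (.read aDst (.reg rOuter)))
            (.lit 1)))) .skip)

/-- The matrix in the array `aAdj` is the adjacency matrix of `A`. -/
def StoresAdj (n : ℕ) (A : ℕ → ℕ → Prop) (σ : RamState) : Prop :=
  ∀ u < n, ∀ w < n, σ.arr aAdj (u * n + w) ≠ 0 ↔ A u w

/-- After `k` rounds the matrix reflects the first `k` positions of the edge list, which contains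
all of `F`. The value `n` in `rBan` deletes nothing and gives `S = Set.univ`. -/
theorem adjProg_spec {n : ℕ} {L : List (Fin n × Fin n)} {a : ℕ} (ha : a ∉ [aRow, aAdj])
    {σ : RamState} (hG : StoresGraph L σ) (hrow : RowsOk n σ) {F : Set (Fin n × Fin n)}
    (hFL : F ⊆ edgeSet L) (hF : StoresEdges L a F σ) {S : Set (Fin n)}
    (hS : ∀ v : Fin n, v ∈ S ↔ (v : ℕ) ≠ σ.reg rBan) :
    StoresAdj n (NatAdj F S) ((adjProg a).den σ) := by
  have haR : a ≠ aRow := fun h => ha (by simp [h])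
  have haA : a ≠ aAdj := fun h => ha (by simp [h])
  obtain ⟨hN, hM, hL⟩ := hG
  have h0 := fill_spec (a := aAdj) (e := .lit 0) (σ := σ) (by decide) hN hrow (fun _ _ => 0)
    (by intros; rfl)
  have hf0 := ForProg.frame_den (fill aAdj (.lit 0)) σ
  set σ' := (fill aAdj (.lit 0)).den σ with hσ'
  let P : ℕ → ℕ → ℕ → Prop := fun k u w => ∃ i, ∃ h : i < L.length, i < k ∧ L[i] ∈ F ∧
    ((L[i]).1 : ℕ) = u ∧ ((L[i]).2 : ℕ) = w ∧ (L[i]).1 ∈ S ∧ (L[i]).2 ∈ S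
  have := ForProg.count_rule (r := rOuter) (b := .edges)
    (p := .ite (.read a (.reg rOuter))
      (.ite (.eq (.read aSrc (.reg rOuter)) (.reg rBan)) .skip
        (.ite (.eq (.read aDst (.reg rOuter)) (.reg rBan)) .skip
          (.write aAdj (.add (.read aRow (.read aSrc (.reg rOuter))) (.read aDst (.reg rOuter)))
            (.lit 1)))) .skip) (σ := σ')
    (fun k τ => ∀ u < n, ∀ w < n, τ.arr aAdj (u * n + w) ≠ 0 ↔ P k u w) (by
      intro u hu w hw
      simp only [RamState.arr_setReg, h0 u hu w hw]
      simp [P]) (by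
      intro k hk τ hFr hr hI
      have hMσ' : σ'.reg rM = L.length := (hf0.reg rM (by decide)).trans hM
      have hkL : k < L.length := by simpa only [LoopBound.val, hMσ'] using hk
      have e1 : τ.arr a = σ.arr a := (hFr.arr a (by simpa [ForProg.arrs] using haA)).trans
        (hf0.arr a (by simpa [ForProg.arrs, fill] using haA))
      have e2 : τ.arr aSrc k = (L[k].1 : ℕ) := by
        rw [hFr.arr aSrc (by simp [ForProg.arrs]), hf0.arr aSrc (by decide)]
        exact (hL k hkL).1
      have e3 : τ.arr aDst k = (L[k].2 : ℕ) := by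
        rw [hFr.arr aDst (by simp [ForProg.arrs]), hf0.arr aDst (by decide)]
        exact (hL k hkL).2
      have e4 : τ.arr aRow (L[k].1 : ℕ) = (L[k].1 : ℕ) * n := by
        rw [hFr.arr aRow (by simp [ForProg.arrs]), hf0.arr aRow (by decide)]
        exact hrow _ L[k].1.2
      have e5 : τ.reg rBan = σ.reg rBan :=
        (hFr.reg rBan (by simp [ForProg.regs])).trans (hf0.reg rBan (by decide))
      have e6 : τ.arr a k ≠ 0 ↔ L[k] ∈ F := by rw [e1]; exact hF k hkL
      have hP : ∀ u w, P (k + 1) u w ↔ P k u w ∨ (L[k] ∈ F ∧ (L[k].1 : ℕ) = u ∧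
          (L[k].2 : ℕ) = w ∧ L[k].1 ∈ S ∧ L[k].2 ∈ S) := by
        intro u w
        constructor
        · rintro ⟨i, h, hik, h'⟩
          rcases Nat.lt_succ_iff_lt_or_eq.1 hik with h1 | rfl
          · exact .inl ⟨i, h, h1, h'⟩
          · exact .inr h'
        · rintro (⟨i, h, hik, h'⟩ | h')
          · exact ⟨i, h, by omega, h'⟩
          · exact ⟨k, hkL, by omega, h'⟩
      intro u hu w hw
      rw [hP u w, ← hI u hu w hw]
      have s1 := hS L[k].1
      have s2 := hS L[k].2
      rw [← e5, ← e2] at s1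
      rw [← e5, ← e3] at s2
      simp only [RamState.arr_setReg, ForProg.den, RamExpr.eval, hr]
      by_cases c1 : τ.arr a k ≠ 0
      · rw [if_pos c1]
        by_cases c2 : τ.arr aSrc k = τ.reg rBan
        · have : L[k].1 ∉ S := fun h => s1.1 h c2
          simp only [c2, if_true, ne_eq, one_ne_zero, not_false_eq_true]
          tauto
        by_cases c3 : τ.arr aDst k = τ.reg rBan
        · have : L[k].2 ∉ S := fun h => s2.1 h c3
          simp only [c2, c3, if_true, if_false, ne_eq, one_ne_zero, not_false_eq_true,
            not_true_eq_false]
          tauto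
        simp only [c2, c3, if_false, ne_eq, not_true_eq_false, RamState.arr_setArr, if_true]
        rw [e2, e3, e4, update_cell _ _ L[k].2.2 hw]
        split_ifs with h
        · simp only [not_false_eq_true, true_iff]
          exact .inr ⟨e6.1 c1, h.1.symm, h.2.symm, s1.2 c2, s2.2 c3⟩
        · refine ⟨.inl, fun h' => h'.resolve_right fun h' => h ⟨h'.2.1.symm, h'.2.2.1.symm⟩⟩
      · rw [if_neg c1]
        have : L[k] ∉ F := fun h => c1 (e6.2 h)
        tauto)
  have hMσ' : σ'.reg rM = L.length := (hf0.reg rM (by decide)).trans hM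
  simp only [LoopBound.val, hMσ'] at this
  intro u hu w hw
  refine (this u hu w hw).trans ?_
  constructor
  · rintro ⟨i, hi, _, h1, rfl, rfl, h2, h3⟩
    exact ⟨L[i].1.2, L[i].2.2, h2, h3, h1⟩
  · rintro ⟨_, _, h2, h3, h1⟩
    obtain ⟨i, hi, h⟩ := List.getElem_of_mem (hFL h1)
    refine ⟨i, hi, hi, ?_⟩
    rw [h]
    exact ⟨h1, rfl, rfl, h2, h3⟩

/-! ## Breadth-first search -/

/-- State of a search: `ord` lists the `cnt` vertices found so far, `num` are their positions in this
list, and the pairs in `done` have been inspected. -/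
structure SearchState (n : ℕ) (A : ℕ → ℕ → Prop) (root : ℕ) (ord num par vis : ℕ → ℕ) (cnt : ℕ)
    (done : ℕ → ℕ → Prop) : Prop where
  pos : 0 < cnt
  ord_zero : ord 0 = root
  num_ord : ∀ i < cnt, num (ord i) = i
  ord_lt : ∀ i < cnt, ord i < n
  vis_iff : ∀ v < n, vis v ≠ 0 ↔ ∃ i < cnt, ord i = v
  par_root : par root = n
  par_ord : ∀ i, 0 < i → i < cnt → ∃ j < i, par (ord i) = ord j ∧ A (ord j) (ord i)
  closed : ∀ i < cnt, ∀ w < n, done i w → A (ord i) w → vis w ≠ 0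

/-- A list of distinct numbers below `n` has at most `n` entries. -/
theorem le_of_injOn_lt {f : ℕ → ℕ} {c n : ℕ} (hf : ∀ i < c, f i < n)
    (hinj : ∀ i < c, ∀ j < c, f i = f j → i = j) : c ≤ n := by
  have := Finset.card_le_card_of_injOn (s := Finset.range c) (t := Finset.range n) f
    (fun i hi => by simpa using hf i (by simpa using hi))
    (fun i hi j hj h => hinj i (by simpa using hi) j (by simpa using hj) h)
  simpa using this

namespace SearchState

variable {n : ℕ} {A : ℕ → ℕ → Prop} {root : ℕ} {ord num par vis : ℕ → ℕ} {cnt : ℕ}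
  {done done' : ℕ → ℕ → Prop}

theorem cnt_le (h : SearchState n A root ord num par vis cnt done) : cnt ≤ n :=
  le_of_injOn_lt h.ord_lt fun i hi j hj hij => by rw [← h.num_ord i hi, hij, h.num_ord j hj]

theorem congr_done (h : SearchState n A root ord num par vis cnt done)
    (h' : ∀ i < cnt, ∀ w < n, done' i w → A (ord i) w → vis w ≠ 0) :
    SearchState n A root ord num par vis cnt done' := { h with closed := h' }

/-- The vertex `w` is appended at position `cnt`, after its parent `ord k`. By `hdone` the row of
the new vertex does not yet count as inspected. -/
theorem visit (h : SearchState n A root ord num par vis cnt done) {k w : ℕ} (hk : k < cnt)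
    (hw : w < n) (hv : vis w = 0) (hA : A (ord k) w) (hdone : ∀ x, ¬ done cnt x) :
    SearchState n A root (Function.update ord cnt w) (Function.update num w cnt)
      (Function.update par w (ord k)) (Function.update vis w 1) (cnt + 1) done := by
  have hne : ∀ i < cnt, ord i ≠ w := fun i hi hiw => (h.vis_iff w hw).2 ⟨i, hi, hiw⟩ hv
  have hord : ∀ i < cnt, Function.update ord cnt w i = ord i := fun i hi =>
    Function.update_of_ne (by omega) _ _
  have hroot : root ≠ w := h.ord_zero ▸ hne 0 h.pos
  refine ⟨by omega, ?_, ?_, ?_, ?_, ?_, ?_, ?_⟩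
  · rw [hord 0 h.pos, h.ord_zero]
  · intro i hi
    rcases Nat.lt_succ_iff_lt_or_eq.1 hi with hi | rfl
    · rw [hord i hi, Function.update_of_ne (hne i hi), h.num_ord i hi]
    · simp
  · intro i hi
    rcases Nat.lt_succ_iff_lt_or_eq.1 hi with hi | rfl
    · rw [hord i hi]
      exact h.ord_lt i hi
    · simpa using hw
  · intro v hv'
    constructor
    · intro hvis
      by_cases hvw : v = w
      · exact ⟨cnt, by omega, by simp [hvw]⟩
      · rw [Function.update_of_ne hvw] at hvis
        obtain ⟨i, hi, hiv⟩ := (h.vis_iff v hv').1 hvis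
        exact ⟨i, by omega, by rw [hord i hi, hiv]⟩
    · rintro ⟨i, hi, rfl⟩
      rcases Nat.lt_succ_iff_lt_or_eq.1 hi with hi | rfl
      · rw [hord i hi, Function.update_of_ne (hne i hi)]
        exact (h.vis_iff _ (h.ord_lt i hi)).2 ⟨i, hi, rfl⟩
      · simp
  · rw [Function.update_of_ne hroot, h.par_root]
  · intro i hi0 hi
    rcases Nat.lt_succ_iff_lt_or_eq.1 hi with hi | rfl
    · obtain ⟨j, hj, h1, h2⟩ := h.par_ord i hi0 hi
      refine ⟨j, hj, ?_⟩
      rw [hord i hi, hord j (by omega), Function.update_of_ne (hne i hi)]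
      exact ⟨h1, h2⟩
    · refine ⟨k, hk, ?_⟩
      rw [hord k hk]
      simpa using hA
  · intro i hi v hv' hd hiv
    rcases Nat.lt_succ_iff_lt_or_eq.1 hi with hi | rfl
    · rw [hord i hi] at hiv
      have := h.closed i hi v hv' hd hiv
      by_cases hvw : v = w
      · simp [hvw]
      · rwa [Function.update_of_ne hvw]
    · exact absurd hd (hdone v)

/-- Parents are found before their children, so positions in the search order increase down the
tree. -/
theorem spanTree (h : SearchState n A root ord num par vis cnt done) :
    SpanTree A (fun v => v < n ∧ vis v ≠ 0) root par num := by
  have hmem : ∀ i < cnt, ord i < n ∧ vis (ord i) ≠ 0 := fun i hi =>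
    ⟨h.ord_lt i hi, (h.vis_iff _ (h.ord_lt i hi)).2 ⟨i, hi, rfl⟩⟩
  have key : ∀ v, (v < n ∧ vis v ≠ 0) → v ≠ root →
      ∃ i j, i < cnt ∧ j < i ∧ v = ord i ∧ par v = ord j ∧ A (ord j) v := by
    rintro v ⟨hv, hvis⟩ hvr
    obtain ⟨i, hi, rfl⟩ := (h.vis_iff v hv).1 hvis
    have : i ≠ 0 := fun hi0 => hvr (by rw [hi0, h.ord_zero])
    obtain ⟨j, hj, h1, h2⟩ := h.par_ord i (by omega) hi
    exact ⟨i, j, hi, hj, rfl, h1, h2⟩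
  refine ⟨h.ord_zero ▸ hmem 0 h.pos, ?_, ?_, ?_⟩
  · intro v hv hvr
    obtain ⟨i, j, hi, hj, rfl, h1, -⟩ := key v hv hvr
    simp only [h1]
    exact hmem j (by omega)
  · intro v hv hvr
    obtain ⟨i, j, hi, hj, rfl, h1, h2⟩ := key v hv hvr
    rwa [h1]
  · intro v hv hvr
    obtain ⟨i, j, hi, hj, rfl, h1, h2⟩ := key v hv hvr
    rw [h1, h.num_ord i hi, h.num_ord j (by omega)]
    exact hj

/-- After a complete search the visited set is closed under adjacency. -/
theorem reach_vis (h : SearchState n A root ord num par vis cnt fun _ _ => True)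
    (hA : ∀ u w, A u w → w < n) {v : ℕ} (hv : Relation.ReflTransGen A root v) :
    v < n ∧ vis v ≠ 0 := by
  induction hv with
  | refl => exact h.spanTree.root_mem
  | @tail u w _ huw ih =>
    obtain ⟨i, hi, rfl⟩ := (h.vis_iff u ih.1).1 ih.2
    exact ⟨hA _ _ huw, h.closed i hi w (hA _ _ huw) trivial huw⟩

end SearchState

/-- The state of the search stored in memory. -/
def StoresSearch (n : ℕ) (A : ℕ → ℕ → Prop) (done : ℕ → ℕ → Prop) (σ : RamState) : Prop :=
  SearchState n A (σ.reg rRoot) (σ.arr aOrd) (σ.arr aNum) (σ.arr aPar) (σ.arr aVis) (σ.reg rCnt)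
    done

/-- Inspect the pair of the current vertex and the inner counter. -/
def visitProg : ForProg :=
  .ite (.read aAdj (.add (.read aRow (.reg rCur)) (.reg rInner)))
    (.ite (.read aVis (.reg rInner)) .skip
      (.write aVis (.reg rInner) (.lit 1) ;;
        .write aPar (.reg rInner) (.reg rCur) ;;
        .write aNum (.reg rInner) (.reg rCnt) ;;
        .write aOrd (.reg rCnt) (.reg rInner) ;;
        .assign rCnt (.add (.reg rCnt) (.lit 1)))) .skip

/-- Initialize the search. -/
def searchInit : ForProg :=
  .count rOuter .verts (.write aVis (.reg rOuter) (.lit 0)) ;;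
  .write aOrd (.lit 0) (.reg rRoot) ;;
  .write aVis (.reg rRoot) (.lit 1) ;;
  .write aNum (.reg rRoot) (.lit 0) ;;
  .write aPar (.reg rRoot) (.reg rN) ;;
  .assign rCnt (.lit 1)

/-- Inspect all vertices. -/
def searchLoop : ForProg :=
  .count rOuter .verts
    (.ite (.lt (.reg rOuter) (.reg rCnt))
      (.assign rCur (.read aOrd (.reg rOuter)) ;; .count rInner .verts visitProg) .skip)

/-- Search from the vertex in the register `rRoot`. -/
def searchProg : ForProg := searchInit ;; searchLoop

/-- Clear the array `a` up to `n`. -/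
theorem clear_spec {a : ℕ} {n : ℕ} {σ : RamState} (hn : σ.reg rN = n) :
    ∀ i < n, ((ForProg.count rOuter .verts (.write a (.reg rOuter) (.lit 0))).den σ).arr a i = 0 := by
  have := ForProg.count_rule (r := rOuter) (b := .verts)
    (p := .write a (.reg rOuter) (.lit 0)) (σ := σ)
    (fun k τ => ∀ i < k, τ.arr a i = 0) (by simp) (by
      intro k hk τ hF hr hI i hi
      simp only [ForProg.den, RamExpr.eval, RamState.arr_setReg, RamState.arr_setArr, if_true, hr,
        Function.update_apply]
      split_ifs with h
      · rfl
      · exact hI i (by omega))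
  simp only [LoopBound.val, hn] at this
  exact this

theorem searchInit_spec {n : ℕ} {A : ℕ → ℕ → Prop} {σ : RamState} (hn : σ.reg rN = n)
    (hroot : σ.reg rRoot < n) : StoresSearch n A (fun _ _ => False) (searchInit.den σ) := by
  have hc := clear_spec (a := aVis) hn
  have hf := ForProg.frame_den (.count rOuter .verts (.write aVis (.reg rOuter) (.lit 0))) σ
  have e1 := hf.reg rRoot (by decide)
  have e2 := hf.reg rN (by decide)
  simp only [searchInit]
  rw [ForProg.den]
  set τ := ForProg.den (.count rOuter .verts (.write aVis (.reg rOuter) (.lit 0))) σ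
  rw [← e1] at hroot
  have e3 : τ.reg 0 = n := e2.trans hn
  simp only [rRoot] at hroot
  simp only [StoresSearch, ForProg.den, RamExpr.eval, RamState.reg_setReg, RamState.arr_setReg,
    RamState.arr_setArr, RamState.reg_setArr, aOrd, aNum, aPar, aVis, rRoot, rCnt, rN]
  simp only [Nat.reduceEqDiff, if_false, if_true, e3]
  refine ⟨by norm_num, by simp, ?_, ?_, ?_, by simp, ?_, ?_⟩
  · intro i hi
    obtain rfl : i = 0 := by omega
    simp
  · intro i hi
    obtain rfl : i = 0 := by omega
    simpa using hroot
  · intro v hv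
    have := hc v hv
    simp only [aVis] at this
    constructor
    · intro h
      by_cases hvr : v = τ.reg 10
      · exact ⟨0, by norm_num, by simp [hvr]⟩
      · rw [Function.update_of_ne hvr] at h
        exact absurd this h
    · rintro ⟨i, hi, rfl⟩
      obtain rfl : i = 0 := by omega
      simp
  · intro i h0 hi
    omega
  · intro i hi w hw h
    exact h.elim

/-- Either `l` is no neighbour, or it was visited before, or it is appended at position `cnt > k`,
which leaves the current entry of `aOrd` alone. -/
theorem visitProg_spec {n : ℕ} {A : ℕ → ℕ → Prop} {τ : RamState} {k l : ℕ}
    (hrow : RowsOk n τ) (hA : StoresAdj n A τ) (hl : l < n) (hr : τ.reg rInner = l)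
    (hk : k < τ.reg rCnt) (hcur : τ.reg rCur = τ.arr aOrd k)
    (h : StoresSearch n A (fun i w => i < k ∨ (i = k ∧ w < l)) τ) :
    (visitProg.den τ).reg rCur = (visitProg.den τ).arr aOrd k ∧ k < (visitProg.den τ).reg rCnt ∧
      StoresSearch n A (fun i w => i < k ∨ (i = k ∧ w < l + 1)) (visitProg.den τ) := by
  have hordk := h.ord_lt k hk
  have hcell := hA _ hordk l hl
  rw [← hrow _ hordk, ← hcur] at hcell
  have upd : (A (τ.arr aOrd k) l → τ.arr aVis l ≠ 0) →
      StoresSearch n A (fun i w => i < k ∨ (i = k ∧ w < l + 1)) τ := by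
    intro hvis
    refine h.congr_done fun i hi w hw hd hiw => ?_
    rcases hd with hd | ⟨rfl, hd⟩
    · exact h.closed i hi w hw (.inl hd) hiw
    · rcases Nat.lt_succ_iff_lt_or_eq.1 hd with hd | rfl
      · exact h.closed i hi w hw (.inr ⟨rfl, hd⟩) hiw
      · exact hvis hiw
  simp only [visitProg, ForProg.den, RamExpr.eval, hr]
  by_cases c1 : τ.arr aAdj (τ.arr aRow (τ.reg rCur) + l) ≠ 0
  · rw [if_pos c1]
    by_cases c2 : τ.arr aVis l ≠ 0
    · rw [if_pos c2]
      exact ⟨hcur, hk, upd fun _ => c2⟩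
    · rw [if_neg c2]
      have hAl : A (τ.arr aOrd k) l := by rw [← hcur]; exact hcell.1 c1
      have := h.visit hk hl (not_not.1 c2) hAl (fun x hx => by omega)
      rw [← hcur] at this
      have hr' := hr
      simp only [rInner] at hr'
      have hk' := hk
      have hcur' := hcur
      simp only [rCnt, rCur, aOrd] at hk' hcur'
      simp only [StoresSearch, RamState.reg_setReg, RamState.arr_setReg, RamState.arr_setArr,
        RamState.reg_setArr, aOrd, aNum, aPar, aVis, rRoot, rCnt, rInner, rCur] at this ⊢
      simp only [Nat.reduceEqDiff, if_false, if_true, hr'] at this ⊢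
      refine ⟨?_, by omega, ?_⟩
      · rw [Function.update_of_ne (by omega), hcur']
      refine this.congr_done fun i hi w hw hd hiw => ?_
      rcases hd with hd | ⟨rfl, hd⟩
      · exact this.closed i hi w hw (.inl hd) hiw
      · rcases Nat.lt_succ_iff_lt_or_eq.1 hd with hd | rfl
        · exact this.closed i hi w hw (.inr ⟨rfl, hd⟩) hiw
        · simp
  · rw [if_neg c1]
    exact ⟨hcur, hk, upd fun hA' => absurd (hcell.2 (by rw [hcur]; exact hA')) c1⟩

/-- The search order itself is the queue: round `k` inspects the row of the vertex at position `k`,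
and rounds with `k ≥ cnt` are idle. Since `cnt ≤ n`, all positions get their turn. -/
theorem searchLoop_spec {n : ℕ} {A : ℕ → ℕ → Prop} {σ : RamState} (hn : σ.reg rN = n)
    (hrow : RowsOk n σ) (hA : StoresAdj n A σ) (h : StoresSearch n A (fun _ _ => False) σ) :
    StoresSearch n A (fun _ _ => True) (searchLoop.den σ) := by
  have := ForProg.count_rule (r := rOuter) (b := .verts)
    (p := .ite (.lt (.reg rOuter) (.reg rCnt))
      (.assign rCur (.read aOrd (.reg rOuter)) ;; .count rInner .verts visitProg) .skip) (σ := σ)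
    (fun k τ => StoresSearch n A (fun i _ => i < k) τ)
    (h.congr_done fun i hi w hw hd => absurd hd (by omega)) (by
      intro k hk τ hF hr hI
      have hNτ : τ.reg rN = n := (hF.reg rN (by decide)).trans hn
      simp only [ForProg.den, RamExpr.eval, hr]
      by_cases c : k < τ.reg rCnt
      · simp only [c, if_true, ne_eq, one_ne_zero, not_false_eq_true]
        have := ForProg.count_rule (r := rInner) (b := .verts) (p := visitProg)
          (σ := τ.setReg rCur (τ.arr aOrd k))
          (fun l τ' => τ'.reg rCur = τ'.arr aOrd k ∧ k < τ'.reg rCnt ∧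
            StoresSearch n A (fun i w => i < k ∨ (i = k ∧ w < l)) τ')
          (by
            refine ⟨by simp, by simpa using c, ?_⟩
            refine hI.congr_done fun i hi w hw hd => ?_
            exact hI.closed i hi w hw (by omega)) (by
            intro l hl τ' hF' hr' hI'
            have hln : l < n := by
              simpa only [LoopBound.val, RamState.reg_setReg, rCur, rN, OfNat.zero_ne_ofNat,
                if_false, show τ.reg 0 = n from hNτ] using hl
            have hrow' : RowsOk n τ' := by
              intro i hi
              rw [hF'.arr aRow (by decide), RamState.arr_setReg, hF.arr aRow (by decide)]
              exact hrow i hi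
            have hA' : StoresAdj n A τ' := by
              intro i hi j hj
              rw [hF'.arr aAdj (by decide), RamState.arr_setReg, hF.arr aAdj (by decide)]
              exact hA i hi j hj
            obtain ⟨g1, g2, g3⟩ := hI'
            simpa [StoresSearch] using visitProg_spec hrow' hA' hln hr' g2 g1 g3)
        simp only [LoopBound.val] at this
        obtain ⟨_, _, h3⟩ := this
        refine h3.congr_done fun i hi w hw hd hiw => h3.closed i hi w hw ?_ hiw
        simp only [RamState.reg_setReg, rCur, rN, OfNat.zero_ne_ofNat, if_false,
          show τ.reg 0 = n from hNτ]
        omega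
      · simp only [c, if_false, ne_eq, not_true_eq_false]
        refine hI.congr_done fun i hi w hw hd => ?_
        have : i < τ.reg rCnt := hi
        exact hI.closed i hi w hw (by omega))
  simp only [LoopBound.val, hn] at this
  refine this.congr_done fun i hi w hw _ => this.closed i hi w hw ?_
  exact hi.trans_le this.cnt_le

theorem searchProg_spec {n : ℕ} {A : ℕ → ℕ → Prop} {σ : RamState} (hn : σ.reg rN = n)
    (hrow : RowsOk n σ) (hA : StoresAdj n A σ) (hroot : σ.reg rRoot < n) :
    StoresSearch n A (fun _ _ => True) (searchProg.den σ) := by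
  have hf := ForProg.frame_den searchInit σ
  refine searchLoop_spec ((hf.reg rN (by decide)).trans hn) ?_ ?_ (searchInit_spec hn hroot)
  · intro i hi
    rw [hf.arr aRow (by decide)]
    exact hrow i hi
  · intro i hi j hj
    rw [hf.arr aAdj (by decide)]
    exact hA i hi j hj

/-! ## Computing the components -/

/-- Add to every row of the matrix `X` the rows of all descendants. -/
def gatherProg (X : ℕ) : ForProg :=
  .count rOuter .verts
    (.ite (.lt (.add (.reg rOuter) (.lit 1)) (.reg rCnt))
      (.assign rCur (.read aOrd (.sub (.reg rCnt) (.add (.reg rOuter) (.lit 1)))) ;;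
        .assign rPar (.read aPar (.reg rCur)) ;;
        .count rInner .verts
          (.ite (.read X (.add (.read aRow (.reg rCur)) (.reg rInner)))
            (.write X (.add (.read aRow (.reg rPar)) (.reg rInner)) (.lit 1)) .skip)) .skip)

/-- As `y ≠ p`, the row that is read does not change while the row of `p` receives its entries. -/
theorem gatherProg_row {n X y p : ℕ} {σ : RamState} (hX : X ≠ aRow) (hn : σ.reg rN = n)
    (hrow : RowsOk n σ) (hy : y < n) (hp : p < n) (hyp : y ≠ p) (hcur : σ.reg rCur = y)
    (hpar : σ.reg rPar = p) :
    ∀ z < n, ∀ c < n, ((ForProg.count rInner .verts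
          (.ite (.read X (.add (.read aRow (.reg rCur)) (.reg rInner)))
            (.write X (.add (.read aRow (.reg rPar)) (.reg rInner)) (.lit 1)) .skip)).den σ).arr X
            (z * n + c) ≠ 0 ↔ σ.arr X (z * n + c) ≠ 0 ∨ (z = p ∧ σ.arr X (y * n + c) ≠ 0) := by
  have := ForProg.count_rule (r := rInner) (b := .verts)
    (p := .ite (.read X (.add (.read aRow (.reg rCur)) (.reg rInner)))
            (.write X (.add (.read aRow (.reg rPar)) (.reg rInner)) (.lit 1)) .skip) (σ := σ)
    (fun l τ => ∀ z < n, ∀ c < n, τ.arr X (z * n + c) ≠ 0 ↔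
      σ.arr X (z * n + c) ≠ 0 ∨ (z = p ∧ c < l ∧ σ.arr X (y * n + c) ≠ 0)) (by simp) (by
      intro l hl τ hF hr hI z hz c hc
      have hln : l < n := by simpa only [LoopBound.val, hn] using hl
      have e1 : τ.reg rCur = y := (hF.reg rCur (by simp [ForProg.regs])).trans hcur
      have e2 : τ.reg rPar = p := (hF.reg rPar (by simp [ForProg.regs])).trans hpar
      have e3 : ∀ i < n, τ.arr aRow i = i * n := fun i hi => by
        rw [hF.arr aRow (by simpa [ForProg.arrs] using hX.symm)]
        exact hrow i hi
      have hyl := hI y hy l hln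
      have hzc := hI z hz c hc
      have aux : c < l + 1 ↔ c < l ∨ c = l := by omega
      simp only [ForProg.den, RamExpr.eval, e1, e2, e3 y hy, e3 p hp, hr, RamState.arr_setReg]
      by_cases h : τ.arr X (y * n + l) ≠ 0
      · rw [if_pos h, RamState.arr_setArr, if_pos rfl, update_cell _ _ hln hc]
        split_ifs with hzp
        · obtain ⟨rfl, rfl⟩ := hzp
          have := hyl.1 h
          simp only [ne_eq, one_ne_zero, not_false_eq_true, true_iff]
          tauto
        · rw [hzc, aux]
          tauto
      · rw [if_neg h, hzc, aux]
        have h' : ¬ (σ.arr X (y * n + l) ≠ 0) := fun h2 => h (hyl.2 (.inl h2))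
        constructor
        · tauto
        · rintro (h1 | ⟨h1, h2 | rfl, h3⟩)
          · exact .inl h1
          · exact .inr ⟨h1, h2, h3⟩
          · exact absurd h3 h')
  simp only [LoopBound.val, hn] at this
  intro z hz c hc
  rw [this z hz c hc]
  tauto

/-- Positions are processed from the last one down to 1, so a vertex passes its row on only after it
has received the rows of its children, whose positions are larger. Position 0 is the root and has no
parent; rows of unvisited vertices are never written. -/
theorem gatherProg_spec {n X : ℕ} {A : ℕ → ℕ → Prop} {σ : RamState}
    (hX : X ∉ [aRow, aOrd, aPar]) (hn : σ.reg rN = n) (hrow : RowsOk n σ)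
    (hs : StoresSearch n A (fun _ _ => True) σ) :
    ∀ y < n, ∀ c < n,
      (σ.arr aVis y ≠ 0 → (((gatherProg X).den σ).arr X (y * n + c) ≠ 0 ↔
        ∃ u, (u < n ∧ σ.arr aVis u ≠ 0) ∧ Subtree (σ.arr aPar) (σ.reg rRoot) y u ∧
          σ.arr X (u * n + c) ≠ 0)) ∧
      (σ.arr aVis y = 0 → (((gatherProg X).den σ).arr X (y * n + c) ≠ 0 ↔
        σ.arr X (y * n + c) ≠ 0)) := by
  have hX1 : X ≠ aRow := fun h => hX (by simp [h])
  have hX2 : X ≠ aOrd := fun h => hX (by simp [h])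
  have hX3 : X ≠ aPar := fun h => hX (by simp [h])
  have hT := hs.spanTree
  set R : ℕ → Prop := fun v => v < n ∧ σ.arr aVis v ≠ 0 with hR
  -- `Q` describes the complete rows, and `C k` the contributions from children among the last `k`
  -- positions.
  let Q : ℕ → ℕ → Prop := fun y c => ∃ u, R u ∧ Subtree (σ.arr aPar) (σ.reg rRoot) y u ∧
    σ.arr X (u * n + c) ≠ 0
  let C : ℕ → ℕ → ℕ → Prop := fun k y c => ∃ i, 0 < i ∧ i < σ.reg rCnt ∧ σ.reg rCnt ≤ i + k ∧
    σ.arr aPar (σ.arr aOrd i) = y ∧ Q (σ.arr aOrd i) c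
  have hordR : ∀ i < σ.reg rCnt, R (σ.arr aOrd i) := fun i hi =>
    ⟨hs.ord_lt i hi, (hs.vis_iff _ (hs.ord_lt i hi)).2 ⟨i, hi, rfl⟩⟩
  have hordr : ∀ i < σ.reg rCnt, σ.arr aOrd i = σ.reg rRoot → i = 0 := fun i hi h => by
    have h1 := hs.num_ord i hi
    have h2 := hs.num_ord 0 hs.pos
    rw [h, ← hs.ord_zero, h2] at h1
    exact h1.symm
  -- Here all positions after `i` have been processed, among them all children of the vertex at
  -- position `i`, so its row is complete.
  have hfinal : ∀ k i c, i < σ.reg rCnt → σ.reg rCnt ≤ i + 1 + k →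
      ((σ.arr X (σ.arr aOrd i * n + c) ≠ 0 ∨ C k (σ.arr aOrd i) c) ↔ Q (σ.arr aOrd i) c) := by
    intro k i c hi hik
    constructor
    · rintro (h | ⟨j, hj0, hj, _, hji, u, hu, hju, h⟩)
      · exact ⟨_, hordR i hi, .self, h⟩
      · refine ⟨u, hu, ?_, h⟩
        exact (hT.subtree_iff hu).2
          (.inr ⟨_, hordR j hj, fun h => by have := hordr j hj h; omega, hji, hju⟩)
    · rintro ⟨u, hu, hiu, h⟩
      rcases (hT.subtree_iff hu).1 hiu with rfl | ⟨z, hz, hzr, hzi, hzu⟩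
      · exact .inl h
      · right
        obtain ⟨j, hj, rfl⟩ := (hs.vis_iff z hz.1).1 hz.2
        have hlt := hT.num_lt _ hz hzr
        rw [hzi, hs.num_ord i hi, hs.num_ord j hj] at hlt
        exact ⟨j, by omega, hj, by omega, hzi, u, hu, hzu, h⟩
  have hCR : ∀ k y c, C k y c → σ.arr aVis y ≠ 0 := by
    rintro k y c ⟨i, hi0, hi, _, rfl, _⟩
    exact (hT.par_mem _ (hordR i hi) fun h => by have := hordr i hi h; omega).2
  have := ForProg.count_rule (r := rOuter) (b := .verts)
    (p := .ite (.lt (.add (.reg rOuter) (.lit 1)) (.reg rCnt))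
      (.assign rCur (.read aOrd (.sub (.reg rCnt) (.add (.reg rOuter) (.lit 1)))) ;;
        .assign rPar (.read aPar (.reg rCur)) ;;
        .count rInner .verts
          (.ite (.read X (.add (.read aRow (.reg rCur)) (.reg rInner)))
            (.write X (.add (.read aRow (.reg rPar)) (.reg rInner)) (.lit 1)) .skip)) .skip)
    (σ := σ) (fun k τ => ∀ y < n, ∀ c < n,
      τ.arr X (y * n + c) ≠ 0 ↔ σ.arr X (y * n + c) ≠ 0 ∨ C k y c)
    (by
      intro y hy c hc
      simp only [RamState.arr_setReg]
      refine ⟨.inl, fun h => h.resolve_right ?_⟩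
      rintro ⟨i, _, h1, h2, _⟩
      omega) (by
      intro k hk τ hF hr hI y hy c hc
      have e1 : τ.reg rCnt = σ.reg rCnt := hF.reg rCnt (by simp [ForProg.regs])
      have e2 : τ.arr aOrd = σ.arr aOrd :=
        hF.arr aOrd (by simpa [ForProg.arrs] using hX2.symm)
      have e3 : τ.arr aPar = σ.arr aPar :=
        hF.arr aPar (by simpa [ForProg.arrs] using hX3.symm)
      have e4 : τ.reg rN = n := (hF.reg rN (by simp [ForProg.regs])).trans hn
      have e5 : RowsOk n τ := fun i hi => by
        rw [hF.arr aRow (by simpa [ForProg.arrs] using hX1.symm)]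
        exact hrow i hi
      rw [ForProg.den]
      simp only [RamExpr.eval, hr, RamState.arr_setReg]
      by_cases hc1 : k + 1 < τ.reg rCnt
      · simp only [hc1, if_true, ne_eq, one_ne_zero, not_false_eq_true]
        rw [e1] at hc1
        set i := σ.reg rCnt - (k + 1) with hi
        have hicnt : i < σ.reg rCnt := by omega
        have hir : σ.arr aOrd i ≠ σ.reg rRoot := fun h => by have := hordr i hicnt h; omega
        have hRi := hordR i hicnt
        have hRp := hT.par_mem _ hRi hir
        have hlt := hT.num_lt _ hRi hir
        have hip : σ.arr aOrd i ≠ σ.arr aPar (σ.arr aOrd i) := fun h => by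
          rw [← h] at hlt
          exact lt_irrefl _ hlt
        rw [ForProg.den, ForProg.den]
        have := gatherProg_row (n := n) (X := X) (y := σ.arr aOrd i)
          (p := σ.arr aPar (σ.arr aOrd i))
          (σ := ForProg.den (.assign rPar (.read aPar (.reg rCur)))
            (ForProg.den (.assign rCur
              (.read aOrd (.sub (.reg rCnt) (.add (.reg rOuter) (.lit 1))))) τ)) hX1
          (by simpa using e4) (by intro j hj; simpa using e5 j hj) hRi.1 hRp.1 hip
          (by simp only [rOuter, rCnt, aOrd] at hr e1 e2 hi; simp [hr, e1, e2, ← hi])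
          (by simp only [rOuter, rCnt, aOrd, aPar] at hr e1 e2 e3 hi; simp [hr, e1, e2, e3, ← hi])
          y hy c hc
        refine this.trans ?_
        have e6 : (ForProg.den (.assign rPar (.read aPar (.reg rCur)))
            (ForProg.den (.assign rCur
              (.read aOrd (.sub (.reg rCnt) (.add (.reg rOuter) (.lit 1))))) τ)).arr = τ.arr := rfl
        rw [e6, hI y hy c hc, hI _ hRi.1 c hc, hfinal k i c hicnt (by omega)]
        constructor
        · rintro ((h | ⟨j, h1, h2, h3, h4⟩) | ⟨rfl, h⟩)
          · exact .inl h
          · exact .inr ⟨j, h1, h2, by omega, h4⟩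
          · exact .inr ⟨i, by omega, hicnt, by omega, rfl, h⟩
        · rintro (h | ⟨j, h1, h2, h3, h4, h5⟩)
          · exact .inl (.inl h)
          · by_cases hji : j = i
            · subst hji
              exact .inr ⟨h4.symm, h5⟩
            · exact .inl (.inr ⟨j, h1, h2, by omega, h4, h5⟩)
      · simp only [hc1, if_false, ne_eq, not_true_eq_false]
        have := hI y hy c hc
        simp only [ne_eq] at this
        refine this.trans (or_congr Iff.rfl ?_)
        constructor
        · rintro ⟨j, h1, h2, h3, h4⟩
          exact ⟨j, h1, h2, by omega, h4⟩
        · rintro ⟨j, h1, h2, h3, h4⟩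
          exact ⟨j, h1, h2, by omega, h4⟩)
  simp only [LoopBound.val, hn] at this
  intro y hy c hc
  have hyc := this y hy c hc
  refine ⟨fun hv => ?_, fun hv => ?_⟩
  · obtain ⟨i, hi, rfl⟩ := (hs.vis_iff y hy).1 hv
    have := hs.cnt_le
    exact hyc.trans (hfinal n i c hi (by omega))
  · exact hyc.trans ⟨fun h => h.resolve_right fun h => hCR _ _ _ h hv, .inl⟩

/-! ### Descendants, adjacencies outside the tree, covered vertices and labels -/

/-- Fill the matrix of descendants. -/
def descProg : ForProg := fill aDesc (.eq (.reg rOuter) (.reg rInner)) ;; gatherProg aDesc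

theorem StoresSearch.of_frame {n : ℕ} {A done : ℕ → ℕ → Prop} {p : ForProg} {σ τ : RamState}
    (hs : StoresSearch n A done σ) (hF : p.Frame σ τ)
    (hp : (rRoot ∉ p.regs ∧ rCnt ∉ p.regs) ∧
      aOrd ∉ p.arrs ∧ aNum ∉ p.arrs ∧ aPar ∉ p.arrs ∧ aVis ∉ p.arrs) :
    StoresSearch n A done τ := by
  obtain ⟨⟨h1, h2⟩, h3, h4, h5, h6⟩ := hp
  rw [StoresSearch, hF.reg _ h1, hF.reg _ h2, hF.arr _ h3, hF.arr _ h4, hF.arr _ h5, hF.arr _ h6]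
  exact hs

theorem RowsOk.of_frame {n : ℕ} {p : ForProg} {σ τ : RamState} (h : RowsOk n σ)
    (hF : p.Frame σ τ) (hp : aRow ∉ p.arrs) : RowsOk n τ := by
  rw [RowsOk, hF.arr _ hp]
  exact h

theorem StoresAdj.of_frame {n : ℕ} {A : ℕ → ℕ → Prop} {p : ForProg} {σ τ : RamState}
    (h : StoresAdj n A σ) (hF : p.Frame σ τ) (hp : aAdj ∉ p.arrs) : StoresAdj n A τ := by
  rw [StoresAdj, hF.arr _ hp]
  exact h

/-- Gathering the identity matrix yields the descendants; rows of unvisited vertices remain rows of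
the identity. -/
theorem descProg_spec {n : ℕ} {A : ℕ → ℕ → Prop} {σ : RamState} (hn : σ.reg rN = n)
    (hrow : RowsOk n σ) (hs : StoresSearch n A (fun _ _ => True) σ) :
    ∀ y < n, ∀ c < n,
      (σ.arr aVis y ≠ 0 → ((descProg.den σ).arr aDesc (y * n + c) ≠ 0 ↔
        σ.arr aVis c ≠ 0 ∧ Subtree (σ.arr aPar) (σ.reg rRoot) y c)) ∧
      (σ.arr aVis y = 0 → ((descProg.den σ).arr aDesc (y * n + c) ≠ 0 ↔ y = c)) := by
  have h0 := fill_spec (a := aDesc) (e := .eq (.reg rOuter) (.reg rInner)) (σ := σ) (by decide) hn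
    hrow (fun i j => if i = j then 1 else 0) (by
      intro i _ j _ τ _ h1 h2
      simp only [RamExpr.eval, h1, h2])
  have hF := ForProg.frame_den (fill aDesc (.eq (.reg rOuter) (.reg rInner))) σ
  set τ := (fill aDesc (.eq (.reg rOuter) (.reg rInner))).den σ with hτ
  have h1 := gatherProg_spec (X := aDesc) (σ := τ) (by decide) ((hF.reg rN (by decide)).trans hn)
    (hrow.of_frame hF (by decide)) (hs.of_frame hF (by decide))
  rw [hF.arr aVis (by decide), hF.arr aPar (by decide), hF.reg rRoot (by decide)] at h1
  intro y hy c hc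
  refine ⟨fun hv => ((h1 y hy c hc).1 hv).trans ?_, fun hv => ((h1 y hy c hc).2 hv).trans ?_⟩
  · constructor
    · rintro ⟨u, ⟨hu, hu'⟩, h2, h3⟩
      rw [h0 u hu c hc] at h3
      obtain rfl : u = c := by
        by_contra h
        simp [h] at h3
      exact ⟨hu', h2⟩
    · rintro ⟨h2, h3⟩
      exact ⟨c, ⟨hc, h2⟩, h3, by rw [h0 c hc c hc]; simp⟩
  · rw [h0 y hy c hc]
    simp

/-- Fill the matrix that tells to which vertices edges outside the tree lead from a subtree. -/
def outProg : ForProg :=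
  fill aOut (.sub
    (.lt (.lit 0) (.add (.read aAdj (.add (.read aRow (.reg rOuter)) (.reg rInner)))
      (.read aAdj (.add (.read aRow (.reg rInner)) (.reg rOuter)))))
    (.add (.eq (.read aPar (.reg rOuter)) (.reg rInner))
      (.eq (.read aPar (.reg rInner)) (.reg rOuter)))) ;;
  gatherProg aOut

/-- The adjacency bit minus the number of parent relations, truncated at zero, is nonzero exactly
for adjacent pairs not joined by a tree edge. Gathering these rows collects the far ends for a whole
subtree, including those inside it. -/
theorem outProg_spec {n : ℕ} {A : ℕ → ℕ → Prop} {σ : RamState} (hn : σ.reg rN = n)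
    (hrow : RowsOk n σ) (hA : StoresAdj n A σ) (hs : StoresSearch n A (fun _ _ => True) σ) :
    ∀ y < n, σ.arr aVis y ≠ 0 → ∀ c < n, ((outProg.den σ).arr aOut (y * n + c) ≠ 0 ↔
        ∃ u, (u < n ∧ σ.arr aVis u ≠ 0) ∧ Subtree (σ.arr aPar) (σ.reg rRoot) y u ∧
          NonTreeAdj A (σ.arr aPar) u c) := by
  obtain ⟨e, he⟩ : ∃ e : RamExpr, e = .sub
    (.lt (.lit 0) (.add (.read aAdj (.add (.read aRow (.reg rOuter)) (.reg rInner)))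
      (.read aAdj (.add (.read aRow (.reg rInner)) (.reg rOuter)))))
    (.add (.eq (.read aPar (.reg rOuter)) (.reg rInner))
      (.eq (.read aPar (.reg rInner)) (.reg rOuter))) := ⟨_, rfl⟩
  have hprog : outProg = (fill aOut e ;; gatherProg aOut) := by rw [he]; rfl
  classical
  have h0 := fill_spec (a := aOut) (e := e) (σ := σ) (by decide) hn
    hrow (fun i j => (if 0 < σ.arr aAdj (i * n + j) + σ.arr aAdj (j * n + i) then 1 else 0) -
      ((if σ.arr aPar i = j then 1 else 0) + if σ.arr aPar j = i then 1 else 0)) (by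
      intro i hi j hj τ hF h1 h2
      have e1 := hF.arr aAdj (by simp [fill, ForProg.arrs])
      have e2 := hF.arr aPar (by simp [fill, ForProg.arrs])
      have e3 := hrow.of_frame hF (by simp [fill, ForProg.arrs])
      subst he
      simp only [RamExpr.eval, h1, h2, e1, e2, e3 i hi, e3 j hj])
  have hF := ForProg.frame_den (fill aOut e) σ
  rw [hprog, ForProg.den]
  set τ := (fill aOut e).den σ with hτ
  have h1 := gatherProg_spec (X := aOut) (σ := τ) (by decide)
    ((hF.reg rN (by simp [fill, ForProg.regs])).trans hn)
    (hrow.of_frame hF (by simp [fill, ForProg.arrs]))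
    (hs.of_frame hF (by simp [fill, ForProg.arrs, ForProg.regs]))
  rw [hF.arr aVis (by simp [fill, ForProg.arrs]), hF.arr aPar (by simp [fill, ForProg.arrs]),
    hF.reg rRoot (by simp [fill, ForProg.regs])] at h1
  intro y hy hv c hc
  refine ((h1 y hy c hc).1 hv).trans ?_
  refine exists_congr fun u => and_congr_right fun hu => and_congr_right fun _ => ?_
  rw [h0 u hu.1 c hc, NonTreeAdj, ← hA u hu.1 c hc, ← hA c hc u hu.1]
  have : 0 < σ.arr aAdj (u * n + c) + σ.arr aAdj (c * n + u) ↔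
      σ.arr aAdj (u * n + c) ≠ 0 ∨ σ.arr aAdj (c * n + u) ≠ 0 := by omega
  rw [← this]
  split_ifs <;> simp_all

/-- Find the vertices whose subtree is left by an edge outside the tree. -/
def covProg : ForProg :=
  .count rOuter .verts (.write aCov (.reg rOuter) (.lit 0)) ;;
  .count rOuter .verts (.count rInner .verts
    (.ite (.read aOut (.add (.read aRow (.reg rOuter)) (.reg rInner)))
      (.ite (.read aDesc (.add (.read aRow (.reg rOuter)) (.reg rInner))) .skip
        (.write aCov (.reg rOuter) (.lit 1))) .skip))

theorem covProg_spec {n : ℕ} {σ : RamState} (hn : σ.reg rN = n) (hrow : RowsOk n σ) :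
    ∀ i < n, (covProg.den σ).arr aCov i ≠ 0 ↔
      ∃ j < n, σ.arr aOut (i * n + j) ≠ 0 ∧ σ.arr aDesc (i * n + j) = 0 := by
  have hc := clear_spec (a := aCov) hn
  have hf := ForProg.frame_den (.count rOuter .verts (.write aCov (.reg rOuter) (.lit 0))) σ
  rw [covProg, ForProg.den]
  set σ' := ForProg.den (.count rOuter .verts (.write aCov (.reg rOuter) (.lit 0))) σ
  have hn' : σ'.reg rN = n := (hf.reg rN (by decide)).trans hn
  have hrow' := hrow.of_frame hf (by decide)
  have hO := hf.arr aOut (by decide)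
  have hD := hf.arr aDesc (by decide)
  have hstep : ∀ k < n, ∀ τ : RamState, τ.reg rN = n → τ.reg rOuter = k → RowsOk n τ →
      τ.arr aOut = σ.arr aOut → τ.arr aDesc = σ.arr aDesc → ∀ i < n,
      (ForProg.den (.count rInner .verts
        (.ite (.read aOut (.add (.read aRow (.reg rOuter)) (.reg rInner)))
          (.ite (.read aDesc (.add (.read aRow (.reg rOuter)) (.reg rInner))) .skip
          (.write aCov (.reg rOuter) (.lit 1))) .skip)) τ).arr aCov i ≠ 0 ↔
        τ.arr aCov i ≠ 0 ∨ (i = k ∧ ∃ j < n, σ.arr aOut (i * n + j) ≠ 0 ∧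
          σ.arr aDesc (i * n + j) = 0) := by
    intro k hk τ hN hr hrw hOτ hDτ
    have := ForProg.count_rule (r := rInner) (b := .verts)
      (p := .ite (.read aOut (.add (.read aRow (.reg rOuter)) (.reg rInner)))
          (.ite (.read aDesc (.add (.read aRow (.reg rOuter)) (.reg rInner))) .skip
          (.write aCov (.reg rOuter) (.lit 1))) .skip) (σ := τ)
      (fun l τ' => ∀ i < n, τ'.arr aCov i ≠ 0 ↔ τ.arr aCov i ≠ 0 ∨ (i = k ∧ ∃ j < l,
        σ.arr aOut (i * n + j) ≠ 0 ∧ σ.arr aDesc (i * n + j) = 0)) (by simp) (by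
        intro l hl τ' hF' hr' hI' i hi
        have e0 : τ'.reg rOuter = k := (hF'.reg rOuter (by decide)).trans hr
        have e1 : τ'.arr aRow k = k * n := (hrw.of_frame hF' (by decide)) k hk
        have e2 : τ'.arr aOut = σ.arr aOut := (hF'.arr aOut (by decide)).trans hOτ
        have e3 : τ'.arr aDesc = σ.arr aDesc := (hF'.arr aDesc (by decide)).trans hDτ
        have aux : (∃ j < l + 1, σ.arr aOut (i * n + j) ≠ 0 ∧ σ.arr aDesc (i * n + j) = 0) ↔
            (∃ j < l, σ.arr aOut (i * n + j) ≠ 0 ∧ σ.arr aDesc (i * n + j) = 0) ∨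
            (σ.arr aOut (i * n + l) ≠ 0 ∧ σ.arr aDesc (i * n + l) = 0) := by
          constructor
          · rintro ⟨j, hj, h⟩
            rcases Nat.lt_succ_iff_lt_or_eq.1 hj with hj | rfl
            · exact .inl ⟨j, hj, h⟩
            · exact .inr h
          · rintro (⟨j, hj, h⟩ | h)
            · exact ⟨j, by omega, h⟩
            · exact ⟨l, by omega, h⟩
        have hIi := hI' i hi
        simp only [ForProg.den, RamExpr.eval, e0, hr', e1, e2, e3, RamState.arr_setReg]
        rw [aux]
        by_cases c1 : σ.arr aOut (k * n + l) ≠ 0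
        · rw [if_pos c1]
          by_cases c2 : σ.arr aDesc (k * n + l) ≠ 0
          · rw [if_pos c2, hIi]
            refine or_congr Iff.rfl (and_congr_right fun h => ?_)
            subst h
            exact ⟨.inl, fun h' => h'.resolve_right fun h' => c2 h'.2⟩
          · rw [if_neg c2, RamState.arr_setArr, if_pos rfl, Function.update_apply]
            split_ifs with h
            · subst h
              simp only [ne_eq, one_ne_zero, not_false_eq_true, true_iff]
              exact .inr ⟨trivial, .inr ⟨c1, not_not.1 c2⟩⟩
            · rw [hIi]
              simp only [h, false_and]
        · rw [if_neg c1, hIi]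
          refine or_congr Iff.rfl (and_congr_right fun h => ?_)
          subst h
          exact ⟨.inl, fun h' => h'.resolve_right fun h' => c1 h'.1⟩)
    simp only [LoopBound.val, hN] at this
    exact this
  have := ForProg.count_rule (r := rOuter) (b := .verts)
    (p := .count rInner .verts
        (.ite (.read aOut (.add (.read aRow (.reg rOuter)) (.reg rInner)))
          (.ite (.read aDesc (.add (.read aRow (.reg rOuter)) (.reg rInner))) .skip
          (.write aCov (.reg rOuter) (.lit 1))) .skip)) (σ := σ')
    (fun k τ => ∀ i < n, τ.arr aCov i ≠ 0 ↔
      (i < k ∧ ∃ j < n, σ.arr aOut (i * n + j) ≠ 0 ∧ σ.arr aDesc (i * n + j) = 0))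
    (by
      intro i hi
      rw [RamState.arr_setReg, hc i hi]
      simp) (by
      intro k hk τ hF hr hI i hi
      have hkn : k < n := by simpa only [LoopBound.val, hn'] using hk
      rw [RamState.arr_setReg]
      rw [hstep k hkn τ ((hF.reg rN (by decide)).trans hn') hr (hrow'.of_frame hF (by decide))
        ((hF.arr aOut (by decide)).trans hO) ((hF.arr aDesc (by decide)).trans hD) i hi, hI i hi]
      have : i < k + 1 ↔ i < k ∨ i = k := by omega
      rw [this, or_and_right])
  simp only [LoopBound.val, hn'] at this
  intro i hi
  rw [this i hi]
  exact ⟨And.right, fun h => ⟨hi, h⟩⟩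

/-- Label the components. -/
def labelProg : ForProg :=
  .write aComp (.reg rRoot) (.reg rRoot) ;;
  .assign rFlag (.lit 0) ;;
  .count rOuter .verts
    (.ite (.lt (.lit 0) (.reg rOuter))
      (.ite (.lt (.reg rOuter) (.reg rCnt))
        (.assign rCur (.read aOrd (.reg rOuter)) ;;
          .ite (.read aCov (.reg rCur))
            (.write aComp (.reg rCur) (.read aComp (.read aPar (.reg rCur))))
            (.write aComp (.reg rCur) (.reg rCur) ;; .assign rFlag (.lit 1)))
        .skip) .skip)

/-- Labels are assigned in search order, so the label of a parent is final when it is copied. The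
root has no tree edge above it and is labelled beforehand; the flag is raised by an uncovered
vertex, that is, by a bridge. -/
theorem labelProg_spec {n : ℕ} {A : ℕ → ℕ → Prop} {σ : RamState} (hn : σ.reg rN = n)
    (hs : StoresSearch n A (fun _ _ => True) σ) :
    (labelProg.den σ).arr aComp (σ.reg rRoot) = σ.reg rRoot ∧
    (∀ v < n, σ.arr aVis v ≠ 0 → v ≠ σ.reg rRoot →
      (σ.arr aCov v ≠ 0 →
        (labelProg.den σ).arr aComp v = (labelProg.den σ).arr aComp (σ.arr aPar v)) ∧
      (σ.arr aCov v = 0 → (labelProg.den σ).arr aComp v = v)) ∧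
    ((labelProg.den σ).reg rFlag ≠ 0 ↔
      ∃ v < n, σ.arr aVis v ≠ 0 ∧ v ≠ σ.reg rRoot ∧ σ.arr aCov v = 0) := by
  have hinj : ∀ i < σ.reg rCnt, ∀ j < σ.reg rCnt, σ.arr aOrd i = σ.arr aOrd j → i = j :=
    fun i hi j hj h => by rw [← hs.num_ord i hi, h, hs.num_ord j hj]
  set σ' := (σ.setArr aComp (σ.reg rRoot) (σ.reg rRoot)).setReg rFlag 0 with hσ'
  have hn' : σ'.reg rN = n := by simpa [hσ'] using hn
  have := ForProg.count_rule (r := rOuter) (b := .verts)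
    (p := .ite (.lt (.lit 0) (.reg rOuter))
      (.ite (.lt (.reg rOuter) (.reg rCnt))
        (.assign rCur (.read aOrd (.reg rOuter)) ;;
          .ite (.read aCov (.reg rCur))
            (.write aComp (.reg rCur) (.read aComp (.read aPar (.reg rCur))))
            (.write aComp (.reg rCur) (.reg rCur) ;; .assign rFlag (.lit 1)))
        .skip) .skip) (σ := σ')
    (fun k τ => τ.arr aComp (σ.reg rRoot) = σ.reg rRoot ∧
      (∀ i, 0 < i → i < k → i < σ.reg rCnt →
        (σ.arr aCov (σ.arr aOrd i) ≠ 0 →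
          τ.arr aComp (σ.arr aOrd i) = τ.arr aComp (σ.arr aPar (σ.arr aOrd i))) ∧
        (σ.arr aCov (σ.arr aOrd i) = 0 → τ.arr aComp (σ.arr aOrd i) = σ.arr aOrd i)) ∧
      (τ.reg rFlag ≠ 0 ↔ ∃ i, 0 < i ∧ i < k ∧ i < σ.reg rCnt ∧ σ.arr aCov (σ.arr aOrd i) = 0))
    (by
      refine ⟨by simp [hσ'], fun i _ hi => absurd hi (by omega), ?_⟩
      simp [hσ']) (by
      intro k hk τ hF hr ⟨hI1, hI2, hI3⟩
      have e1 : τ.reg rCnt = σ.reg rCnt := hF.reg rCnt (by decide)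
      have e2 : τ.arr aOrd = σ.arr aOrd := hF.arr aOrd (by decide)
      have e3 : τ.arr aCov = σ.arr aCov := hF.arr aCov (by decide)
      have e4 : τ.arr aPar = σ.arr aPar := hF.arr aPar (by decide)
      have hskip : ¬ (0 < k ∧ k < σ.reg rCnt) →
          (∀ i, 0 < i → i < k + 1 → i < σ.reg rCnt → i < k) := by
        intro h i h1 h2 h3
        rcases Nat.lt_succ_iff_lt_or_eq.1 h2 with h4 | rfl
        · exact h4
        · exact absurd ⟨h1, h3⟩ h
      have skip : ¬ (0 < k ∧ k < σ.reg rCnt) →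
          τ.arr aComp (σ.reg rRoot) = σ.reg rRoot ∧
          (∀ i, 0 < i → i < k + 1 → i < σ.reg rCnt →
            (σ.arr aCov (σ.arr aOrd i) ≠ 0 →
              τ.arr aComp (σ.arr aOrd i) = τ.arr aComp (σ.arr aPar (σ.arr aOrd i))) ∧
            (σ.arr aCov (σ.arr aOrd i) = 0 → τ.arr aComp (σ.arr aOrd i) = σ.arr aOrd i)) ∧
          (τ.reg rFlag ≠ 0 ↔
            ∃ i, 0 < i ∧ i < k + 1 ∧ i < σ.reg rCnt ∧ σ.arr aCov (σ.arr aOrd i) = 0) := by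
        intro h
        refine ⟨hI1, fun i h1 h2 h3 => hI2 i h1 (hskip h i h1 h2 h3) h3, hI3.trans ?_⟩
        constructor
        · rintro ⟨i, h1, h2, h3⟩
          exact ⟨i, h1, by omega, h3⟩
        · rintro ⟨i, h1, h2, h3, h4⟩
          exact ⟨i, h1, hskip h i h1 h2 h3, h3, h4⟩
      by_cases c0 : 0 < k
      swap
      · simpa [hr, c0] using skip (by tauto)
      by_cases c1 : k < σ.reg rCnt
      swap
      · have c1' : ¬ k < τ.reg 11 := by rwa [show τ.reg 11 = σ.reg rCnt from e1]
        have hr' : τ.reg 6 = k := hr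
        simpa [hr', c0, c1'] using skip (by tauto)
      have hroot : σ.reg rRoot ≠ σ.arr aOrd k := fun h => by
        rw [← hs.ord_zero] at h
        exact absurd (hinj 0 hs.pos k c1 h) (by omega)
      -- The write at position `k` disturbs neither earlier labels nor the labels of the parents
      -- involved.
      have hne : ∀ i < k, σ.arr aOrd i ≠ σ.arr aOrd k := fun i hi h =>
        absurd (hinj i (by omega) k c1 h) (by omega)
      have hpne : ∀ i, 0 < i → i ≤ k → σ.arr aPar (σ.arr aOrd i) ≠ σ.arr aOrd k := by
        intro i h1 h2 h
        obtain ⟨j, hj, hj', _⟩ := hs.par_ord i h1 (by omega)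
        exact hne j (by omega) (hj'.symm.trans h)
      have hlast : ∀ P : ℕ → Prop, (∀ i, 0 < i → i < k → P i) → P k →
          ∀ i, 0 < i → i < k + 1 → i < σ.reg rCnt → P i := by
        intro P h1 h2 i h3 h4 _
        rcases Nat.lt_succ_iff_lt_or_eq.1 h4 with h5 | rfl
        · exact h1 i h3 h5
        · exact h2
      simp only [ForProg.den, RamExpr.eval, hr, c0, if_true, ne_eq, one_ne_zero,
        not_false_eq_true, e1, c1, RamState.reg_setReg, RamState.arr_setReg, e2, e3, e4]
      by_cases c2 : σ.arr aCov (σ.arr aOrd k) = 0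
      · simp only [c2, not_true_eq_false, if_false, RamState.arr_setReg, RamState.arr_setArr,
          RamState.reg_setReg, if_true]
        refine ⟨by rw [Function.update_of_ne hroot]; exact hI1, hlast _ ?_ ?_, ?_⟩
        · intro i h1 h2
          rw [Function.update_of_ne (hne i h2), Function.update_of_ne (hpne i h1 h2.le)]
          exact hI2 i h1 h2 (by omega)
        · exact ⟨fun h => absurd c2 h, fun _ => by simp⟩
        · simp only [rFlag, rOuter, Nat.reduceEqDiff, if_false, one_ne_zero,
            not_false_eq_true, true_iff]
          exact ⟨k, c0, by omega, c1, c2⟩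
      · simp only [c2, not_false_eq_true, if_true, RamState.arr_setArr, RamState.reg_setReg,
          RamState.reg_setArr, RamState.arr_setReg]
        refine ⟨by rw [Function.update_of_ne hroot]; exact hI1, hlast _ ?_ ?_, ?_⟩
        · intro i h1 h2
          rw [Function.update_of_ne (hne i h2), Function.update_of_ne (hpne i h1 h2.le)]
          exact hI2 i h1 h2 (by omega)
        · refine ⟨fun _ => ?_, fun h => absurd h c2⟩
          rw [Function.update_self, Function.update_of_ne (hpne k c0 le_rfl)]
        · simp only [rFlag, rOuter, rCur, Nat.reduceEqDiff, if_false]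
          refine hI3.trans ⟨?_, ?_⟩
          · rintro ⟨i, h1, h2, h3⟩
            exact ⟨i, h1, by omega, h3⟩
          · rintro ⟨i, h1, h2, h3, h4⟩
            refine ⟨i, h1, ?_, h3, h4⟩
            rcases Nat.lt_succ_iff_lt_or_eq.1 h2 with h5 | rfl
            · exact h5
            · exact absurd h4 c2)
  simp only [LoopBound.val, hn'] at this
  obtain ⟨h1, h2, h3⟩ := this
  have hcnt := hs.cnt_le
  have hidx : ∀ v < n, σ.arr aVis v ≠ 0 → v ≠ σ.reg rRoot →
      ∃ i, 0 < i ∧ i < σ.reg rCnt ∧ σ.arr aOrd i = v := by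
    intro v hv hvis hvr
    obtain ⟨i, hi, rfl⟩ := (hs.vis_iff v hv).1 hvis
    exact ⟨i, Nat.pos_of_ne_zero fun h => hvr (by rw [h]; exact hs.ord_zero), hi, rfl⟩
  refine ⟨h1, fun v hv hvis hvr => ?_, h3.trans ⟨?_, ?_⟩⟩
  · obtain ⟨i, hi0, hi, rfl⟩ := hidx v hv hvis hvr
    exact h2 i hi0 (by omega) hi
  · rintro ⟨i, hi0, _, hi, hc⟩
    refine ⟨_, hs.ord_lt i hi, (hs.vis_iff _ (hs.ord_lt i hi)).2 ⟨i, hi, rfl⟩, fun h => ?_, hc⟩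
    rw [← hs.ord_zero] at h
    have := hinj i hi 0 hs.pos h
    omega
  · rintro ⟨v, hv, hvis, hvr, hc⟩
    obtain ⟨i, hi0, hi, rfl⟩ := hidx v hv hvis hvr
    exact ⟨i, hi0, by omega, hi, hc⟩

/-- Label the twinless strongly connected components of the graph stored in `a` without the vertex in
the register `rX`, and set the flag if there are at least two of them. -/
def coreProg (a : ℕ) : ForProg :=
  .assign rBan (.reg rX) ;;
  .assign rRoot (.eq (.reg rX) (.lit 0)) ;;
  rowsProg ;; adjProg a ;; searchProg ;; outProg ;; descProg ;; covProg ;; labelProg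

theorem ForProg.den_seq (p q : ForProg) (σ : RamState) : (p ;; q).den σ = q.den (p.den σ) := rfl

theorem Alg.StoresGraph.of_frame {n : ℕ} {L : List (Fin n × Fin n)} {p : ForProg} {σ τ : RamState}
    (h : StoresGraph L σ) (hF : p.Frame σ τ)
    (hp : rN ∉ p.regs ∧ rM ∉ p.regs ∧ aSrc ∉ p.arrs ∧ aDst ∉ p.arrs) : StoresGraph L τ := by
  rw [StoresGraph, hF.reg _ hp.1, hF.reg _ hp.2.1, hF.arr _ hp.2.2.1, hF.arr _ hp.2.2.2]
  exact h

theorem Alg.StoresEdges.of_frame {n : ℕ} {L : List (Fin n × Fin n)} {F : Set (Fin n × Fin n)} {a : ℕ}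
    {p : ForProg} {σ τ : RamState} (h : StoresEdges L a F σ) (hF : p.Frame σ τ)
    (hp : a ∉ p.arrs) : StoresEdges L a F τ := by
  rw [StoresEdges, hF.arr _ hp]
  exact h

/-- `coreProg` labels the twinless strongly connected components and decides whether there are several. -/
theorem coreProg_spec {n : ℕ} {L : List (Fin n × Fin n)} {a : ℕ} (ha : a < 5) {σ : RamState}
    (hG : StoresGraph L σ) {F : Set (Fin n × Fin n)} (hFL : F ⊆ edgeSet L)
    (hF : StoresEdges L a F σ) {x : Fin n} (hx : σ.reg rX = x) (hn2 : 2 ≤ n)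
    (hsc : StronglyConnectedOn F ({x}ᶜ)) :
    (∀ v w : Fin n, v ≠ x → w ≠ x → (((coreProg a).den σ).arr aComp v =
      ((coreProg a).den σ).arr aComp w ↔ SameSide F ({x}ᶜ) v w)) ∧
    (((coreProg a).den σ).reg rFlag ≠ 0 ↔ ¬ TwinlessSCOn F ({x}ᶜ)) := by
  have hn : σ.reg rN = n := hG.1
  -- All arrays written by the program have indices from 5 on, so the marks in `a` survive.
  have hne : ∀ b, 5 ≤ b → b ≠ a := fun b hb h => by omega
  simp only [coreProg, ForProg.den_seq]
  have f0 := ForProg.frame_den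
    (.assign rBan (.reg rX) ;; .assign rRoot (.eq (.reg rX) (.lit 0))) σ
  rw [ForProg.den_seq] at f0
  set σ0 := ForProg.den (.assign rRoot (.eq (.reg rX) (.lit 0)))
    (ForProg.den (.assign rBan (.reg rX)) σ) with hσ0
  have hban : σ0.reg rBan = x := by
    rw [← hx]
    simp [hσ0]
  -- The root must differ from the deleted vertex: it is 1 if `x` is 0, and 0 otherwise. Both are
  -- vertices because `2 ≤ n`.
  have hroot : σ0.reg rRoot = if (x : ℕ) = 0 then 1 else 0 := by
    rw [← hx]
    simp [hσ0]
  clear_value σ0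
  have n0 : σ0.reg rN = n := (f0.reg rN (by decide)).trans hn
  have g0 := hG.of_frame f0 (by decide)
  have E0 : StoresEdges L a F σ0 := hF.of_frame f0 (by simp [ForProg.arrs])
  have f1 := ForProg.frame_den rowsProg σ0
  have r1 := rowsProg_spec n0
  set σ1 := ForProg.den rowsProg σ0 with hσ1
  clear_value σ1
  have g1 := g0.of_frame f1 (by decide)
  have E1 : StoresEdges L a F σ1 := E0.of_frame f1
    (by simpa [ForProg.arrs, rowsProg] using (hne 6 (by norm_num)).symm)
  have ban1 : σ1.reg rBan = x := (f1.reg rBan (by decide)).trans hban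
  have a2 := adjProg_spec (a := a) (S := {x}ᶜ)
    (by simpa using ⟨(hne 6 (by norm_num)).symm, (hne 7 (by norm_num)).symm⟩) g1 r1 hFL E1
    (fun v => by rw [ban1, Set.mem_compl_iff, Set.mem_singleton_iff, Fin.ext_iff])
  have f2 := ForProg.frame_den (adjProg a) σ1
  set σ2 := ForProg.den (adjProg a) σ1 with hσ2
  clear_value σ2
  have n2 : σ2.reg rN = n := (f2.reg rN (by simp [adjProg, fill, ForProg.regs])).trans g1.1
  have r2 := r1.of_frame f2 (by simp [adjProg, fill, ForProg.arrs])
  have root2 : σ2.reg rRoot = if (x : ℕ) = 0 then 1 else 0 := by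
    rw [f2.reg rRoot (by simp [adjProg, fill, ForProg.regs]), f1.reg rRoot (by decide), hroot]
  have hroot_lt : σ2.reg rRoot < n := by
    rw [root2]
    split_ifs <;> omega
  have hroot_ne : σ2.reg rRoot ≠ x := by
    rw [root2]
    split_ifs <;> omega
  have s3 := searchProg_spec n2 r2 a2 hroot_lt
  have f3 := ForProg.frame_den searchProg σ2
  set σ3 := ForProg.den searchProg σ2 with hσ3
  clear_value σ3
  have n3 : σ3.reg rN = n := (f3.reg rN (by decide)).trans n2
  have r3 := r2.of_frame f3 (by decide)
  have a3 := a2.of_frame f3 (by decide)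
  have root3 : σ3.reg rRoot = σ2.reg rRoot := f3.reg rRoot (by decide)
  have o4 := outProg_spec n3 r3 a3 s3
  have f4 := ForProg.frame_den outProg σ3
  set σ4 := ForProg.den outProg σ3 with hσ4
  clear_value σ4
  have n4 : σ4.reg rN = n := (f4.reg rN (by decide)).trans n3
  have r4 := r3.of_frame f4 (by decide)
  have s4 := s3.of_frame f4 (by decide)
  have d5 := descProg_spec n4 r4 s4
  have f5 := ForProg.frame_den descProg σ4
  set σ5 := ForProg.den descProg σ4 with hσ5
  clear_value σ5
  have n5 : σ5.reg rN = n := (f5.reg rN (by decide)).trans n4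
  have r5 := r4.of_frame f5 (by decide)
  have s5 := s4.of_frame f5 (by decide)
  have c6 := covProg_spec n5 r5
  have f6 := ForProg.frame_den covProg σ5
  set σ6 := ForProg.den covProg σ5 with hσ6
  clear_value σ6
  have n6 : σ6.reg rN = n := (f6.reg rN (by decide)).trans n5
  have s6 := s5.of_frame f6 (by decide)
  have l7 := labelProg_spec n6 s6
  set σ7 := ForProg.den labelProg σ6 with hσ7
  clear_value σ7
  rw [f6.reg rRoot (by decide), f5.reg rRoot (by decide), f4.reg rRoot (by decide),
    f6.arr aPar (by decide), f5.arr aPar (by decide), f4.arr aPar (by decide),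
    f6.arr aVis (by decide), f5.arr aVis (by decide), f4.arr aVis (by decide)] at l7
  rw [f5.arr aOut (by decide)] at c6
  rw [f4.reg rRoot (by decide), f4.arr aPar (by decide), f4.arr aVis (by decide)] at d5
  have hT := s3.spanTree
  -- No edge of the deleted graph leads to `x`, and strong connectivity makes the search find all
  -- other vertices.
  have hRS : ∀ v, (v < n ∧ σ3.arr aVis v ≠ 0) ↔ NatMem ({x}ᶜ) v := by
    intro v
    constructor
    · intro hv
      refine hT.induction (P := fun v => NatMem ({x}ᶜ : Set (Fin n)) v) ?_ ?_ v hv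
      · rw [root3]
        exact ⟨hroot_lt, fun h => hroot_ne (congrArg Fin.val h)⟩
      · intro v hv hvr _
        obtain ⟨_, h1, _, h2, _⟩ := hT.adj v hv hvr
        exact ⟨h1, h2⟩
    · rintro ⟨hv, hvS⟩
      refine s3.reach_vis (fun u w ⟨_, h, _⟩ => h) ?_
      have hrS : (⟨σ3.reg rRoot, by rw [root3]; exact hroot_lt⟩ : Fin n) ∈ ({x}ᶜ : Set (Fin n)) := by
        intro h
        exact hroot_ne (root3 ▸ congrArg Fin.val h)
      have := hsc.2 _ hrS _ hvS
      exact Relation.ReflTransGen.lift (p := NatAdj F ({x}ᶜ)) (fun v : Fin n => (v : ℕ))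
        (fun p q ⟨h1, h2, h3⟩ => ⟨p.2, q.2, h1, h2, h3⟩) _ _ this
  have hT' : SpanTree (NatAdj F ({x}ᶜ)) (NatMem ({x}ᶜ)) (σ3.reg rRoot) (σ3.arr aPar)
      (σ3.arr aNum) := by
    have : (fun v => v < n ∧ σ3.arr aVis v ≠ 0) = NatMem ({x}ᶜ : Set (Fin n)) :=
      funext fun v => propext (hRS v)
    rwa [this] at hT
  have hpr : σ3.arr aPar (σ3.reg rRoot) = n := s3.par_root
  -- An entry of `aOut` without a matching entry of `aDesc` is an adjacency outside the tree that
  -- leaves the subtree.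
  have hcov : ∀ v, NatMem ({x}ᶜ : Set (Fin n)) v → (σ6.arr aCov v ≠ 0 ↔
      Covered (NatAdj F ({x}ᶜ)) (σ3.arr aPar) (σ3.reg rRoot) v) := by
    intro v hv
    have hv' := (hRS v).2 hv
    have hadj : ∀ u w, NonTreeAdj (NatAdj F ({x}ᶜ)) (σ3.arr aPar) u w →
        NatMem ({x}ᶜ : Set (Fin n)) u ∧ NatMem ({x}ᶜ : Set (Fin n)) w := by
      rintro u w ⟨⟨h1, h2, h3, h4, _⟩ | ⟨h1, h2, h3, h4, _⟩, _⟩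
      exacts [⟨⟨h1, h3⟩, h2, h4⟩, ⟨⟨h2, h4⟩, h1, h3⟩]
    rw [c6 v hv'.1]
    constructor
    · rintro ⟨j, hj, h1, h2⟩
      obtain ⟨u, hu, h3, h4⟩ := (o4 v hv'.1 hv'.2 j hj).1 h1
      refine ⟨u, j, h3, fun h => ?_, h4⟩
      have hjv := (hRS j).2 (hadj u j h4).2
      exact ((d5 v hv'.1 j hj).1 hv'.2).2 ⟨hjv.2, h⟩ h2
    · rintro ⟨u, w, h1, h2, h3⟩
      have hw := (hRS w).2 (hadj u w h3).2
      refine ⟨w, hw.1, (o4 v hv'.1 hv'.2 w hw.1).2 ⟨u, (hRS u).2 (hadj u w h3).1, h1, h3⟩, ?_⟩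
      by_contra h
      exact h2 (((d5 v hv'.1 w hw.1).1 hv'.2).1 h).2
  obtain ⟨l1, l2, l3⟩ := l7
  refine ⟨fun v w hv hw => ?_, l3.trans ?_⟩
  · refine label_eq_iff hT' hpr l1 (fun v hv hvr hc => ?_) (fun v hv hvr hc => ?_) hv hw
    · have hv' := (hRS v).2 hv
      exact (l2 v hv'.1 hv'.2 hvr).1 ((hcov v hv).2 hc)
    · have hv' := (hRS v).2 hv
      exact (l2 v hv'.1 hv'.2 hvr).2 (by_contra fun h => hc ((hcov v hv).1 h))
  · rw [twinlessSCOn_iff_covered hsc hT' hpr]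
    push Not
    constructor
    · rintro ⟨v, h1, h2, h3, h4⟩
      have hv := (hRS v).1 ⟨h1, h2⟩
      exact ⟨v, hv, h3, fun h => (hcov v hv).2 h h4⟩
    · rintro ⟨v, hv, h3, h4⟩
      have hv' := (hRS v).2 hv
      exact ⟨v, hv'.1, hv'.2, h3, by_contra fun h => h4 ((hcov v hv).1 h)⟩

/-! ## Finding the vertices that separate the root from a given vertex -/

namespace SearchState

variable {n : ℕ} {A : ℕ → ℕ → Prop} {root : ℕ} {ord num par vis : ℕ → ℕ} {cnt : ℕ}
  {done : ℕ → ℕ → Prop}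

theorem ord_num (h : SearchState n A root ord num par vis cnt done) {v : ℕ} (hv : v < n)
    (hvis : vis v ≠ 0) : num v < cnt ∧ ord (num v) = v := by
  obtain ⟨i, hi, rfl⟩ := (h.vis_iff v hv).1 hvis
  rw [h.num_ord i hi]
  exact ⟨hi, rfl⟩

theorem num_root (h : SearchState n A root ord num par vis cnt done) : num root = 0 := by
  rw [← h.ord_zero, h.num_ord 0 h.pos]

end SearchState

/-- `w` lies on the tree path from the root to `v`. -/
def OnPath (n root : ℕ) (par vis : ℕ → ℕ) (v w : ℕ) : Prop :=
  (w < n ∧ vis w ≠ 0) ∧ Subtree par root w v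

/-- State of the scan along the tree path from the root to `v`: the vertices of the path with number
below `pos` (except `v`) and the vertices off the path that were reached from them are in the queue,
`high` bounds the numbers of the vertices of the path that were reached, and `bad` tells whether one
of the vertices scanned so far separates `v` from the root. -/
structure ScanState (n : ℕ) (A : ℕ → ℕ → Prop) (root : ℕ) (num par vis : ℕ → ℕ) (cnt v : ℕ)
    (done : ℕ → ℕ → Prop) (que seen : ℕ → ℕ) (tail pos high bad : ℕ) : Prop where
  pos_le : pos ≤ cnt
  que_lt : ∀ i < tail, que i < n
  que_inj : ∀ i < tail, ∀ j < tail, que i = que j → i = j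
  seen_iff : ∀ w < n, seen w ≠ 0 ↔ ∃ i < tail, que i = w
  seen_path : ∀ w, OnPath n root par vis v w → (seen w ≠ 0 ↔ num w < pos ∧ w ≠ v)
  sound : ∀ w < n, seen w ≠ 0 → ∀ z, OnPath n root par vis v z → pos ≤ num z →
    ReachAvoid A z root w
  high_sound : high = 0 ∨ ∃ w, OnPath n root par vis v w ∧ num w = high ∧
    ∀ z, OnPath n root par vis v z → pos ≤ num z → num z < high → ReachAvoid A z root w
  closed : ∀ i < tail, ∀ w < n, done i w → A (que i) w →
    (OnPath n root par vis v w → num w ≤ high) ∧ (¬ OnPath n root par vis v w → seen w ≠ 0)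
  bad_iff : bad ≠ 0 ↔ ∃ z, OnPath n root par vis v z ∧ 0 < num z ∧ z ≠ v ∧ num z < pos ∧
    ¬ ReachAvoid A z root v

namespace ScanState

variable {n : ℕ} {A : ℕ → ℕ → Prop} {root : ℕ} {ord num par vis : ℕ → ℕ} {cnt v : ℕ}
  {done done' all : ℕ → ℕ → Prop} {que seen : ℕ → ℕ} {tail pos high bad bad' : ℕ}

/-- Vertices enter the queue at most once; this limits the number of rounds of the scan. -/
theorem tail_le (h : ScanState n A root num par vis cnt v done que seen tail pos high bad) :
    tail ≤ n := le_of_injOn_lt h.que_lt h.que_inj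

theorem congr_done (h : ScanState n A root num par vis cnt v done que seen tail pos high bad)
    (h' : ∀ i < tail, ∀ w < n, done' i w → A (que i) w →
      (OnPath n root par vis v w → num w ≤ high) ∧
        (¬ OnPath n root par vis v w → seen w ≠ 0)) :
    ScanState n A root num par vis cnt v done' que seen tail pos high bad := { h with closed := h' }

theorem init (hseen : ∀ w < n, seen w = 0) :
    ScanState n A root num par vis cnt v done que seen 0 0 0 0 where
  pos_le := Nat.zero_le _
  que_lt i hi := absurd hi (by omega)
  que_inj i hi := absurd hi (by omega)
  seen_iff w hw := by simp [hseen w hw]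
  seen_path w hw := by simp [hseen w hw.1.1]
  sound w hw h := absurd (hseen w hw) h
  high_sound := .inl rfl
  closed i hi := absurd hi (by omega)
  bad_iff := by simp

/-- A new vertex enters the queue. -/
theorem enqueue_que {w : ℕ} (hlt : ∀ i < tail, que i < n)
    (hinj : ∀ i < tail, ∀ j < tail, que i = que j → i = j)
    (hseen : ∀ w < n, seen w ≠ 0 ↔ ∃ i < tail, que i = w) (hw : w < n) (hnew : seen w = 0) :
    (∀ i < tail + 1, Function.update que tail w i < n) ∧
    (∀ i < tail + 1, ∀ j < tail + 1,
      Function.update que tail w i = Function.update que tail w j → i = j) ∧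
    (∀ x < n, Function.update seen w 1 x ≠ 0 ↔ ∃ i < tail + 1, Function.update que tail w i = x) := by
  have hold : ∀ i < tail, Function.update que tail w i = que i := fun i hi =>
    Function.update_of_ne (by omega) _ _
  have hne : ∀ i < tail, que i ≠ w := fun i hi h => (hseen w hw).2 ⟨i, hi, h⟩ hnew
  refine ⟨fun i hi => ?_, fun i hi j hj hij => ?_, fun x hx => ⟨fun h => ?_, ?_⟩⟩
  · rcases Nat.lt_succ_iff_lt_or_eq.1 hi with hi | rfl
    · rw [hold i hi]
      exact hlt i hi
    · simpa using hw
  · rcases Nat.lt_succ_iff_lt_or_eq.1 hi with hi | rfl <;>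
      rcases Nat.lt_succ_iff_lt_or_eq.1 hj with hj | rfl
    · rw [hold i hi, hold j hj] at hij
      exact hinj i hi j hj hij
    · rw [hold i hi, Function.update_self] at hij
      exact absurd hij (hne i hi)
    · rw [hold j hj, Function.update_self] at hij
      exact absurd hij.symm (hne j hj)
    · rfl
  · by_cases hxw : x = w
    · exact ⟨tail, by omega, by simp [hxw]⟩
    · rw [Function.update_of_ne hxw] at h
      obtain ⟨i, hi, hix⟩ := (hseen x hx).1 h
      exact ⟨i, by omega, by rw [hold i hi, hix]⟩
  · rintro ⟨i, hi, rfl⟩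
    rcases Nat.lt_succ_iff_lt_or_eq.1 hi with hi | rfl
    · rw [hold i hi, Function.update_of_ne (hne i hi)]
      exact (hseen _ (hlt i hi)).2 ⟨i, hi, rfl⟩
    · simp

/-- An edge to a vertex off the path. -/
theorem visit (h : ScanState n A root num par vis cnt v done que seen tail pos high bad) {k w : ℕ}
    (hk : k < tail) (hw : w < n) (hp : ¬ OnPath n root par vis v w) (hs : seen w = 0)
    (hA : A (que k) w) (hdone : ∀ x, ¬ done tail x) :
    ScanState n A root num par vis cnt v done (Function.update que tail w)
      (Function.update seen w 1) (tail + 1) pos high bad := by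
  obtain ⟨q1, q2, q3⟩ := enqueue_que h.que_lt h.que_inj h.seen_iff hw hs
  have hpn : ∀ z, OnPath n root par vis v z → z ≠ w := fun z hz hzw => hp (hzw ▸ hz)
  have hmono : ∀ x, seen x ≠ 0 → Function.update seen w 1 x ≠ 0 := by
    intro x hx
    rw [Function.update_apply]
    split_ifs <;> simp [hx]
  refine ⟨h.pos_le, q1, q2, q3, fun x hx => ?_, fun x hx hxs z hz hzp => ?_, h.high_sound,
    fun i hi x hx hd hix => ?_, h.bad_iff⟩
  · rw [Function.update_of_ne (hpn x hx)]
    exact h.seen_path x hx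
  · by_cases hxw : x = w
    · subst hxw
      have hq := (h.seen_iff _ (h.que_lt k hk)).2 ⟨k, hk, rfl⟩
      -- The queue vertex is not `z`: a vertex of the path is seen only if its number is below
      -- `pos`.
      refine (h.sound _ (h.que_lt k hk) hq z hz hzp).tail ⟨fun hqz => ?_, (hpn z hz).symm, hA⟩
      rw [hqz] at hq
      have := ((h.seen_path z hz).1 hq).1
      omega
    · rw [Function.update_of_ne hxw] at hxs
      exact h.sound x hx hxs z hz hzp
  · rcases Nat.lt_succ_iff_lt_or_eq.1 hi with hi | rfl
    · rw [Function.update_of_ne (by omega)] at hix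
      exact ⟨(h.closed i hi x hx hd hix).1, fun h' => hmono x ((h.closed i hi x hx hd hix).2 h')⟩
    · exact absurd hd (hdone x)

/-- An edge to a vertex of the path. -/
theorem hit (h : ScanState n A root num par vis cnt v done que seen tail pos high bad) {k w : ℕ}
    (hk : k < tail) (hp : OnPath n root par vis v w) (hA : A (que k) w) (hw : high < num w) :
    ScanState n A root num par vis cnt v done que seen tail pos (num w) bad := by
  refine { h with high_sound := .inr ⟨w, hp, rfl, fun z hz hzp hzw => ?_⟩, closed := ?_ }
  · have hq := (h.seen_iff _ (h.que_lt k hk)).2 ⟨k, hk, rfl⟩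
    refine (h.sound _ (h.que_lt k hk) hq z hz hzp).tail ⟨fun hqz => ?_, fun hwz => ?_, hA⟩
    · rw [hqz] at hq
      have := ((h.seen_path z hz).1 hq).1
      omega
    · rw [hwz] at hzw
      exact lt_irrefl _ hzw
  · intro i hi x hx hd hix
    exact ⟨fun hx' => ((h.closed i hi x hx hd hix).1 hx').trans hw.le,
      (h.closed i hi x hx hd hix).2⟩

/-- The scan passes a vertex off the path, or the end of the path. -/
theorem skip (h : ScanState n A root num par vis cnt v done que seen tail pos high bad)
    (hs : SearchState n A root ord num par vis cnt all) (hpos : pos < cnt)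
    (hp : OnPath n root par vis v (ord pos) → ord pos = v) :
    ScanState n A root num par vis cnt v done que seen tail (pos + 1) high bad := by
  have hz : ∀ z, OnPath n root par vis v z → z ≠ v → (num z < pos + 1 ↔ num z < pos) := by
    intro z hz hzv
    have : num z ≠ pos := by
      rintro rfl
      have := (hs.ord_num hz.1.1 hz.1.2).2
      rw [this] at hp
      exact hzv (hp hz)
    omega
  refine ⟨hpos, h.que_lt, h.que_inj, h.seen_iff, fun w hw => ?_, ?_, ?_, h.closed,
    h.bad_iff.trans ?_⟩
  · rw [h.seen_path w hw]
    exact ⟨fun h' => ⟨by omega, h'.2⟩, fun h' => ⟨(hz w hw h'.2).1 h'.1, h'.2⟩⟩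
  · exact fun w hw hsw z hz hzp => h.sound w hw hsw z hz (by omega)
  · exact h.high_sound.imp_right fun ⟨w, h1, h2, h3⟩ =>
      ⟨w, h1, h2, fun z hz hzp => h3 z hz (by omega)⟩
  · constructor
    · rintro ⟨z, h1, h2, h3, h4, h5⟩
      exact ⟨z, h1, h2, h3, by omega, h5⟩
    · rintro ⟨z, h1, h2, h3, h4, h5⟩
      exact ⟨z, h1, h2, h3, (hz z h1 h3).1 h4, h5⟩

/-- The next vertex of the path separates `v` from the root if and only if no later vertex of the
path was reached. -/
theorem reachAvoid_iff
    (h : ScanState n A root num par vis cnt v (fun _ _ => True) que seen tail pos high bad)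
    (hs : SearchState n A root ord num par vis cnt all) (hA : ∀ u w, A u w → w < n)
    (hv : v < n ∧ vis v ≠ 0) (hpos : pos < cnt) (hpos0 : pos ≠ 0)
    (hp : OnPath n root par vis v (ord pos)) (hne : ord pos ≠ v) :
    ReachAvoid A (ord pos) root v ↔ pos < high := by
  have hT := hs.spanTree
  have hnum := hs.num_ord pos hpos
  have hnv : pos < num v := by
    rcases hT.num_le hp.2 hv with h | h
    · exact absurd h.symm hne
    · omega
  constructor
  -- If no vertex of the path beyond `pos` was hit, edges leave the set of seen vertices only
  -- towards `ord pos`, so a walk that avoids it never gets to `v`.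
  · intro hr
    by_contra hhigh
    obtain ⟨p, q, ⟨_, hq, hpq⟩, hpX, hqX⟩ :=
      exists_edge_of_reach (X := {w | w < n ∧ seen w ≠ 0}) hr
        ⟨hT.root_mem.1, (h.seen_path root ⟨hT.root_mem, hT.subtree_root hv⟩).2
          ⟨by rw [hs.num_root]; omega, fun hrv => by
            rw [← hrv, hs.num_root] at hnv
            omega⟩⟩
        (fun hvX => ((h.seen_path v ⟨hv, .self⟩).1 hvX.2).2 rfl)
    obtain ⟨i, hi, rfl⟩ := (h.seen_iff p hpX.1).1 hpX.2
    have hqn := hA _ _ hpq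
    obtain ⟨c1, c2⟩ := h.closed i hi q hqn trivial hpq
    by_cases hqp : OnPath n root par vis v q
    · have h1 := c1 hqp
      have h2 : num q ≠ pos := by
        rintro rfl
        exact hq (hs.ord_num hqp.1.1 hqp.1.2).2.symm
      refine hqX ⟨hqn, (h.seen_path q hqp).2 ⟨by omega, ?_⟩⟩
      rintro rfl
      omega
    · exact hqX ⟨hqn, c2 hqp⟩
  -- A walk avoiding `ord pos` leads to the vertex with number `high`; from there the tree path to
  -- `v` uses larger numbers only.
  · intro hhigh
    rcases h.high_sound with h0 | ⟨w, hw, rfl, hr⟩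
    · omega
    · refine (hr _ hp (by omega) (by omega)).trans (hT.reach_down hw.2 hv fun x hx hxv hxp => ?_)
      have hxR := hT.mem_of_subtree hxv hv
      rcases hT.num_le hx hxR with h | h
      · rw [← h, hxp] at hhigh
        omega
      · rw [hxp] at h
        omega

/-- The next vertex of the path enters the queue. -/
theorem push
    (h : ScanState n A root num par vis cnt v (fun _ _ => True) que seen tail pos high bad)
    (hs : SearchState n A root ord num par vis cnt all) (hA : ∀ u w, A u w → w < n)
    (hv : v < n ∧ vis v ≠ 0) (hpos : pos < cnt)
    (hp : OnPath n root par vis v (ord pos)) (hne : ord pos ≠ v)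
    (hbad : bad' ≠ 0 ↔ bad ≠ 0 ∨ (pos ≠ 0 ∧ ¬ pos < high)) (hdone : ∀ x, ¬ done tail x) :
    ScanState n A root num par vis cnt v done (Function.update que tail (ord pos))
      (Function.update seen (ord pos) 1) (tail + 1) (pos + 1) high bad' := by
  have hT := hs.spanTree
  have hnum := hs.num_ord pos hpos
  have hs0 : seen (ord pos) = 0 := by
    by_contra hc
    have := ((h.seen_path _ hp).1 hc).1
    omega
  obtain ⟨q1, q2, q3⟩ := enqueue_que h.que_lt h.que_inj h.seen_iff hp.1.1 hs0
  have heq : ∀ z, OnPath n root par vis v z → num z = pos → z = ord pos := by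
    rintro z hz rfl
    exact (hs.ord_num hz.1.1 hz.1.2).2.symm
  refine ⟨hpos, q1, q2, q3, fun w hw => ?_, fun w hw hws z hz hzp => ?_, ?_, ?_, ?_⟩
  · by_cases hwp : w = ord pos
    · subst hwp
      simp only [Function.update_self, ne_eq, one_ne_zero, not_false_eq_true, true_iff]
      exact ⟨by omega, hne⟩
    · rw [Function.update_of_ne hwp, h.seen_path w hw]
      have : num w ≠ pos := fun h' => hwp (heq w hw h')
      exact and_congr_left fun _ => by omega
  · by_cases hwp : w = ord pos
    · subst hwp
      -- The tree path to `ord pos` has numbers up to `pos`, whereas the number of `z` is larger.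
      exact hT.reach_root hp.1 (by omega)
    · rw [Function.update_of_ne hwp] at hws
      exact h.sound w hw hws z hz (by omega)
  · exact h.high_sound.imp_right fun ⟨w, h1, h2, h3⟩ =>
      ⟨w, h1, h2, fun z hz hzp => h3 z hz (by omega)⟩
  · intro i hi x hx hd hix
    rcases Nat.lt_succ_iff_lt_or_eq.1 hi with hi | rfl
    · rw [Function.update_of_ne (by omega)] at hix
      refine ⟨(h.closed i hi x hx trivial hix).1, fun h' => ?_⟩
      rw [Function.update_apply]
      split_ifs
      · simp
      · exact (h.closed i hi x hx trivial hix).2 h'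
    · exact absurd hd (hdone x)
  · rw [hbad, h.bad_iff]
    constructor
    · rintro (⟨z, h1, h2, h3, h4, h5⟩ | ⟨h1, h2⟩)
      · exact ⟨z, h1, h2, h3, by omega, h5⟩
      · exact ⟨_, hp, by omega, hne, by omega,
          fun h' => h2 ((h.reachAvoid_iff hs hA hv hpos h1 hp hne).1 h')⟩
    · rintro ⟨z, h1, h2, h3, h4, h5⟩
      by_cases hz : num z = pos
      · right
        have := heq z h1 hz
        subst this
        have h0 : pos ≠ 0 := by omega
        exact ⟨h0, fun h' => h5 ((h.reachAvoid_iff hs hA hv hpos h0 hp hne).2 h')⟩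
      · exact .inl ⟨z, h1, h2, h3, by omega, h5⟩

/-- Result of the complete scan. -/
theorem bad_ne_zero_iff
    (h : ScanState n A root num par vis cnt v done que seen tail cnt high bad)
    (hs : SearchState n A root ord num par vis cnt all) (hv : v < n ∧ vis v ≠ 0) :
    bad ≠ 0 ↔ ¬ ∀ z < n, z ≠ root → z ≠ v → ReachAvoid A z root v := by
  have hT := hs.spanTree
  rw [h.bad_iff]
  constructor
  · rintro ⟨z, hz, hz0, hzv, _, hr⟩ hall
    refine hr (hall z hz.1.1 (fun hzr => ?_) hzv)
    rw [hzr, hs.num_root] at hz0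
    omega
  · intro hall
    push Not at hall
    obtain ⟨z, hz, hzr, hzv, hr⟩ := hall
    -- A vertex off the tree path cannot separate, since the path itself avoids it.
    have hp : OnPath n root par vis v z := by
      by_contra hp
      refine hr (hT.reach_down (hT.subtree_root hv) hv fun w _ hwv hwz => hp ?_)
      subst hwz
      exact ⟨hT.mem_of_subtree hwv hv, hwv⟩
    obtain ⟨h1, h2⟩ := hs.ord_num hp.1.1 hp.1.2
    refine ⟨z, hp, Nat.pos_of_ne_zero fun h0 => hzr ?_, hzv, h1, hr⟩
    rw [← h2, h0, hs.ord_zero]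

end ScanState

/-! ### Running the scan, and the test whether an edge can be dropped -/

/-- Inspect the pair of the current vertex and the inner counter during the scan. -/
def expandProg : ForProg :=
  .ite (.read aAdj (.add (.read aRow (.reg rCur)) (.reg rInner)))
    (.ite (.read aDesc (.add (.read aRow (.reg rInner)) (.reg rEnd)))
      (.ite (.lt (.reg rHigh) (.read aNum (.reg rInner)))
        (.assign rHigh (.read aNum (.reg rInner))) .skip)
      (.ite (.read aSeen (.reg rInner)) .skip
        (.write aSeen (.reg rInner) (.lit 1) ;;
          .write aQueue (.reg rTail) (.reg rInner) ;;
          .assign rTail (.add (.reg rTail) (.lit 1))))) .skip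

/-- Proceed to the next position of the search order; the vertex found there is current. -/
def advanceProg : ForProg :=
  .ite (.read aDesc (.add (.read aRow (.reg rCur)) (.reg rEnd)))
    (.ite (.eq (.reg rCur) (.reg rEnd)) .skip
      (.ite (.eq (.reg rPos) (.lit 0)) .skip
        (.ite (.lt (.reg rPos) (.reg rHigh)) .skip (.assign rBad (.lit 1))) ;;
        .write aSeen (.reg rCur) (.lit 1) ;;
        .write aQueue (.reg rTail) (.reg rCur) ;;
        .assign rTail (.add (.reg rTail) (.lit 1)))) .skip ;;
  .assign rPos (.add (.reg rPos) (.lit 1))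

/-- Process the head of the queue, or else the next vertex in the search order. -/
def scanStep : ForProg :=
  .ite (.lt (.reg rHead) (.reg rTail))
    (.assign rCur (.read aQueue (.reg rHead)) ;;
      .assign rHead (.add (.reg rHead) (.lit 1)) ;;
      .count rInner .verts expandProg)
    (.ite (.lt (.reg rPos) (.reg rCnt))
      (.assign rCur (.read aOrd (.reg rPos)) ;; advanceProg) .skip)

/-- Initialize the scan. -/
def scanInit : ForProg :=
  .count rOuter .verts (.write aSeen (.reg rOuter) (.lit 0)) ;;
  .assign rHead (.lit 0) ;; .assign rTail (.lit 0) ;; .assign rPos (.lit 0) ;;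
  .assign rHigh (.lit 0) ;; .assign rBad (.lit 0)

/-- Find out whether some vertex separates the vertex in `rEnd` from the root of the search tree. -/
def scanProg : ForProg := scanInit ;; .count rOuter .twiceVerts scanStep

/-- The state of the scan stored in `τ`, for the search stored in `σ`. -/
def StoresScan (n : ℕ) (A : ℕ → ℕ → Prop) (σ : RamState) (v : ℕ) (done : ℕ → ℕ → Prop)
    (τ : RamState) : Prop :=
  ScanState n A (σ.reg rRoot) (σ.arr aNum) (σ.arr aPar) (σ.arr aVis) (σ.reg rCnt) v done
    (τ.arr aQueue) (τ.arr aSeen) (τ.reg rTail) (τ.reg rPos) (τ.reg rHigh) (τ.reg rBad)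

/-- The data that the scan reads but does not change. -/
structure ScanInput (n : ℕ) (A : ℕ → ℕ → Prop) (σ : RamState) (v : ℕ) (τ : RamState) : Prop where
  rows : RowsOk n τ
  adj : StoresAdj n A τ
  desc : ∀ w < n, τ.arr aDesc (w * n + v) ≠ 0 ↔
    OnPath n (σ.reg rRoot) (σ.arr aPar) (σ.arr aVis) v w
  num : τ.arr aNum = σ.arr aNum
  ord : τ.arr aOrd = σ.arr aOrd
  cnt : τ.reg rCnt = σ.reg rCnt
  fin : τ.reg rEnd = v
  verts : τ.reg rN = n

theorem ScanInput.of_frame {n : ℕ} {A : ℕ → ℕ → Prop} {σ : RamState} {v : ℕ} {τ τ' : RamState}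
    {p : ForProg} (h : ScanInput n A σ v τ) (hF : p.Frame τ τ')
    (hp : (rCnt ∉ p.regs ∧ rEnd ∉ p.regs ∧ rN ∉ p.regs) ∧ aRow ∉ p.arrs ∧ aAdj ∉ p.arrs ∧
      aDesc ∉ p.arrs ∧ aNum ∉ p.arrs ∧ aOrd ∉ p.arrs) : ScanInput n A σ v τ' := by
  obtain ⟨⟨h1, h2, h3⟩, h4, h5, h6, h7, h8⟩ := hp
  refine ⟨h.rows.of_frame hF h4, h.adj.of_frame hF h5, ?_, ?_, ?_, ?_, ?_, ?_⟩
  · rw [hF.arr _ h6]; exact h.desc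
  · rw [hF.arr _ h7]; exact h.num
  · rw [hF.arr _ h8]; exact h.ord
  · rw [hF.reg _ h1]; exact h.cnt
  · rw [hF.reg _ h2]; exact h.fin
  · rw [hF.reg _ h3]; exact h.verts

/-- A neighbour on the path can only raise `high`; it is not queued before the scan position arrives
at it. A neighbour off the path is queued at once. Column `v` of the descendant matrix distinguishes
the two cases. -/
theorem expandProg_spec {n : ℕ} {A : ℕ → ℕ → Prop} {σ τ : RamState} {v k l : ℕ}
    (hi : ScanInput n A σ v τ) (hl : l < n) (hr : τ.reg rInner = l) (hk : k < τ.reg rTail)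
    (hcur : τ.reg rCur = τ.arr aQueue k)
    (h : StoresScan n A σ v (fun i w => i < k ∨ (i = k ∧ w < l)) τ) :
    (expandProg.den τ).reg rCur = (expandProg.den τ).arr aQueue k ∧
      k < (expandProg.den τ).reg rTail ∧
      StoresScan n A σ v (fun i w => i < k ∨ (i = k ∧ w < l + 1)) (expandProg.den τ) := by
  have hqk := h.que_lt k hk
  have hcell := hi.adj _ hqk l hl
  rw [← hi.rows _ hqk, ← hcur] at hcell
  have hdesc := hi.desc l hl
  rw [← hi.rows l hl] at hdesc
  have upd : ∀ {que seen : ℕ → ℕ} {tail pos high bad : ℕ},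
      ScanState n A (σ.reg rRoot) (σ.arr aNum) (σ.arr aPar) (σ.arr aVis) (σ.reg rCnt) v
        (fun i w => i < k ∨ (i = k ∧ w < l)) que seen tail pos high bad →
      que k = τ.arr aQueue k →
      (A (τ.arr aQueue k) l →
        (OnPath n (σ.reg rRoot) (σ.arr aPar) (σ.arr aVis) v l → σ.arr aNum l ≤ high) ∧
        (¬ OnPath n (σ.reg rRoot) (σ.arr aPar) (σ.arr aVis) v l → seen l ≠ 0)) →
      ScanState n A (σ.reg rRoot) (σ.arr aNum) (σ.arr aPar) (σ.arr aVis) (σ.reg rCnt) v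
        (fun i w => i < k ∨ (i = k ∧ w < l + 1)) que seen tail pos high bad := by
    intro que seen tail pos high bad hS hq hnew
    refine hS.congr_done fun i hi w hw hd hiw => ?_
    rcases hd with hd | ⟨rfl, hd⟩
    · exact hS.closed i hi w hw (.inl hd) hiw
    · rcases Nat.lt_succ_iff_lt_or_eq.1 hd with hd | rfl
      · exact hS.closed i hi w hw (.inr ⟨rfl, hd⟩) hiw
      · exact hnew (hq ▸ hiw)
  have hnum := hi.num
  have hfin := hi.fin
  simp only [expandProg, ForProg.den, RamExpr.eval, hr, hfin, hnum]
  by_cases c1 : τ.arr aAdj (τ.arr aRow (τ.reg rCur) + l) ≠ 0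
  swap
  · rw [if_neg c1]
    exact ⟨hcur, hk, upd h rfl
      fun hA' => absurd (hcell.2 (by rw [hcur]; exact hA')) c1⟩
  rw [if_pos c1]
  have hAl : A (τ.arr aQueue k) l := by rw [← hcur]; exact hcell.1 c1
  by_cases c2 : τ.arr aDesc (τ.arr aRow l + v) ≠ 0
  · rw [if_pos c2]
    have hp := hdesc.1 c2
    by_cases c3 : τ.reg rHigh < σ.arr aNum l
    · simp only [c3, if_true, ne_eq, one_ne_zero, not_false_eq_true]
      have := h.hit hk hp hAl c3
      refine ⟨by simpa using hcur, by simpa using hk, ?_⟩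
      simp only [StoresScan, RamState.reg_setReg, RamState.arr_setReg, rTail, rPos, rHigh, rBad]
      simp only [Nat.reduceEqDiff, if_false, if_true]
      exact upd this rfl
        fun _ => ⟨fun _ => le_rfl, fun h' => absurd hp h'⟩
    · simp only [c3, if_false, ne_eq, not_true_eq_false]
      exact ⟨hcur, hk, upd h rfl
        fun _ => ⟨fun _ => not_lt.1 c3, fun h' => absurd hp h'⟩⟩
  · rw [if_neg c2]
    have hp : ¬ OnPath n (σ.reg rRoot) (σ.arr aPar) (σ.arr aVis) v l := fun h' => c2 (hdesc.2 h')
    by_cases c3 : τ.arr aSeen l ≠ 0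
    · rw [if_pos c3]
      exact ⟨hcur, hk, upd h rfl
        fun _ => ⟨fun h' => absurd h' hp, fun _ => c3⟩⟩
    · rw [if_neg c3]
      have := h.visit hk hl hp (not_not.1 c3) hAl (fun x hx => by omega)
      have hr' := hr
      have hk' := hk
      have hcur' := hcur
      simp only [rInner, rTail, rCur, aQueue] at hr' hk' hcur'
      simp only [StoresScan, RamState.reg_setReg, RamState.arr_setReg, RamState.arr_setArr,
        RamState.reg_setArr, rTail, rPos, rHigh, rBad, aQueue, aSeen, rInner, rCur] at this ⊢
      simp only [Nat.reduceEqDiff, if_false, if_true, hr'] at this ⊢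
      refine ⟨?_, by omega, ?_⟩
      · rw [Function.update_of_ne (by omega), hcur']
      · exact upd this
          (Function.update_of_ne (by omega) _ _) fun _ => ⟨fun h' => absurd h' hp, fun _ => by simp⟩

/-- The queue is exhausted by `hhead`, so `high` accounts for all edges from seen vertices and
decides whether the next vertex of the path separates. The root, at position 0, is not tested, and
`v` is passed without being queued. -/
theorem advanceProg_spec {n : ℕ} {A : ℕ → ℕ → Prop} {σ τ : RamState} {v : ℕ}
    (hs : StoresSearch n A (fun _ _ => True) σ) (hA : ∀ u w, A u w → w < n)
    (hv : v < n ∧ σ.arr aVis v ≠ 0) (hi : ScanInput n A σ v τ) (hpos : τ.reg rPos < σ.reg rCnt)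
    (hcur : τ.reg rCur = σ.arr aOrd (τ.reg rPos)) (hhead : τ.reg rHead = τ.reg rTail)
    (h : StoresScan n A σ v (fun i _ => i < τ.reg rHead) τ) :
    (advanceProg.den τ).reg rPos = τ.reg rPos + 1 ∧
    (advanceProg.den τ).reg rHead ≤ (advanceProg.den τ).reg rTail ∧
    StoresScan n A σ v (fun i _ => i < (advanceProg.den τ).reg rHead) (advanceProg.den τ) := by
  have hall : StoresScan n A σ v (fun _ _ => True) τ :=
    h.congr_done fun i hi w hw _ => h.closed i hi w hw (by rw [hhead]; exact hi)
  have hlt := hs.ord_lt _ hpos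
  have hdesc := hi.desc _ hlt
  rw [← hi.rows _ hlt, ← hcur] at hdesc
  have hfin := hi.fin
  simp only [advanceProg, ForProg.den, RamExpr.eval, hfin]
  have skip : (OnPath n (σ.reg rRoot) (σ.arr aPar) (σ.arr aVis) v (τ.reg rCur) → τ.reg rCur = v) →
      ((τ.setReg rPos (τ.reg rPos + 1)).reg rPos = τ.reg rPos + 1 ∧
        (τ.setReg rPos (τ.reg rPos + 1)).reg rHead ≤ (τ.setReg rPos (τ.reg rPos + 1)).reg rTail ∧
        StoresScan n A σ v (fun i _ => i < (τ.setReg rPos (τ.reg rPos + 1)).reg rHead)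
          (τ.setReg rPos (τ.reg rPos + 1))) := by
    intro hp
    have := h.skip hs hpos (by rw [← hcur]; exact hp)
    refine ⟨by simp, by simpa using hhead.le, ?_⟩
    simpa [StoresScan] using this
  by_cases c1 : τ.arr aDesc (τ.arr aRow (τ.reg rCur) + v) ≠ 0
  swap
  · rw [if_neg c1]
    exact skip fun hp => absurd (hdesc.2 hp) c1
  rw [if_pos c1]
  have hp := hdesc.1 c1
  by_cases c2 : τ.reg rCur = v
  · simp only [c2, if_true, ne_eq, one_ne_zero, not_false_eq_true]
    exact skip fun _ => c2
  simp only [c2, if_false, ne_eq, not_true_eq_false]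
  have hd : ∀ x : ℕ, ¬ (fun i (_ : ℕ) => i < τ.reg rHead) (τ.reg rTail) x := by
    intro x
    simp only [hhead, lt_irrefl, not_false_eq_true]
  have push : ∀ bad', (bad' ≠ 0 ↔ τ.reg rBad ≠ 0 ∨ (τ.reg rPos ≠ 0 ∧ ¬ τ.reg rPos < τ.reg rHigh)) →
      _ := fun bad' hbad =>
    hall.push (done := fun i _ => i < τ.reg rHead) hs hA hv hpos (by rw [← hcur]; exact hp)
      (by rw [← hcur]; exact c2) hbad hd
  rw [← hcur] at push
  have hhead' := hhead
  simp only [rHead, rTail] at hhead'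
  by_cases c3 : τ.reg rPos = 0
  · have := push (τ.reg rBad) (by simp only [c3]; tauto)
    simp only [c3, if_true, one_ne_zero, not_false_eq_true] at this ⊢
    simp only [rPos] at c3
    simp only [StoresScan, RamState.reg_setReg, RamState.arr_setReg, RamState.arr_setArr,
      RamState.reg_setArr, rTail, rPos, rHigh, rBad, aQueue, aSeen, rCur, rHead] at this ⊢
    simp only [Nat.reduceEqDiff, if_false, if_true, c3] at this ⊢
    exact ⟨trivial, by omega, this⟩
  by_cases c4 : τ.reg rPos < τ.reg rHigh
  · have := push (τ.reg rBad) (by simp only [c4]; tauto)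
    simp only [c3, c4, if_true, if_false, one_ne_zero, not_false_eq_true, not_true_eq_false]
      at this ⊢
    simp only [StoresScan, RamState.reg_setReg, RamState.arr_setReg, RamState.arr_setArr,
      RamState.reg_setArr, rTail, rPos, rHigh, rBad, aQueue, aSeen, rCur, rHead] at this ⊢
    simp only [Nat.reduceEqDiff, if_false, if_true] at this ⊢
    exact ⟨trivial, by omega, this⟩
  · have := push 1 (by
      simp only [c4, ne_eq, c3]
      simp)
    simp only [c3, c4, if_false, not_true_eq_false]
    simp only [StoresScan, RamState.reg_setReg, RamState.arr_setReg, RamState.arr_setArr,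
      RamState.reg_setArr, rTail, rPos, rHigh, rBad, aQueue, aSeen, rCur, rHead] at this ⊢
    simp only [Nat.reduceEqDiff, if_false, if_true] at this ⊢
    exact ⟨trivial, by omega, this⟩

/-- Progress is measured by `rHead + rPos`, which grows by one per round until both the queue and
the search order are exhausted. -/
theorem scanStep_spec {n : ℕ} {A : ℕ → ℕ → Prop} {σ τ : RamState} {v k : ℕ}
    (hs : StoresSearch n A (fun _ _ => True) σ) (hA : ∀ u w, A u w → w < n)
    (hv : v < n ∧ σ.arr aVis v ≠ 0) (hi : ScanInput n A σ v τ)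
    (hht : τ.reg rHead ≤ τ.reg rTail)
    (hk : τ.reg rHead + τ.reg rPos = k ∨ (τ.reg rHead = τ.reg rTail ∧ τ.reg rPos = σ.reg rCnt))
    (h : StoresScan n A σ v (fun i _ => i < τ.reg rHead) τ) :
    (scanStep.den τ).reg rHead ≤ (scanStep.den τ).reg rTail ∧
    ((scanStep.den τ).reg rHead + (scanStep.den τ).reg rPos = k + 1 ∨
      ((scanStep.den τ).reg rHead = (scanStep.den τ).reg rTail ∧
        (scanStep.den τ).reg rPos = σ.reg rCnt)) ∧
    StoresScan n A σ v (fun i _ => i < (scanStep.den τ).reg rHead) (scanStep.den τ) := by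
  have hcnt := hi.cnt
  by_cases c1 : τ.reg rHead < τ.reg rTail
  · obtain ⟨τ1, hτ1⟩ : ∃ τ1, τ1 = (τ.setReg rCur (τ.arr aQueue (τ.reg rHead))).setReg rHead
        (τ.reg rHead + 1) := ⟨_, rfl⟩
    have hden : scanStep.den τ = (ForProg.count rInner .verts expandProg).den τ1 := by
      simp only [scanStep]
      rw [ForProg.den, if_pos (by simp only [RamExpr.eval, c1]; simp)]
      rw [ForProg.den_seq, ForProg.den_seq, hτ1]
      rfl
    have hf0 := ForProg.frame_den (.assign rCur (.read aQueue (.reg rHead)) ;;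
      .assign rHead (.add (.reg rHead) (.lit 1))) τ
    have hf0' : (ForProg.den (.assign rCur (.read aQueue (.reg rHead)) ;;
      .assign rHead (.add (.reg rHead) (.lit 1))) τ) = τ1 := by rw [hτ1]; rfl
    rw [hf0'] at hf0
    have hi1 := hi.of_frame hf0 (by decide)
    have e1 : τ1.reg rHead = τ.reg rHead + 1 := by simp [hτ1]
    have e2 : τ1.reg rTail = τ.reg rTail := hf0.reg rTail (by decide)
    have e3 : τ1.reg rPos = τ.reg rPos := hf0.reg rPos (by decide)
    have e4 : τ1.reg rCur = τ1.arr aQueue (τ.reg rHead) := by simp [hτ1]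
    have h1 : StoresScan n A σ v (fun i _ => i < τ.reg rHead) τ1 := by
      rw [hτ1]
      simpa [StoresScan] using h
    have hf := ForProg.frame_den (.count rInner .verts expandProg) τ1
    have := ForProg.count_rule (r := rInner) (b := .verts) (p := expandProg) (σ := τ1)
      (fun l τ' => τ'.reg rCur = τ'.arr aQueue (τ.reg rHead) ∧ τ.reg rHead < τ'.reg rTail ∧
        StoresScan n A σ v
          (fun i w => i < τ.reg rHead ∨ (i = τ.reg rHead ∧ w < l)) τ')
      (by
        refine ⟨by simpa using e4, by simpa using e2 ▸ c1, ?_⟩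
        have : StoresScan n A σ v (fun i w => i < τ.reg rHead ∨ (i = τ.reg rHead ∧ w < 0)) τ1 :=
          h1.congr_done fun i hi w hw hd => h1.closed i hi w hw (by omega)
        simpa [StoresScan] using this) (by
        intro l hl τ' hF' hr' ⟨g1, g2, g3⟩
        have hln : l < n := by simpa only [LoopBound.val, hi1.verts] using hl
        simpa [StoresScan] using
          expandProg_spec (hi1.of_frame hF' (by decide)) hln hr' g2 g1 g3)
    simp only [LoopBound.val, hi1.verts] at this
    rw [hden]
    obtain ⟨-, g2, g3⟩ := this
    rw [hf.reg rHead (by decide), hf.reg rPos (by decide), e1, e3]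
    refine ⟨g2, .inl (by omega), ?_⟩
    exact g3.congr_done fun i hi w hw hd => g3.closed i hi w hw (by omega)
  · have hht' : τ.reg rHead = τ.reg rTail := by omega
    by_cases c2 : τ.reg rPos < τ.reg rCnt
    · have hden : scanStep.den τ = advanceProg.den (τ.setReg rCur (τ.arr aOrd (τ.reg rPos))) := by
        simp only [scanStep]
        rw [ForProg.den, if_neg (by simp only [RamExpr.eval, c1]; simp), ForProg.den,
          if_pos (by simp only [RamExpr.eval, c2]; simp), ForProg.den_seq]
        rfl
      have hf0 := ForProg.frame_den (.assign rCur (.read aOrd (.reg rPos))) τ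
      have hi1 := hi.of_frame hf0 (by decide)
      have := advanceProg_spec (τ := τ.setReg rCur (τ.arr aOrd (τ.reg rPos))) hs hA hv hi1
        (by simp only [rPos, rCnt] at c2 hcnt; simpa [hcnt] using c2)
        (by have := hi.ord; simp only [aOrd] at this; simp [this])
        (by simpa using hht') (by simpa [StoresScan] using h)
      rw [hden]
      obtain ⟨g1, g2, g3⟩ := this
      refine ⟨g2, .inl ?_, g3⟩
      have e1 := (ForProg.frame_den advanceProg
        (τ.setReg rCur (τ.arr aOrd (τ.reg rPos)))).reg rHead (by decide)
      rw [g1, e1]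
      simp only [RamState.reg_setReg, rHead, rPos, rCur, Nat.reduceEqDiff, if_false]
      simp only [rHead, rPos, rCnt] at hk c2 hcnt
      omega
    · have hden : scanStep.den τ = τ := by
        simp only [scanStep]
        rw [ForProg.den, if_neg (by simp only [RamExpr.eval, c1]; simp), ForProg.den,
          if_neg (by simp only [RamExpr.eval, c2]; simp), ForProg.den]
      rw [hden]
      have := h.pos_le
      exact ⟨hht, .inr ⟨hht', by omega⟩, h⟩

theorem scanProg_spec {n : ℕ} {A : ℕ → ℕ → Prop} {σ : RamState} {v : ℕ}
    (hs : StoresSearch n A (fun _ _ => True) σ) (hA : ∀ u w, A u w → w < n)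
    (hv : v < n ∧ σ.arr aVis v ≠ 0) (hi : ScanInput n A σ v σ) :
    (scanProg.den σ).reg rBad ≠ 0 ↔
      ¬ ∀ z < n, z ≠ σ.reg rRoot → z ≠ v → ReachAvoid A z (σ.reg rRoot) v := by
  have hf := ForProg.frame_den scanInit σ
  have hseen : ∀ w < n, (scanInit.den σ).arr aSeen w = 0 :=
    clear_spec (a := aSeen) (n := n) hi.verts
  have z1 : (scanInit.den σ).reg rHead = 0 := by simp only [scanInit, ForProg.den_seq]; simp
  have z2 : (scanInit.den σ).reg rTail = 0 := by simp only [scanInit, ForProg.den_seq]; simp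
  have z3 : (scanInit.den σ).reg rPos = 0 := by simp only [scanInit, ForProg.den_seq]; simp
  have z4 : (scanInit.den σ).reg rHigh = 0 := by simp only [scanInit, ForProg.den_seq]; simp
  have z5 : (scanInit.den σ).reg rBad = 0 := by simp only [scanInit, ForProg.den_seq]; simp
  have hi0 := hi.of_frame hf (by decide)
  rw [scanProg, ForProg.den_seq]
  set σ0 := scanInit.den σ
  clear_value σ0
  have h0 : StoresScan n A σ v (fun _ _ => False) σ0 := by
    rw [StoresScan, z2, z3, z4, z5]
    exact ScanState.init hseen
  have := ForProg.count_rule (r := rOuter) (b := .twiceVerts) (p := scanStep) (σ := σ0)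
    (fun k τ => τ.reg rHead ≤ τ.reg rTail ∧ (τ.reg rHead + τ.reg rPos = k ∨
      (τ.reg rHead = τ.reg rTail ∧ τ.reg rPos = σ.reg rCnt)) ∧
      StoresScan n A σ v (fun i _ => i < τ.reg rHead) τ)
    (by
      have h0' : StoresScan n A σ v (fun i _ => i < σ0.reg rHead) σ0 :=
        h0.congr_done fun i hi w hw hd => by omega
      refine ⟨?_, .inl ?_, by simpa [StoresScan] using h0'⟩
      · simp only [rHead, rTail] at z1 z2
        simp [z1, z2]
      · simp only [rHead, rPos] at z1 z3
        simp [z1, z3]) (by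
      intro k hk τ hF hr ⟨g1, g2, g3⟩
      simpa [StoresScan] using scanStep_spec hs hA hv (hi0.of_frame hF (by decide)) g1 g2 g3)
  simp only [LoopBound.val, hi0.verts] at this
  obtain ⟨g1, g2, g3⟩ := this
  have t1 := g3.tail_le
  have t2 := g3.pos_le
  have t3 := hs.cnt_le
  -- Since `rHead ≤ rTail ≤ n` and `rPos ≤ cnt ≤ n`, the position has arrived at `cnt` after `2n`
  -- rounds.
  have hfin : (ForProg.den (.count rOuter .twiceVerts scanStep) σ0).reg rPos = σ.reg rCnt := by
    omega
  rw [StoresScan, hfin] at g3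
  exact g3.bad_ne_zero_iff hs hv

/-- Decide whether some vertex separates the head from the tail of the edge at position `rEdge` in the
graph stored in `aE2v`. -/
def separatorProg : ForProg :=
  .assign rBan (.reg rN) ;;
  .assign rRoot (.read aSrc (.reg rEdge)) ;;
  .assign rEnd (.read aDst (.reg rEdge)) ;;
  rowsProg ;; adjProg aE2v ;; searchProg ;; descProg ;;
  .ite (.read aVis (.reg rEnd)) scanProg (.assign rBad (.lit 1))

theorem reachAvoid_iff_reachIn {n : ℕ} {F : Set (Fin n × Fin n)} {u v z : Fin n} :
    ReachAvoid (NatAdj F Set.univ) z u v ↔ ReachIn F ({z}ᶜ) u v := by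
  constructor
  · intro h
    suffices H : ∀ w, ReachAvoid (NatAdj F Set.univ) z u w → ∀ w' : Fin n, (w' : ℕ) = w →
        ReachIn F ({z}ᶜ) u w' from H v h v rfl
    intro w hw
    induction hw with
    | refl => intro w' hw'; rw [Fin.ext hw']
    | @tail b c _ hbc ih =>
      rintro w' rfl
      obtain ⟨h1, h2, hb, hc, _, _, hF⟩ := hbc
      refine (ih ⟨b, hb⟩ rfl).tail ⟨fun h => h1 (congrArg Fin.val h), fun h => h2 ?_, hF⟩
      exact congrArg Fin.val h
  · intro h
    refine Relation.ReflTransGen.lift (p := fun a b => a ≠ (z : ℕ) ∧ b ≠ (z : ℕ) ∧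
      NatAdj F Set.univ a b) (fun v : Fin n => (v : ℕ)) (fun p q ⟨h1, h2, h3⟩ => ?_) _ _ h
    exact ⟨fun h => h1 (Fin.ext h), fun h => h2 (Fin.ext h), p.2, q.2, trivial, trivial, h3⟩

/-- The search starts at the tail of the edge and deletes no vertex, as `rBan` is `n`. If it finds
the head, the scan decides. If not, any third vertex violates the condition, and one exists because
`3 ≤ n`. -/
theorem separatorProg_spec {n : ℕ} {L : List (Fin n × Fin n)} {σ : RamState}
    (hG : StoresGraph L σ) {F : Set (Fin n × Fin n)} (hFL : F ⊆ edgeSet L)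
    (hF : StoresEdges L aE2v F σ) {k : ℕ} (hk : k < L.length) (hkσ : σ.reg rEdge = k)
    (hn : 3 ≤ n) :
    (separatorProg.den σ).reg rBad ≠ 0 ↔
      ¬ ∀ z, z ≠ L[k].1 → z ≠ L[k].2 → ReachIn F ({z}ᶜ) L[k].1 L[k].2 := by
  simp only [separatorProg, ForProg.den_seq]
  have f0 := ForProg.frame_den (.assign rBan (.reg rN) ;;
    .assign rRoot (.read aSrc (.reg rEdge)) ;; .assign rEnd (.read aDst (.reg rEdge))) σ
  rw [ForProg.den_seq, ForProg.den_seq] at f0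
  set σ0 := ForProg.den (.assign rEnd (.read aDst (.reg rEdge)))
    (ForProg.den (.assign rRoot (.read aSrc (.reg rEdge)))
      (ForProg.den (.assign rBan (.reg rN)) σ)) with hσ0
  have hL := hG.2.2 k hk
  have ban0 : σ0.reg rBan = n := by
    rw [← hG.1]
    simp [hσ0]
  have root0 : σ0.reg rRoot = L[k].1 := by
    rw [← hL.1, ← hkσ]
    simp [hσ0]
  have end0 : σ0.reg rEnd = L[k].2 := by
    rw [← hL.2, ← hkσ]
    simp [hσ0]
  clear_value σ0
  have g0 := hG.of_frame f0 (by decide)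
  have E0 := hF.of_frame f0 (by decide)
  have f1 := ForProg.frame_den rowsProg σ0
  have r1 := rowsProg_spec g0.1
  set σ1 := ForProg.den rowsProg σ0 with hσ1
  clear_value σ1
  have g1 := g0.of_frame f1 (by decide)
  have E1 := E0.of_frame f1 (by decide)
  have ban1 : σ1.reg rBan = n := (f1.reg rBan (by decide)).trans ban0
  have a2 := adjProg_spec (a := aE2v) (S := Set.univ) (by decide) g1 r1 hFL E1
    (fun v => by
      rw [ban1]
      exact ⟨fun _ => v.2.ne, fun _ => trivial⟩)
  have f2 := ForProg.frame_den (adjProg aE2v) σ1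
  set σ2 := ForProg.den (adjProg aE2v) σ1 with hσ2
  clear_value σ2
  have n2 : σ2.reg rN = n := (f2.reg rN (by decide)).trans g1.1
  have r2 := r1.of_frame f2 (by decide)
  have root2 : σ2.reg rRoot = L[k].1 := by
    rw [f2.reg rRoot (by decide), f1.reg rRoot (by decide), root0]
  have end2 : σ2.reg rEnd = L[k].2 := by
    rw [f2.reg rEnd (by decide), f1.reg rEnd (by decide), end0]
  have s3 := searchProg_spec n2 r2 a2 (by rw [root2]; exact L[k].1.2)
  have f3 := ForProg.frame_den searchProg σ2
  set σ3 := ForProg.den searchProg σ2 with hσ3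
  clear_value σ3
  have n3 : σ3.reg rN = n := (f3.reg rN (by decide)).trans n2
  have r3 := r2.of_frame f3 (by decide)
  have a3 := a2.of_frame f3 (by decide)
  have d4 := descProg_spec n3 r3 s3
  have f4 := ForProg.frame_den descProg σ3
  set σ4 := ForProg.den descProg σ3 with hσ4
  clear_value σ4
  have n4 : σ4.reg rN = n := (f4.reg rN (by decide)).trans n3
  have r4 := r3.of_frame f4 (by decide)
  have a4 := a3.of_frame f4 (by decide)
  have s4 := s3.of_frame f4 (by decide)
  have root4 : σ4.reg rRoot = L[k].1 := by
    rw [f4.reg rRoot (by decide), f3.reg rRoot (by decide), root2]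
  have end4 : σ4.reg rEnd = L[k].2 := by
    rw [f4.reg rEnd (by decide), f3.reg rEnd (by decide), end2]
  have hA : ∀ u w, NatAdj F Set.univ u w → w < n := fun u w ⟨_, h, _⟩ => h
  rw [← f4.arr aVis (by decide), ← f4.arr aPar (by decide), ← f4.reg rRoot (by decide)] at d4
  have hconv : (∀ z < n, z ≠ (L[k].1 : ℕ) → z ≠ (L[k].2 : ℕ) →
        ReachAvoid (NatAdj F Set.univ) z L[k].1 L[k].2) ↔
      ∀ z, z ≠ L[k].1 → z ≠ L[k].2 → ReachIn F ({z}ᶜ) L[k].1 L[k].2 := by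
    constructor
    · intro h z h1 h2
      exact reachAvoid_iff_reachIn.1
        (h z z.2 (fun h => h1 (Fin.ext h)) fun h => h2 (Fin.ext h))
    · intro h z hz h1 h2
      exact reachAvoid_iff_reachIn (z := ⟨z, hz⟩).2
        (h ⟨z, hz⟩ (fun h => h1 (congrArg Fin.val h)) fun h => h2 (congrArg Fin.val h))
  rw [← hconv]
  by_cases c : σ4.arr aVis (L[k].2 : ℕ) ≠ 0
  · rw [ForProg.den, if_pos (by rw [RamExpr.eval, RamExpr.eval, end4]; exact c)]
    have hin : ScanInput n (NatAdj F Set.univ) σ4 L[k].2 σ4 := by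
      refine ⟨r4, a4, fun w hw => ?_, rfl, rfl, rfl, end4, n4⟩
      have hd := d4 w hw L[k].2 L[k].2.2
      by_cases hvis : σ4.arr aVis w = 0
      · rw [hd.2 hvis]
        constructor
        · rintro rfl
          exact absurd hvis c
        · exact fun h => absurd hvis h.1.2
      · rw [hd.1 hvis]
        exact ⟨fun h => ⟨⟨hw, hvis⟩, h.2⟩, fun h => ⟨c, h.2⟩⟩
    have := scanProg_spec s4 hA ⟨L[k].2.2, c⟩ hin
    rwa [root4] at this
  · rw [ForProg.den, if_neg (by rw [RamExpr.eval, RamExpr.eval, end4]; exact c)]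
    simp only [ForProg.den, RamExpr.eval, RamState.reg_setReg, if_true, ne_eq, one_ne_zero,
      not_false_eq_true, true_iff]
    intro hall
    obtain ⟨z, hz⟩ : ∃ z, z ∉ ({L[k].1, L[k].2} : Finset (Fin n)) := by
      by_contra! hall
      have := (Finset.card_le_card (s := Finset.univ) fun x _ => hall x).trans Finset.card_le_two
      rw [Finset.card_univ, Fintype.card_fin] at this
      omega
    simp only [Finset.mem_insert, Finset.mem_singleton, not_or] at hz
    have hr := hall z z.2 (fun h => hz.1 (Fin.ext h)) fun h => hz.2 (Fin.ext h)
    rw [← root4] at hr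
    exact c (s4.reach_vis hA (Relation.ReflTransGen.mono (fun _ _ h => h.2.2) _ _ hr)).2

/-! ## The subroutines -/

theorem Alg.keeps_of_frame {p : ForProg} {σ τ : RamState} (hF : p.Frame σ τ) {rs as : List ℕ}
    (hr : ∀ r ∈ rs, r ∉ p.regs) (ha : ∀ a ∈ as, a ∉ p.arrs) : Keeps rs as σ τ :=
  ⟨fun r h => hF.reg r (hr r h), fun a h => hF.arr a (ha a h)⟩

/-- Counting loops always halt, so only the denotation has to be examined. -/
theorem ForProg.correct_compile {p : ForProg} (hok : p.ok = true) {Pre : RamState → Prop}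
    {Post : RamState → RamState → Prop} (h : ∀ σ, Pre σ → Post σ (p.den σ)) :
    Alg.Correct p.compile Pre Post := fun σ hσ =>
  have ⟨t, ht, _⟩ := ForProg.exec_compile _ _ p hok σ rfl rfl
  ⟨t, p.den σ, ht, h σ hσ⟩

/-! ### Minimal subgraph, articulation points and search for an edge -/

/-- Try to drop the edge at position `rEdge`. -/
def dropProg : ForProg :=
  .write aE2v (.reg rEdge) (.lit 0) ;;
  separatorProg ;;
  .ite (.reg rBad) (.write aE2v (.reg rEdge) (.lit 1)) .skip

/-- Compute a minimal `2`-vertex-connected spanning subgraph. -/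
def minimalProg : ForProg :=
  .count rEdge .edges (.write aE2v (.reg rEdge) (.lit 1)) ;; .count rEdge .edges dropProg

/-- Without repetitions in `L`, the edge has no second position at which it would remain marked. -/
theorem Alg.StoresEdges.diff {n : ℕ} {L : List (Fin n × Fin n)} (hL : L.Nodup) {a : ℕ}
    {F : Set (Fin n × Fin n)} {σ : RamState} (h : StoresEdges L a F σ) {k : ℕ} (hk : k < L.length) :
    StoresEdges L a (F \ {L[k]}) (σ.setArr a k 0) := by
  intro i hi
  simp only [RamState.arr_setArr, if_true, Function.update_apply, Set.mem_sdiff,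
    Set.mem_singleton_iff, hL.getElem_inj_iff]
  split_ifs with hik
  · simp [hik]
  · simpa [hik] using h i hi

theorem Alg.StoresEdges.insert {n : ℕ} {L : List (Fin n × Fin n)} (hL : L.Nodup) {a : ℕ}
    {F : Set (Fin n × Fin n)} {σ : RamState} (h : StoresEdges L a F σ) {k : ℕ} (hk : k < L.length) :
    StoresEdges L a (insert L[k] F) (σ.setArr a k 1) := by
  intro i hi
  simp only [RamState.arr_setArr, if_true, Function.update_apply, Set.mem_insert_iff,
    hL.getElem_inj_iff]
  split_ifs with hik
  · simp [hik]
  · simpa [hik] using h i hi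

/-- One pass is enough: an edge that was indispensable when tested stays so in every smaller graph,
because `2`-vertex-connectivity passes to larger edge sets. -/
theorem minimalProg_spec {n : ℕ} {L : List (Fin n × Fin n)} (hL : L.Nodup)
    (hE : IsKVertexConnected 2 (edgeSet L)) {σ : RamState} (hG : StoresGraph L σ) :
    ∃ E2v, IsMinimalTwoVertexConnected (edgeSet L) E2v ∧
      StoresEdges L aE2v E2v (minimalProg.den σ) := by
  have hn : 3 ≤ n := by simpa using hE.2.1
  have hinit := ForProg.count_rule (r := rEdge) (b := .edges)
    (p := .write aE2v (.reg rEdge) (.lit 1)) (σ := σ) (fun k τ => ∀ i < k, τ.arr aE2v i ≠ 0)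
    (by simp) (by
      intro k hk τ hF hr hI i hi
      simp only [ForProg.den, RamExpr.eval, hr, RamState.arr_setReg, RamState.arr_setArr, if_true,
        Function.update_apply]
      split_ifs with h
      · simp
      · exact hI i (by omega))
  simp only [LoopBound.val, hG.2.1] at hinit
  have hf0 := ForProg.frame_den (.count rEdge .edges (.write aE2v (.reg rEdge) (.lit 1))) σ
  rw [minimalProg, ForProg.den_seq]
  set σ0 := ForProg.den (.count rEdge .edges (.write aE2v (.reg rEdge) (.lit 1))) σ
  have hG0 := hG.of_frame hf0 (by decide)
  clear_value σ0
  have := ForProg.count_rule (r := rEdge) (b := .edges) (p := dropProg) (σ := σ0)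
    (fun k τ => ∃ F ⊆ edgeSet L, StoresEdges L aE2v F τ ∧ IsKVertexConnected 2 F ∧
      ∀ i, ∀ h : i < L.length, i < k → L[i] ∈ F → ¬ IsKVertexConnected 2 (F \ {L[i]}))
    (by
      refine ⟨edgeSet L, subset_rfl, fun i hi => ?_, hE, fun i _ h => absurd h (by omega)⟩
      simp only [RamState.arr_setReg]
      exact ⟨fun _ => List.getElem_mem hi, fun _ => hinit i hi⟩) (by
      rintro k hk τ hF hr ⟨F, hFL, hFτ, hF2, hmin⟩
      have hGτ := hG0.of_frame hF (by decide)
      have hkL : k < L.length := by simpa only [LoopBound.val, hG0.2.1] using hk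
      rw [dropProg, ForProg.den_seq, ForProg.den_seq]
      have e0 : ForProg.den (.write aE2v (.reg rEdge) (.lit 0)) τ = τ.setArr aE2v k 0 := by
        rw [ForProg.den, RamExpr.eval, RamExpr.eval, hr]
      rw [e0]
      have s1 := hFτ.diff hL hkL
      have hG1 : StoresGraph L (τ.setArr aE2v k 0) := by
        have := hGτ.of_frame (ForProg.frame_den (.write aE2v (.reg rEdge) (.lit 0)) τ) (by decide)
        rwa [e0] at this
      have hr1 : (τ.setArr aE2v k 0).reg rEdge = k := hr
      have hsep := separatorProg_spec hG1 (Set.sdiff_subset.trans hFL) s1 hkL hr1 hn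
      have hf := ForProg.frame_den separatorProg (τ.setArr aE2v k 0)
      have s2 := s1.of_frame hf (by decide)
      have hr2 := (hf.reg rEdge (by decide)).trans hr1
      set τ2 := ForProg.den separatorProg (τ.setArr aE2v k 0)
      clear_value τ2
      have hsep' : τ2.reg rBad ≠ 0 ↔ ¬ IsKVertexConnected 2 (F \ {L[k]}) := by
        rw [hsep, IsKVertexConnected.diff_singleton_iff (u := L[k].1) (v := L[k].2) hF2]
      rw [ForProg.den]
      by_cases c : τ2.reg rBad ≠ 0
      · rw [if_pos (by rwa [RamExpr.eval])]
        -- Removing an absent edge would leave the `2`-vertex-connected graph `F` unchanged.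
        have hkF : L[k] ∈ F := by
          by_contra hkF
          exact hsep'.1 c (by rwa [Set.sdiff_singleton_eq_self hkF])
        refine ⟨F, hFL, ?_, hF2, fun i hi hik hiF => ?_⟩
        · have := s2.insert hL hkL
          rw [Set.insert_sdiff_singleton, Set.insert_eq_of_mem hkF] at this
          rw [ForProg.den, RamExpr.eval, RamExpr.eval, hr2]
          exact this
        · rcases Nat.lt_succ_iff_lt_or_eq.1 hik with hik | rfl
          · exact hmin i hi hik hiF
          · exact hsep'.1 c
      · rw [if_neg (by rwa [RamExpr.eval])]
        have h2 : IsKVertexConnected 2 (F \ {L[k]}) := by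
          by_contra h2
          exact c (hsep'.2 h2)
        refine ⟨F \ {L[k]}, Set.sdiff_subset.trans hFL, s2, h2, fun i hi hik hiF => ?_⟩
        rcases Nat.lt_succ_iff_lt_or_eq.1 hik with hik | rfl
        · exact fun h => hmin i hi hik hiF.1 (h.mono (Set.sdiff_subset_sdiff_left Set.sdiff_subset))
        · exact absurd rfl hiF.2)
  simp only [LoopBound.val, hG0.2.1] at this
  obtain ⟨F, hFL, hFτ, hF2, hmin⟩ := this
  refine ⟨F, isMinimalTwoVertexConnected_of_forall hFL hF2 fun e he => ?_, hFτ⟩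
  obtain ⟨i, hi, rfl⟩ := List.getElem_of_mem (hFL he)
  exact hmin i hi hi he

/-- Compute the twinless articulation points. -/
def articulationProg : ForProg :=
  .count rX .verts (coreProg aE2v ;; .write aTap (.reg rX) (.reg rFlag))

theorem IsMinimalTwoVertexConnected.compl {V : Type*} [Fintype V] {E F : Set (V × V)}
    (h : IsMinimalTwoVertexConnected E F) (x : V) : StronglyConnectedOn F ({x}ᶜ) :=
  (isKVertexConnected_two_iff.1 h.1.2).2.2 x

theorem IsMinimalTwoVertexConnected.three_le {n : ℕ} {E F : Set (Fin n × Fin n)}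
    (h : IsMinimalTwoVertexConnected E F) : 3 ≤ n := by simpa using h.1.2.2.1

/-- The loop counter is `rX`, the register from which `coreProg` takes the vertex to delete, and the
resulting flag is the answer for this vertex. -/
theorem articulationProg_spec {n : ℕ} {L : List (Fin n × Fin n)} {E2v : Set (Fin n × Fin n)}
    (hmin : IsMinimalTwoVertexConnected (edgeSet L) E2v) {σ : RamState} (hG : StoresGraph L σ)
    (hE : StoresEdges L aE2v E2v σ) :
    ∀ x : Fin n, (articulationProg.den σ).arr aTap x ≠ 0 ↔ IsTwinlessArticulationPoint E2v x := by
  have hn := hmin.three_le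
  have := ForProg.count_rule (r := rX) (b := .verts)
    (p := coreProg aE2v ;; .write aTap (.reg rX) (.reg rFlag)) (σ := σ)
    (fun k τ => ∀ x : Fin n, (x : ℕ) < k →
      (τ.arr aTap x ≠ 0 ↔ IsTwinlessArticulationPoint E2v x)) (fun x hx => absurd hx (by omega)) (by
      intro k hk τ hF hr hI x hx
      have hkn : k < n := by simpa only [LoopBound.val, hG.1] using hk
      have hc := (coreProg_spec (a := aE2v) (x := ⟨k, hkn⟩) (by decide)
        (hG.of_frame hF (by decide)) hmin.1.1 (hE.of_frame hF (by decide)) hr (by omega)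
        (hmin.compl _)).2
      have hf := ForProg.frame_den (coreProg aE2v) τ
      have e1 := (hf.reg rX (by decide)).trans hr
      have e2 := hf.arr aTap (by decide)
      rw [ForProg.den_seq, ForProg.den]
      simp only [RamState.arr_setReg, RamState.arr_setArr, RamExpr.eval, if_true, e1, e2]
      rw [Function.update_apply]
      split_ifs with h
      · rw [hc]
        have : x = ⟨k, hkn⟩ := Fin.ext h
        rw [this]
        exact Iff.rfl
      · exact hI x (by omega))
  simp only [LoopBound.val, hG.1] at this
  exact fun x => this x x.2

/-- Find an edge of `E ∖ E_{2t}` between distinct components. -/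
def findProg : ForProg :=
  .assign rPick (.lit 0) ;;
  .count rOuter .edges
    (.ite (.read aE2t (.reg rOuter)) .skip
      (.ite (.eq (.read aSrc (.reg rOuter)) (.reg rX)) .skip
        (.ite (.eq (.read aDst (.reg rOuter)) (.reg rX)) .skip
          (.ite (.eq (.read aComp (.read aSrc (.reg rOuter)))
              (.read aComp (.read aDst (.reg rOuter)))) .skip
            (.assign rPick (.reg rOuter))))))

/-- Each suitable edge overwrites `rPick`, so the last one remains. The initial value 0 means
nothing, but by `hex` it is overwritten or happens to be suitable. -/
theorem findProg_spec {n : ℕ} {L : List (Fin n × Fin n)} {F : Set (Fin n × Fin n)} {x : Fin n}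
    {σ : RamState} (hG : StoresGraph L σ) (hF : StoresEdges L aE2t F σ) (hx : σ.reg rX = x)
    (hex : ∃ i, ∃ h : i < L.length, L[i] ∉ F ∧ L[i].1 ≠ x ∧ L[i].2 ≠ x ∧
      σ.arr aComp L[i].1 ≠ σ.arr aComp L[i].2) :
    ∃ h : (findProg.den σ).reg rPick < L.length, L[(findProg.den σ).reg rPick] ∉ F ∧
      L[(findProg.den σ).reg rPick].1 ≠ x ∧ L[(findProg.den σ).reg rPick].2 ≠ x ∧
      σ.arr aComp L[(findProg.den σ).reg rPick].1 ≠
        σ.arr aComp L[(findProg.den σ).reg rPick].2 := by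
  let good : ℕ → Prop := fun i => ∃ h : i < L.length, L[i] ∉ F ∧ L[i].1 ≠ x ∧ L[i].2 ≠ x ∧
    σ.arr aComp L[i].1 ≠ σ.arr aComp L[i].2
  rw [findProg, ForProg.den_seq]
  have f0 := ForProg.frame_den (.assign rPick (.lit 0)) σ
  set σ0 := ForProg.den (.assign rPick (.lit 0)) σ
  clear_value σ0
  have M0 : σ0.reg rM = L.length := (f0.reg rM (by decide)).trans hG.2.1
  have := ForProg.count_rule (r := rOuter) (b := .edges)
    (p := .ite (.read aE2t (.reg rOuter)) .skip
      (.ite (.eq (.read aSrc (.reg rOuter)) (.reg rX)) .skip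
        (.ite (.eq (.read aDst (.reg rOuter)) (.reg rX)) .skip
          (.ite (.eq (.read aComp (.read aSrc (.reg rOuter)))
              (.read aComp (.read aDst (.reg rOuter)))) .skip
            (.assign rPick (.reg rOuter)))))) (σ := σ0)
    (fun k τ => (∃ i < k, good i) → good (τ.reg rPick))
    (by rintro ⟨i, hi, _⟩; omega) (by
      intro k hk τ hFr hr hI
      have hkL : k < L.length := by simpa only [LoopBound.val, M0] using hk
      have e1 : τ.arr aE2t = σ.arr aE2t :=
        (hFr.arr aE2t (by decide)).trans (f0.arr aE2t (by decide))
      have e2 : τ.arr aSrc k = (L[k].1 : ℕ) := by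
        rw [hFr.arr aSrc (by decide), f0.arr aSrc (by decide)]
        exact (hG.2.2 k hkL).1
      have e3 : τ.arr aDst k = (L[k].2 : ℕ) := by
        rw [hFr.arr aDst (by decide), f0.arr aDst (by decide)]
        exact (hG.2.2 k hkL).2
      have e4 : τ.reg rX = x :=
        ((hFr.reg rX (by decide)).trans (f0.reg rX (by decide))).trans hx
      have e5 : τ.arr aComp = σ.arr aComp :=
        (hFr.arr aComp (by decide)).trans (f0.arr aComp (by decide))
      have old : ¬ good k → (∃ i < k + 1, good i) → good (τ.reg rPick) := by
        rintro hk' ⟨i, hi, hgood⟩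
        rcases Nat.lt_succ_iff_lt_or_eq.1 hi with hi | rfl
        · exact hI ⟨i, hi, hgood⟩
        · exact absurd hgood hk'
      have hFk := hF k hkL
      have hpick : ∀ (τ' : RamState) (j : ℕ), (τ'.setReg rOuter j).reg rPick = τ'.reg rPick := by
        intro τ' j
        simp
      simp only [ForProg.den, RamExpr.eval, hr, e1, e2, e3, e4, e5, hpick]
      by_cases c1 : σ.arr aE2t k ≠ 0
      · rw [if_pos c1]
        exact old fun ⟨_, h, _⟩ => h (hFk.1 c1)
      rw [if_neg c1]
      by_cases c2 : (L[k].1 : ℕ) = x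
      · simp only [c2, if_true, ne_eq, one_ne_zero, not_false_eq_true]
        exact old fun ⟨_, _, h, _⟩ => h (Fin.ext c2)
      by_cases c3 : (L[k].2 : ℕ) = x
      · simp only [c2, c3, if_true, if_false, ne_eq, one_ne_zero, not_false_eq_true,
          not_true_eq_false]
        exact old fun ⟨_, _, _, h, _⟩ => h (Fin.ext c3)
      by_cases c4 : σ.arr aComp (L[k].1 : ℕ) = σ.arr aComp (L[k].2 : ℕ)
      · simp only [c2, c3, c4, if_true, if_false, ne_eq, one_ne_zero, not_false_eq_true,
          not_true_eq_false]
        exact old fun ⟨_, _, _, _, h⟩ => h c4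
      · simp only [c2, c3, c4, if_false, ne_eq, not_true_eq_false, RamState.reg_setReg, if_true]
        exact fun _ => ⟨hkL, fun h => c1 (hFk.2 h), fun h => c2 (congrArg Fin.val h),
          fun h => c3 (congrArg Fin.val h), c4⟩)
  simp only [LoopBound.val, M0] at this
  obtain ⟨i, hi, hgood⟩ := hex
  exact this ⟨i, hi, hi, hgood⟩

/-! ## Inside the loop -/

section Loop

variable {n : ℕ} {L : List (Fin n × Fin n)} {E2v F : Set (Fin n × Fin n)} {x : Fin n}
  {σ τ : RamState}

theorem Alg.InLoop.of_frame {p : ForProg} (h : InLoop L E2v F x σ) (hF : p.Frame σ τ)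
    (hp : (rN ∉ p.regs ∧ rM ∉ p.regs ∧ aSrc ∉ p.arrs ∧ aDst ∉ p.arrs) ∧ aE2v ∉ p.arrs ∧
      aE2t ∉ p.arrs ∧ rX ∉ p.regs) : InLoop L E2v F x τ := by
  obtain ⟨h1, h2, h3, h4, h5, h6, h7, h8⟩ := h
  obtain ⟨p1, p2, p3, p4⟩ := hp
  exact ⟨h1.of_frame hF p1, h2, h3.of_frame hF p2, h4, h5, h6.of_frame hF p3, h7,
    (hF.reg _ p4).trans h8⟩

/-- This property is inherited from `E2v ⊆ F`; it is what allows components to be computed from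
bridges. -/
theorem Alg.InLoop.stronglyConnectedOn (h : InLoop L E2v F x σ) : StronglyConnectedOn F ({x}ᶜ) :=
  (h.2.1.compl x).mono h.2.2.2.1

theorem Alg.InLoop.coreProg_flag (h : InLoop L E2v F x σ) :
    ((coreProg aE2t).den σ).reg rFlag ≠ 0 ↔ ¬ TwinlessSCOn F ({x}ᶜ) :=
  (coreProg_spec (by decide) h.1 h.2.2.2.2.1 h.2.2.2.2.2.1 h.2.2.2.2.2.2.2
    (by have := h.2.1.three_le; omega) h.stronglyConnectedOn).2

theorem Alg.InLoop.coreProg_components (h : InLoop L E2v F x σ) :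
    StoresComponents F x ((coreProg aE2t).den σ) := by
  intro v w hv hw
  rw [(coreProg_spec (by decide) h.1 h.2.2.2.2.1 h.2.2.2.2.2.1 h.2.2.2.2.2.2.2
    (by have := h.2.1.three_le; omega) h.stronglyConnectedOn).1 v w hv hw]
  exact (h.stronglyConnectedOn.exists_isTSCC_iff hv hw).symm

theorem Alg.InLoop.findProg_pick (h : InLoop L E2v F x σ)
    (hE : IsKVertexTwinlessConnected 2 (edgeSet L)) (hc : StoresComponents F x σ)
    (hF : ¬ TwinlessSCOn F ({x}ᶜ)) :
    ∃ h : (findProg.den σ).reg rPick < L.length, L[(findProg.den σ).reg rPick] ∉ F ∧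
      ∃ C D, IsTSCC F ({x}ᶜ) C ∧ IsTSCC F ({x}ᶜ) D ∧ C ≠ D ∧
        L[(findProg.den σ).reg rPick].1 ∈ C ∧ L[(findProg.den σ).reg rPick].2 ∈ D := by
  have hsc := h.stronglyConnectedOn
  have hex : ∃ i, ∃ h : i < L.length, L[i] ∉ F ∧ L[i].1 ≠ x ∧ L[i].2 ≠ x ∧
      σ.arr aComp L[i].1 ≠ σ.arr aComp L[i].2 := by
    -- The input graph minus `x` is twinless strongly connected, so it has an edge outside `F`
    -- between two classes.
    obtain ⟨p, hp, q, hq, hpqE, hpqF, hpq⟩ := exists_edge_not_sameSide hsc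
      ((isKVertexTwinlessConnected_two_iff.1 hE).2.2 x) hF
    obtain ⟨i, hi, hiL⟩ := List.getElem_of_mem hpqE
    refine ⟨i, hi, ?_⟩
    rw [hiL]
    refine ⟨hpqF, hp, hq, fun heq => hpq ?_⟩
    exact (hsc.exists_isTSCC_iff hp hq).1 ((hc p q hp hq).1 heq)
  obtain ⟨hlt, h1, h2, h3, h4⟩ := findProg_spec h.1 h.2.2.2.2.2.1 h.2.2.2.2.2.2.2 hex
  obtain ⟨C, hC, hC1, _⟩ := (hsc.exists_isTSCC_iff h2 h2).2 .rfl'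
  obtain ⟨D, hD, hD1, _⟩ := (hsc.exists_isTSCC_iff h3 h3).2 .rfl'
  refine ⟨hlt, h1, C, D, hC, hD, ?_, hC1, hD1⟩
  rintro rfl
  exact h4 ((hc _ _ h2 h3).2 ⟨C, hC, hC1, hD1⟩)

end Loop

/-- The subroutines of the algorithm. -/
def subroutines : Subroutines where
  minimalTwoVC := minimalProg.compile
  articulationPoints := articulationProg.compile
  testNotTSC := (coreProg aE2t).compile
  components := (coreProg aE2t).compile
  findEdge := findProg.compile

theorem subroutines_findEdge : subroutines.findEdge = findProg.compile := rfl

theorem subroutines_testNotTSC : subroutines.testNotTSC = (coreProg aE2t).compile := rfl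

/-- One program serves both for the test and for the components, since a single labelling pass also
reveals whether there is a bridge. -/
theorem subroutines_correct : subroutines.Correct where
  minimalTwoVC n L hL hE := ForProg.correct_compile (by decide) fun σ hσ =>
    ⟨keeps_of_frame (ForProg.frame_den _ _) (by decide) (by decide),
      minimalProg_spec hL hE.isKVertexConnected hσ⟩
  articulationPoints n L hL hE E2v hmin := ForProg.correct_compile (by decide) fun σ hσ =>
    ⟨keeps_of_frame (ForProg.frame_den _ _) (by decide) (by decide),
      articulationProg_spec hmin hσ.1 hσ.2⟩
  testNotTSC n L hL hE E2v F x := ForProg.correct_compile (by decide) fun σ hσ =>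
    ⟨keeps_of_frame (ForProg.frame_den _ _) (by decide) (by decide), hσ.coreProg_flag⟩
  components n L hL hE E2v F x hF := ForProg.correct_compile (by decide) fun σ hσ =>
    ⟨keeps_of_frame (ForProg.frame_den _ _) (by decide) (by decide), hσ.coreProg_components⟩
  findEdge n L hL hE E2v F x hF := ForProg.correct_compile (by decide) fun σ hσ =>
    ⟨keeps_of_frame (ForProg.frame_den _ _) (by decide) (by decide),
      hσ.1.findProg_pick hE hσ.2 hF⟩

/-! ## Running time -/

section Time

variable {n : ℕ} {L : List (Fin n × Fin n)} {E2v F : Set (Fin n × Fin n)} {x : Fin n}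

/-- The while-loop, after the first test. -/
theorem exec_while (hL : L.Nodup) (hE : IsKVertexTwinlessConnected 2 (edgeSet L)) {B : ℕ}
    (hB₁ : (coreProg aE2t).cost n L.length ≤ B) (hB₂ : findProg.cost n L.length ≤ B) :
    ∀ (d : ℕ) (F : Set (Fin n × Fin n)) (σ : RamState), (edgeSet L \ F).ncard = d →
      InLoop L E2v F x σ → (σ.reg rFlag ≠ 0 ↔ ¬ TwinlessSCOn F ({x}ᶜ)) →
      ∃ t τ F', RamExec (.loop (.reg rFlag)
          (.seq subroutines.components (.seq subroutines.findEdge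
            (.seq (.write aE2t (.reg rPick) (.lit 1)) subroutines.testNotTSC)))) σ t τ ∧
        InLoop L E2v F' x τ ∧ TwinlessSCOn F' ({x}ᶜ) ∧ F ⊆ F' ∧ τ.arr aTap = σ.arr aTap ∧
        t + (edgeSet L \ F').ncard * (3 * B + 5) ≤ 2 + d * (3 * B + 5) := by
  intro d
  induction d with
  | zero =>
    intro F σ hd h hflag
    -- When no edge is left to add, `F` contains the input graph, and the loop must have ended.
    have hsub : edgeSet L ⊆ F := by
      rw [Set.ncard_eq_zero] at hd
      exact Set.sdiff_eq_empty.1 hd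
    have hT : TwinlessSCOn F ({x}ᶜ) :=
      ((isKVertexTwinlessConnected_two_iff.1 hE).2.2 x).mono hsub
    refine ⟨_, σ, F, RamExec.loopFalse (by_contra fun h0 => hflag.1 h0 hT), h, hT, subset_rfl, rfl,
      ?_⟩
    rw [hd]
    simp [RamExpr.cost]
  | succ d ih =>
    intro F σ hd h hflag
    by_cases hT : TwinlessSCOn F ({x}ᶜ)
    · refine ⟨_, σ, F, RamExec.loopFalse (by_contra fun h0 => hflag.1 h0 hT), h, hT, subset_rfl,
        rfl, ?_⟩
      rw [hd]
      simp [RamExpr.cost]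
    · have f1 := ForProg.frame_den (coreProg aE2t) σ
      obtain ⟨t1, x1, b1⟩ := ForProg.exec_compile n L.length (coreProg aE2t) (by decide) σ h.1.1
        h.1.2.1
      have h1 := h.of_frame f1 (by decide)
      have c1 := h.coreProg_components
      set σ1 := (coreProg aE2t).den σ
      clear_value σ1
      have f2 := ForProg.frame_den findProg σ1
      obtain ⟨t2, x2, b2⟩ := ForProg.exec_compile n L.length findProg (by decide) σ1 h1.1.1
        h1.1.2.1
      have h2 := h1.of_frame f2 (by decide)
      obtain ⟨hlt, hnF, _⟩ := h1.findProg_pick hE c1 hT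
      set σ2 := findProg.den σ1
      obtain ⟨e, he⟩ : ∃ e, e = L[σ2.reg rPick] := ⟨_, rfl⟩
      rw [← he] at hnF
      clear_value σ2
      have heL : e ∈ edgeSet L := he ▸ List.getElem_mem hlt
      obtain ⟨σ3, hσ3⟩ : ∃ σ3, σ3 = σ2.setArr aE2t (σ2.reg rPick) 1 := ⟨_, rfl⟩
      have x3 : RamExec (.write aE2t (.reg rPick) (.lit 1)) σ2 3 σ3 := by
        rw [hσ3]
        exact RamExec.write aE2t (.reg rPick) (.lit 1) σ2
      have f3 := ForProg.frame_den (.write aE2t (.reg rPick) (.lit 1)) σ2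
      have hσ3' : ForProg.den (.write aE2t (.reg rPick) (.lit 1)) σ2 = σ3 := by rw [hσ3]; rfl
      rw [hσ3'] at f3
      have h3 : InLoop L E2v (insert e F) x σ3 := by
        obtain ⟨g1, g2, g3, g4, g5, g6, g7, g8⟩ := h2
        refine ⟨g1.of_frame f3 (by decide), g2, g3.of_frame f3 (by decide),
          g4.trans (Set.subset_insert _ _), Set.insert_subset heL g5, ?_, g7,
          (f3.reg rX (by decide)).trans g8⟩
        rw [hσ3, he]
        exact g6.insert hL hlt
      have f4 := ForProg.frame_den (coreProg aE2t) σ3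
      obtain ⟨t4, x4, b4⟩ := ForProg.exec_compile n L.length (coreProg aE2t) (by decide) σ3 h3.1.1
        h3.1.2.1
      have h4 := h3.of_frame f4 (by decide)
      have flag4 := h3.coreProg_flag
      set σ4 := (coreProg aE2t).den σ3
      clear_value σ4
      -- One missing edge fewer pays for this pass: three subroutine runs of at most `B`, 3 for the
      -- write and 2 for the loop test.
      have hd4 : (edgeSet L \ insert e F).ncard = d := by
        have : edgeSet L \ insert e F = (edgeSet L \ F) \ {e} := by
          rw [Set.sdiff_sdiff, Set.union_singleton]
        rw [this, Set.ncard_sdiff_singleton_of_mem (Set.mem_sdiff_of_mem heL hnF), hd]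
        rfl
      obtain ⟨t5, τ, F', x5, h5, hT5, hF5, tap5, b5⟩ := ih _ σ4 hd4 h4 flag4
      have hbody := RamExec.seq x1 (RamExec.seq x2 (RamExec.seq x3 x4))
      rw [← subroutines_findEdge, ← subroutines_testNotTSC] at hbody
      refine ⟨_, τ, F', RamExec.loopTrue (c := .reg rFlag) (hflag.2 hT) hbody x5, h5, hT5,
        (Set.subset_insert _ _).trans hF5, ?_, ?_⟩
      · rw [tap5, f4.arr aTap (by decide), f3.arr aTap (by decide), f2.arr aTap (by decide),
          f1.arr aTap (by decide)]
      · simp only [RamExpr.cost]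
        have : (d + 1) * (3 * B + 5) = d * (3 * B + 5) + (3 * B + 5) := by ring
        omega

/-- The for-loop. -/
theorem exec_for (hL : L.Nodup) (hE : IsKVertexTwinlessConnected 2 (edgeSet L)) {B : ℕ}
    (hB₁ : (coreProg aE2t).cost n L.length ≤ B) (hB₂ : findProg.cost n L.length ≤ B)
    (hmin : IsMinimalTwoVertexConnected (edgeSet L) E2v) :
    ∀ (j k : ℕ) (F : Set (Fin n × Fin n)) (σ : RamState), k + j = n → StoresGraph L σ →
      StoresEdges L aE2v E2v σ → E2v ⊆ F → F ⊆ edgeSet L → StoresEdges L aE2t F σ →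
      (∀ x : Fin n, σ.arr aTap x ≠ 0 ↔ IsTwinlessArticulationPoint E2v x) → σ.reg rX = k →
      (∀ y : Fin n, (y : ℕ) < k → TwinlessSCOn F ({y}ᶜ)) →
      ∃ t τ F', RamExec (.loop (.lt (.reg rX) (.reg rN))
          (.seq (.ite (.read aTap (.reg rX)) (whileLoop subroutines) .skip)
            (.assign rX (.add (.reg rX) (.lit 1))))) σ t τ ∧
        F ⊆ F' ∧ F' ⊆ edgeSet L ∧ StoresEdges L aE2t F' τ ∧
        (∀ y : Fin n, TwinlessSCOn F' ({y}ᶜ)) ∧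
        t + (edgeSet L \ F').ncard * (3 * B + 5) ≤
          4 + j * (B + 20) + (edgeSet L \ F).ncard * (3 * B + 5) := by
  intro j
  induction j with
  | zero =>
    intro k F σ hk hG hE2v hsub hFL hF htap hX hdone
    refine ⟨_, σ, F, RamExec.loopFalse ?_, subset_rfl, hFL, hF, fun y => hdone y (by omega), ?_⟩
    · rw [RamExpr.eval, RamExpr.eval, RamExpr.eval, hX, hG.1]
      simp [hk ▸ Nat.add_zero k]
    · simp [RamExpr.cost]
  | succ j ih =>
    intro k F σ hk hG hE2v hsub hFL hF htap hX hdone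
    have hkn : k < n := by omega
    have hcond : (RamExpr.lt (.reg rX) (.reg rN)).eval σ ≠ 0 := by
      rw [RamExpr.eval, RamExpr.eval, RamExpr.eval, hX, hG.1, if_pos hkn]
      exact one_ne_zero
    have htapx := htap ⟨k, hkn⟩
    have hread : (RamExpr.read aTap (.reg rX)).eval σ = σ.arr aTap k := by
      rw [RamExpr.eval, RamExpr.eval, hX]
    -- The passes are charged to the edges that they add, so a vertex itself pays for one test only.
    -- If it is no articulation point, `E2v` without it is already twinless strongly connected, and
    -- hence so is `F`.
    obtain ⟨t1, σ1, F1, x1, hF1, hG1, hE1, hFL1, hs1, hT1, tap1, X1, b1⟩ :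
        ∃ t τ F', RamExec (.ite (.read aTap (.reg rX)) (whileLoop subroutines) .skip) σ t τ ∧
          F ⊆ F' ∧ StoresGraph L τ ∧ StoresEdges L aE2v E2v τ ∧ F' ⊆ edgeSet L ∧
          StoresEdges L aE2t F' τ ∧ TwinlessSCOn F' ({(⟨k, hkn⟩ : Fin n)}ᶜ) ∧
          τ.arr aTap = σ.arr aTap ∧ τ.reg rX = k ∧
          t + (edgeSet L \ F').ncard * (3 * B + 5) ≤
            B + 8 + (edgeSet L \ F).ncard * (3 * B + 5) := by
      by_cases hap : IsTwinlessArticulationPoint E2v (⟨k, hkn⟩ : Fin n)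
      · have hin : InLoop L E2v F ⟨k, hkn⟩ σ := ⟨hG, hmin, hE2v, hsub, hFL, hF, hap, hX⟩
        have f0 := ForProg.frame_den (coreProg aE2t) σ
        obtain ⟨t0, x0, b0⟩ := ForProg.exec_compile n L.length (coreProg aE2t) (by decide) σ hG.1
          hG.2.1
        obtain ⟨t, τ, F', hx, hin', hT, hFF', htap', hb⟩ := exec_while hL hE hB₁ hB₂ _ F _ rfl
          (hin.of_frame f0 (by decide)) hin.coreProg_flag
        refine ⟨_, τ, F', RamExec.iteTrue (by rw [hread]; exact htapx.2 hap)
          (RamExec.seq x0 hx), hFF', hin'.1, hin'.2.2.1, hin'.2.2.2.2.1, hin'.2.2.2.2.2.1, hT, ?_,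
          hin'.2.2.2.2.2.2.2, ?_⟩
        · rw [htap', f0.arr aTap (by decide)]
        · simp only [RamExpr.cost]
          omega
      · refine ⟨_, σ, F, RamExec.iteFalse ?_ (RamExec.skip σ), subset_rfl, hG, hE2v, hFL, hF, ?_,
          rfl, hX, ?_⟩
        · rw [hread]
          exact by_contra fun h0 => hap (htapx.1 h0)
        · exact (not_not.1 hap).mono hsub
        · simp only [RamExpr.cost]
          omega
    have f2 := ForProg.frame_den (.assign rX (.add (.reg rX) (.lit 1))) σ1
    obtain ⟨t3, τ, F', x3, h1, h2, h3, h4, b3⟩ := ih (k + 1) F1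
      (ForProg.den (.assign rX (.add (.reg rX) (.lit 1))) σ1) (by omega)
      (hG1.of_frame f2 (by decide)) (hE1.of_frame f2 (by decide)) (hsub.trans hF1) hFL1
      (hs1.of_frame f2 (by decide)) (by rw [f2.arr aTap (by decide), tap1]; exact htap)
      (by rw [ForProg.den, RamExpr.eval, RamExpr.eval, RamExpr.eval, X1]; simp) (by
        intro y hy
        rcases Nat.lt_succ_iff_lt_or_eq.1 hy with hy | hy
        · exact (hdone y hy).mono hF1
        · have : y = ⟨k, hkn⟩ := Fin.ext hy
          rw [this]
          exact hT1)
    refine ⟨_, τ, F', RamExec.loopTrue hcond (RamExec.seq x1 (RamExec.assign _ _ _)) x3,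
      hF1.trans h1, h2, h3, h4, ?_⟩
    simp only [RamExpr.cost]
    have : (j + 1) * (B + 20) = j * (B + 20) + (B + 20) := by ring
    omega

/-- The loop that copies `E_{2v}` to `E_{2t}`. -/
def copyProg : ForProg := .count rI .edges (.write aE2t (.reg rI) (.read aE2v (.reg rI)))

theorem copyProg_spec {σ : RamState} (hG : StoresGraph L σ) (hF : StoresEdges L aE2v F σ) :
    StoresEdges L aE2t F (copyProg.den σ) := by
  have := ForProg.count_rule (r := rI) (b := .edges)
    (p := .write aE2t (.reg rI) (.read aE2v (.reg rI))) (σ := σ)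
    (fun k τ => ∀ i < k, τ.arr aE2t i = σ.arr aE2v i) (fun i hi => absurd hi (by omega)) (by
      intro k hk τ hFr hr hI i hi
      have e1 := hFr.arr aE2v (by decide)
      rw [ForProg.den, RamExpr.eval, RamExpr.eval, RamExpr.eval, hr, e1, RamState.arr_setReg,
        RamState.arr_setArr, if_pos rfl, Function.update_apply]
      split_ifs with h
      · rw [h]
      · exact hI i (by omega))
  simp only [LoopBound.val, hG.2.1] at this
  intro i hi
  rw [copyProg, this i hi]
  exact hF i hi

/-- The edges missing in `E_{2v}` bound the number of passes over all vertices together, whence the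
summand `L.length * (3 * B + 5)`. Strong connectivity of the output comes from `E_{2v}`. -/
theorem exec_approx (hL : L.Nodup) (hE : IsKVertexTwinlessConnected 2 (edgeSet L)) {B : ℕ}
    (hB₁ : (coreProg aE2t).cost n L.length ≤ B) (hB₂ : findProg.cost n L.length ≤ B) {σ : RamState}
    (hG : StoresGraph L σ) :
    ∃ t τ F, RamExec (approx subroutines) σ t τ ∧ F ⊆ edgeSet L ∧ StoresEdges L aE2t F τ ∧
      IsKVertexTwinlessConnected 2 F ∧
      t ≤ minimalProg.cost n L.length + copyProg.cost n L.length +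
        articulationProg.cost n L.length + 6 + n * (B + 20) + L.length * (3 * B + 5) := by
  obtain ⟨t1, x1, b1⟩ := ForProg.exec_compile n L.length minimalProg (by decide) σ hG.1 hG.2.1
  have f1 := ForProg.frame_den minimalProg σ
  obtain ⟨E2v, hmin, s1⟩ := minimalProg_spec hL hE.isKVertexConnected hG
  have g1 := hG.of_frame f1 (by decide)
  set σ1 := minimalProg.den σ
  clear_value σ1
  obtain ⟨t2, x2, b2⟩ := ForProg.exec_compile n L.length copyProg (by decide) σ1 g1.1 g1.2.1
  have f2 := ForProg.frame_den copyProg σ1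
  have c2 := copyProg_spec g1 s1
  have g2 := g1.of_frame f2 (by decide)
  have s2 := s1.of_frame f2 (by decide)
  set σ2 := copyProg.den σ1
  clear_value σ2
  obtain ⟨t3, x3, b3⟩ := ForProg.exec_compile n L.length articulationProg (by decide) σ2 g2.1 g2.2.1
  have f3 := ForProg.frame_den articulationProg σ2
  have a3 := articulationProg_spec hmin g2 s2
  have g3 := g2.of_frame f3 (by decide)
  have s3 := s2.of_frame f3 (by decide)
  have c3 := c2.of_frame f3 (by decide)
  set σ3 := articulationProg.den σ2
  clear_value σ3
  have f4 := ForProg.frame_den (.assign rX (.lit 0)) σ3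
  obtain ⟨t4, τ, F, x4, h1, h2, h3, h4, b4⟩ := exec_for hL hE hB₁ hB₂ hmin n 0 E2v
    (ForProg.den (.assign rX (.lit 0)) σ3) (by omega) (g3.of_frame f4 (by decide))
    (s3.of_frame f4 (by decide)) subset_rfl hmin.1.1 (c3.of_frame f4 (by decide))
    (by rw [f4.arr aTap (by decide)]; exact a3) (by simp) (fun y hy => absurd hy (by omega))
  refine ⟨_, τ, F, RamExec.seq x1 (RamExec.seq x2 (RamExec.seq x3
    (RamExec.seq (RamExec.assign _ _ _) x4))), h2, h3, ?_, ?_⟩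
  · rw [isKVertexTwinlessConnected_two_iff]
    have hcard := hmin.1.2.2.1
    exact ⟨twinlessSCOn_univ_of_compl hcard h4 (hmin.1.2.1.mono h1), hcard, h4⟩
  · have hcard : (edgeSet L \ E2v).ncard ≤ L.length := by
      have h5 : edgeSet L = (L.toFinset : Set (Fin n × Fin n)) := by
        ext e
        simp [edgeSet]
      calc (edgeSet L \ E2v).ncard ≤ (edgeSet L).ncard := Set.ncard_le_ncard Set.sdiff_subset
        _ = L.toFinset.card := by rw [h5, Set.ncard_coe_finset]
        _ ≤ L.length := L.toFinset_card_le
    have := Nat.mul_le_mul_right (3 * B + 5) hcard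
    simp only [RamExpr.cost]
    omega

end Time

/-! ### Summing up the running time -/

/-- The bound on the running time in terms of `n` and `m`. -/
theorem exists_time_bound : ∃ K : ℕ, ∀ n m : ℕ, 3 ≤ n → n ≤ m → m ≤ n ^ 2 →
    ∃ B, (coreProg aE2t).cost n m ≤ B ∧ findProg.cost n m ≤ B ∧
      minimalProg.cost n m + copyProg.cost n m + articulationProg.cost n m + 6 + n * (B + 20) +
        m * (3 * B + 5) ≤ K * (n ^ 2 * m) := by
  obtain ⟨c1, hc1⟩ : ∃ c, c = (coreProg aE2t).coeff + findProg.coeff := ⟨_, rfl⟩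
  obtain ⟨c2, hc2⟩ : ∃ c, c = dropProg.coeff := ⟨_, rfl⟩
  obtain ⟨c3, hc3⟩ : ∃ c, c = (coreProg aE2v ;; .write aTap (.reg rX) (.reg rFlag)).coeff :=
    ⟨_, rfl⟩
  -- `c2` pays for `m` trial deletions, `c3` for `n` articulation tests, `c1` for the `n` first
  -- tests, `3 * c1` for at most `m` passes, and 200 for the terms of lower order.
  refine ⟨c2 + 4 * c1 + c3 + 200, fun n m hn hnm hm => ⟨c1 * n ^ 2, ?_, ?_, ?_⟩⟩
  · refine (ForProg.cost_le (by omega) hm _).trans ?_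
    rw [hc1, show (coreProg aE2t).deg = 2 by decide]
    exact Nat.mul_le_mul_right _ (Nat.le_add_right _ _)
  · refine (ForProg.cost_le (by omega) hm _).trans ?_
    rw [hc1, show findProg.deg = 2 by decide]
    exact Nat.mul_le_mul_right _ (Nat.le_add_left _ _)
  · have d2 : dropProg.cost n m ≤ c2 * n ^ 2 := by
      have := ForProg.cost_le (show 1 ≤ n by omega) hm dropProg
      rwa [← hc2, show dropProg.deg = 2 by decide] at this
    have d3 : (coreProg aE2v ;; .write aTap (.reg rX) (.reg rFlag)).cost n m ≤ c3 * n ^ 2 := by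
      have := ForProg.cost_le (show 1 ≤ n by omega) hm
        (coreProg aE2v ;; .write aTap (.reg rX) (.reg rFlag))
      rwa [← hc3, show (coreProg aE2v ;; .write aTap (.reg rX) (.reg rFlag)).deg = 2 by decide]
        at this
    have e1 : minimalProg.cost n m = 8 + m * 13 + (8 + m * (dropProg.cost n m + 10)) := rfl
    have e2 : copyProg.cost n m = 8 + m * 14 := rfl
    have e3 : articulationProg.cost n m =
        8 + n * ((coreProg aE2v ;; .write aTap (.reg rX) (.reg rFlag)).cost n m + 10) := rfl
    rw [e1, e2, e3]
    have m2 := Nat.mul_le_mul_left m (Nat.add_le_add_right d2 10)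
    have m3 := Nat.mul_le_mul_left n (Nat.add_le_add_right d3 10)
    obtain ⟨Q, hQ⟩ : ∃ Q, Q = n ^ 2 * m := ⟨_, rfl⟩
    have q1 : n * n ^ 2 ≤ Q := by rw [hQ, mul_comm n]; exact Nat.mul_le_mul_left _ hnm
    have q2 : m ≤ Q := by rw [hQ]; exact Nat.le_mul_of_pos_left _ (by positivity)
    have r1 : m * (c2 * n ^ 2 + 10) = c2 * Q + 10 * m := by rw [hQ]; ring
    have r2 : n * (c3 * n ^ 2 + 10) = c3 * (n * n ^ 2) + 10 * n := by ring
    have r3 : n * (c1 * n ^ 2 + 20) = c1 * (n * n ^ 2) + 20 * n := by ring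
    have r4 : m * (3 * (c1 * n ^ 2) + 5) = 3 * (c1 * Q) + 5 * m := by rw [hQ]; ring
    have r5 := Nat.mul_le_mul_left c3 q1
    have r6 := Nat.mul_le_mul_left c1 q1
    have r7 : (c2 + 4 * c1 + c3 + 200) * Q = c2 * Q + 4 * (c1 * Q) + c3 * Q + 200 * Q := by ring
    rw [← hQ, r7]
    omega

theorem Alg.storesGraph_initState {n : ℕ} (L : List (Fin n × Fin n)) :
    StoresGraph L (initState n L) := by
  refine ⟨by simp [initState], by simp [initState], fun i hi => ?_⟩
  simp [initState, hi]

theorem theorem2 :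
    ∃ P : Alg.Subroutines, P.Correct ∧
      ∃ K : ℕ, ∀ (n : ℕ) (E : Finset (Fin n × Fin n)),
        IsKVertexTwinlessConnected 2 (E : Set (Fin n × Fin n)) →
        ∀ L : List (Fin n × Fin n), L.Nodup → L.toFinset = E →
          ∃ (t : ℕ) (τ : RamState),
            RamExec (Alg.approx P) (Alg.initState n L) t τ ∧
            t ≤ K * (n ^ 2 * E.card) ∧
            ∃ E2t : Set (Fin n × Fin n), E2t ⊆ (E : Set (Fin n × Fin n)) ∧
              Alg.StoresEdges L Alg.aE2t E2t τ ∧ IsKVertexTwinlessConnected 2 E2t := by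
  obtain ⟨K, hK⟩ := exists_time_bound
  refine ⟨subroutines, subroutines_correct, K, fun n E hE L hL hLE => ?_⟩
  have hset : (E : Set (Fin n × Fin n)) = edgeSet L := by
    ext e
    simp [edgeSet, ← hLE]
  have hcard : E.card = L.length := by rw [← hLE, List.toFinset_card_of_nodup hL]
  have hn : 3 ≤ n := by simpa using hE.2.1
  -- Both comparisons matter: `n ≤ m` absorbs the cubic terms, and `m ≤ n ^ 2` bounds the edge loops
  -- inside the subroutines.
  have hnm : n ≤ E.card := by simpa using hE.isKVertexConnected.card_le
  have hmn : E.card ≤ n ^ 2 := by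
    have := Finset.card_le_univ E
    simpa [Fintype.card_prod, sq] using this
  rw [hset] at hE ⊢
  rw [hcard] at hnm hmn ⊢
  obtain ⟨B, hB₁, hB₂, hB⟩ := hK n L.length hn hnm hmn
  obtain ⟨t, τ, F, hx, hF, hs, hT, ht⟩ := exec_approx hL hE hB₁ hB₂ (storesGraph_initState L)
  exact ⟨t, τ, hx, ht.trans hB, F, hF, hs, hT⟩
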